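/- **Setting.** Let $G$ be a finite group, represented on spin chains $(\mathbb C^d)^{\otimes N}$ ($N\ge 1$) by matrix product unitaries $U_g$ with injective tensors $T_g$ ($U_gU_h=U_{gh}$, $U_e=1$ for all $N$). Let $(\psi_x)_{x\in I}$ be a non-empty finite family of matrix product states with injective tensors $A_x$, permuted transitively: $U_g\psi_x=\psi_{gx}$. Let $e_{x,y}\neq 0$ ($x,y\in I$) be domain wall tensors, and let $\psi(x,y)=\sum \mathrm{Tr}[e_{xy}^{i_1}A_y^{i_2}\cdots A_y^{i_{l-1}}e_{yx}^{i_l}A_x^{i_{l+1}}\cdots A_x^{i_N}]\,|i_1\dots i_N\rangle$ satisfy $U_g\psi(x,y)\propto\psi(gx,gy)$ for sufficiently separated walls. A *local reduction* (of nilpotency length $r$) of a tensor $C$ to a tensor $A$ is a pair $(\widehat V,V)$ with $\widehat V C^{w}V=A^{w}$ for all words $w$ and $C^{u}C^{w}C^{u'}=C^{u}VA^{w}\widehat VC^{u'}$ for non-empty $w$ and $|u|=|u'|=r$ (with $C^{w}=C^{w_1}\cdots C^{w_m}$; $r=1$ after blocking). *Fusion tensors* $V_{g,h}$ are local reductions of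 the product of $T_g$ with $T_h$ to $T_{gh}$; *action tensors* $W_{g,x}$ are local reductions of $T_g$ acting on $A_x$ to $A_{gx}$. Nonzero scalars $\omega$, $L$, $B$ are defined as follows, where the first two identities hold after multiplication from the left by $3r$ columns of the stacked tensors: $$(1\otimes V_{h,k})V_{g,hk}=\omega(g,h,k)\,(V_{g,h}\otimes 1)V_{gh,k},\qquad (V_{g,h}\otimes 1)W_{gh,x}=L^x_{g,h}\,(1\otimes W_{h,x})W_{g,hx},$$ and $B^g_{y,x}$ is the factor by which $r$ columns $T_gA_y$, one column $T_ge_{y,x}$ and $r$ columns $T_gA_x$, placed between $\widehat W_{g,y}$ and $W_{g,x}$, reduce to $r$ tensors $A_{gy}$, $e_{gy,gx}$ and $r$ tensors $A_{gx}$. **Statement.** Fusion and action tensors exist for some common $r$. For any choice of them (with any $r$), $\omega$, $L$ and $B$ exist and are unique, and $\omega$ is a 3-cocycle: $\omega(g,h,k)\,\omega(g,hk,l)\,\omega(h,k,l)=\omega(gh,k,l)\,\omega(g,h,kl)$. Let $g\in G\setminus H$, where $H=\{h: hx=x\ \forall x\in I\}$ is the unbroken subgroup, and let $o(g)$ be the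 order of $g$. There is a phase $\Theta$, $|\Theta|=1$, such that for every $x\in I$ and all choices of fusion and action tensors (so $\Theta$ is gauge invariant and independent of the ground state) $$\Theta=\prod_{i=1}^{o(g)}B^g_{g^ix,\,g^{i-1}x}=\prod_{i=1}^{o(g)}\frac{L^{gx}_{g,g^i}}{L^x_{g,g^i}}=\prod_{i=1}^{o(g)}\omega^{-1}(g,g^i,g),\qquad \prod_{i=1}^{o(g)}B^g_{g^{i-1}x,\,g^{i}x}=\Theta^{-1}.$$ In a gauge with $B^e_{gx,x}=1$ the factor $i=o(g)$ of the product of $L$-symbols is trivial, so that this product may be taken over $1\le i\le o(g)-1$. If $\omega$ is a coboundary, in particular if the symmetry is on-site ($U_h=u_h^{\otimes N}$ for all $h\in G$ and $N\ge1$), then $\Theta=1$. $\Theta$ is the phase of the cyclic interchange of $n=o(g)+1$ domain walls. Let $\hat A$ be a left inverse of the block tensor $\bigoplus_xA_x$. On a segment of sites let $O^{[k]}_{a}$ be the operator that has at site $k$ the endpoint tensor $\sum_x \hat A_x W_{g,x}e_{gx,x}$ (on block $x$ it replaces $A_x$ by $W_{g,x}e_{gx,x}$), has $T_g$ on all sites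 to the left of $k$, with the last bond contracted with a vector $a$, and is the identity to the right of $k$. If the sites $k_1<k_2<\dots<k_n$ are sufficiently far from each other and from the left end of the segment (at a distance depending on $g$ and $r$, but not on the segment, the vectors $a_j$ or $x$), then for arbitrary outer bond indices of $\psi_x$ $$O^{[k_n]}_{a_n}\cdots O^{[k_2]}_{a_2}O^{[k_1]}_{a_1}|\psi_x\rangle=\Theta\;O^{[k_1]}_{a_n}O^{[k_n]}_{a_{n-1}}\cdots O^{[k_2]}_{a_1}|\psi_x\rangle .$$ For the mirror-image operators (endpoint $\sum_x\hat A_x e_{x,gx}\widehat W_{g,x}$, string of $T_g$ to the right, $k_1>\dots>k_n$ far from each other and from the right end) the same identity holds with $\prod_{i=1}^{o(g)}B^g_{g^{i-1}x,\,g^ix}=\Theta^{-1}$ in place of $\Theta$. -/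

import Mathlib

open scoped Matrix Kronecker

noncomputable section

namespace DomainWall

/-! ### Tensors, matrix product states and matrix product operators -/

/-- The product `B^{i₁} ⋯ B^{iₘ}` along the word `i₁ … iₘ`. -/
def word {σ n : Type*} [Fintype n] [DecidableEq n] (B : σ → Matrix n n ℂ) (w : List σ) :
    Matrix n n ℂ :=
  (w.map B).prod

/-- `Ahat` is a left inverse of the tensor `A`, read as a linear map from the virtual space
(pairs of bond indices) to the physical space `ℂ^σ`. -/
def IsLeftInverse {σ n : Type*} [Fintype σ] [DecidableEq n]
    (Ahat A : σ → Matrix n n ℂ) : Prop :=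
  ∀ a b a' b' : n, ∑ i, Ahat i a b * A i a' b' = if a = a' ∧ b = b' then 1 else 0

/-- Injective tensor: it has a left inverse as a map from the virtual to the physical space. -/
def IsInjective {σ n : Type*} [Fintype σ] [DecidableEq n] (A : σ → Matrix n n ℂ) : Prop :=
  ∃ Ahat : σ → Matrix n n ℂ, IsLeftInverse Ahat A

/-- The periodic matrix product state `∑ Tr[A^{s₁} ⋯ A^{s_N}] |s₁ … s_N⟩`. -/
def mps {d m : ℕ} (A : Fin d → Matrix (Fin m) (Fin m) ℂ) (N : ℕ) : (Fin N → Fin d) → ℂ :=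
  fun s => (word A (List.ofFn s)).trace

/-- The periodic matrix product operator
`∑ Tr[T^{s₁t₁} ⋯ T^{s_N t_N}] |s₁ … s_N⟩⟨t₁ … t_N|`. -/
def mpo {d m : ℕ} (T : Fin d → Fin d → Matrix (Fin m) (Fin m) ℂ) (N : ℕ) :
    Matrix (Fin N → Fin d) (Fin N → Fin d) ℂ :=
  fun s t => ((List.ofFn fun l => T (s l) (t l)).prod).trace

/-- The column obtained by placing one operator tensor above another. -/
def stack {d : ℕ} {m n : Type*}
    (T : Fin d → Fin d → Matrix m m ℂ) (T' : Fin d → Fin d → Matrix n n ℂ) :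
    Fin d × Fin d → Matrix (m × n) (m × n) ℂ :=
  fun p => ∑ k, T p.1 k ⊗ₖ T' k p.2

/-- The column obtained by placing an operator tensor above a (possibly rectangular) state
tensor. -/
def act {d : ℕ} {m n n' : Type*}
    (T : Fin d → Fin d → Matrix m m ℂ) (A : Fin d → Matrix n n' ℂ) :
    Fin d → Matrix (m × n) (m × n') ℂ :=
  fun i => ∑ j, T i j ⊗ₖ A j

/-- `(Vh, V)` locally reduces the tensor `B` to the tensor `A`: sandwiching any word of `B`'s
between `Vh` and `V` gives the word of `A`'s (in particular `Vh * V = 1`), and inside a longer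
word of `B`'s, at distance `r` from both ends, a word of `B`'s may be replaced by
`V A ⋯ A Vh`. Here `r` is the nilpotency length; blocking `r` sites brings it down to `1`. -/
structure IsReduction {σ n m : Type*} [Fintype n] [DecidableEq n] [Fintype m] [DecidableEq m]
    (r : ℕ) (B : σ → Matrix n n ℂ) (A : σ → Matrix m m ℂ)
    (Vh : Matrix m n ℂ) (V : Matrix n m ℂ) : Prop where
  contract : ∀ w : List σ, Vh * word B w * V = word A w
  expand : ∀ u w v : List σ, u.length = r → v.length = r → w ≠ [] →
    word B u * word B w * word B v = word B u * V * word A w * Vh * word B v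

/-! ### Matrix product unitary representations, ground states and their local tensors -/

/-- A representation of `G` by matrix product unitaries given by injective tensors `T g`. -/
structure MPURep (G : Type*) [Group G] (d : ℕ) where
  /-- bond dimensions -/
  χ : G → ℕ
  /-- the local tensors -/
  T : ∀ g, Fin d → Fin d → Matrix (Fin (χ g)) (Fin (χ g)) ℂ
  injective : ∀ g, IsInjective (fun p : Fin d × Fin d => T g p.1 p.2)
  unitary : ∀ g N, 0 < N → mpo (T g) N ∈ Matrix.unitaryGroup (Fin N → Fin d) ℂ
  map_mul : ∀ g h N, 0 < N → mpo (T g) N * mpo (T h) N = mpo (T (g * h)) N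
  map_one : ∀ N, 0 < N → mpo (T 1) N = 1

/-- On-site symmetry: each unitary is a tensor power `u_g ⊗ ⋯ ⊗ u_g`. -/
def MPURep.IsOnSite {G : Type*} [Group G] {d : ℕ} (U : MPURep G d) : Prop :=
  ∃ u : G → Matrix (Fin d) (Fin d) ℂ, ∀ g N, 0 < N →
    ∀ s t : Fin N → Fin d, mpo (U.T g) N s t = ∏ l, u g (s l) (t l)

/-- Injective matrix product states `ψ_x` that are permuted by the unitaries,
`U_g ψ_x = ψ_{g x}`. -/
structure GroundStates {G : Type*} [Group G] {d : ℕ} (U : MPURep G d)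
    (I : Type*) [MulAction G I] where
  /-- bond dimensions -/
  D : I → ℕ
  /-- the local tensors -/
  A : ∀ x, Fin d → Matrix (Fin (D x)) (Fin (D x)) ℂ
  injective : ∀ x, IsInjective (A x)
  permute : ∀ (g : G) (x : I) N, 0 < N → mpo (U.T g) N *ᵥ mps (A x) N = mps (A (g • x)) N

/-- The unbroken subgroup: the elements that fix every ground state. -/
def unbroken (G I : Type*) [Group G] [MulAction G I] : Subgroup G :=
  (MulAction.toPermHom G I).ker

/-- Fusion tensors: for all `g, h` a local reduction of the product of the tensors of `U_g` and
`U_h` to the tensor of `U_{gh}`. -/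
structure FusionTensors {G : Type*} [Group G] {d : ℕ} (U : MPURep G d) (r : ℕ) where
  V : ∀ g h, Matrix (Fin (U.χ g) × Fin (U.χ h)) (Fin (U.χ (g * h))) ℂ
  Vh : ∀ g h, Matrix (Fin (U.χ (g * h))) (Fin (U.χ g) × Fin (U.χ h)) ℂ
  isReduction : ∀ g h, IsReduction r (stack (U.T g) (U.T h))
    (fun p : Fin d × Fin d => U.T (g * h) p.1 p.2) (Vh g h) (V g h)

/-- Action tensors: for all `g, x` a local reduction of the action of the tensor of `U_g` on the
tensor of `ψ_x` to the tensor of `ψ_{gx}`. -/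
structure ActionTensors {G : Type*} [Group G] {d : ℕ} {U : MPURep G d}
    {I : Type*} [MulAction G I] (S : GroundStates U I) (r : ℕ) where
  W : ∀ (g : G) (x : I), Matrix (Fin (U.χ g) × Fin (S.D x)) (Fin (S.D (g • x))) ℂ
  Wh : ∀ (g : G) (x : I), Matrix (Fin (S.D (g • x))) (Fin (U.χ g) × Fin (S.D x)) ℂ
  isReduction : ∀ g x, IsReduction r (act (U.T g) (S.A x)) (S.A (g • x)) (Wh g x) (W g x)

/-- `ω(g,h,k)` compares the two ways of fusing three operator tensors (on `3 r` columns):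
`h` with `k` first and then `g`, versus `g` with `h` first and then `k`. -/
def IsAssociator {G : Type*} [Group G] {d r : ℕ} {U : MPURep G d} (F : FusionTensors U r)
    (ω : G → G → G → ℂˣ) : Prop :=
  ∀ g h k, ∀ w : List (Fin d × Fin d), w.length = 3 * r →
    word (stack (fun i j => stack (U.T g) (U.T h) (i, j)) (U.T k)) w
        * ((1 : Matrix (Fin (U.χ g)) (Fin (U.χ g)) ℂ) ⊗ₖ F.V h k).submatrix
            (Equiv.prodAssoc _ _ _) id
        * (F.V g (h * k)).submatrix id (Fin.cast (congrArg U.χ (mul_assoc g h k)))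
      = (ω g h k : ℂ) •
        (word (stack (fun i j => stack (U.T g) (U.T h) (i, j)) (U.T k)) w
          * (F.V g h ⊗ₖ (1 : Matrix (Fin (U.χ k)) (Fin (U.χ k)) ℂ))
          * F.V (g * h) k)

/-- The `L`-symbol `L x g h` (written `L^x_{g,h}`) compares the two ways of letting two operator
tensors act on the tensor of `ψ_x` (on `3 r` columns): fusing `g` with `h` first, versus acting
with `h` first and then with `g`. -/
def IsLSymbol {G : Type*} [Group G] {d r : ℕ} {U : MPURep G d} {I : Type*} [MulAction G I]
    {S : GroundStates U I} (F : FusionTensors U r) (W : ActionTensors S r)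
    (L : I → G → G → ℂˣ) : Prop :=
  ∀ x g h, ∀ w : List (Fin d), w.length = 3 * r →
    word (act (fun i j => stack (U.T g) (U.T h) (i, j)) (S.A x)) w
        * (F.V g h ⊗ₖ (1 : Matrix (Fin (S.D x)) (Fin (S.D x)) ℂ))
        * W.W (g * h) x
      = (L x g h : ℂ) •
        (word (act (fun i j => stack (U.T g) (U.T h) (i, j)) (S.A x)) w
          * ((1 : Matrix (Fin (U.χ g)) (Fin (U.χ g)) ℂ) ⊗ₖ W.W h x).submatrix
              (Equiv.prodAssoc _ _ _) id
          * (W.W g (h • x)).submatrix id (Fin.cast (congrArg S.D (mul_smul g h x))))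

/-- The 3-cocycle condition. -/
def IsCocycle {G : Type*} [Group G] (ω : G → G → G → ℂˣ) : Prop :=
  ∀ g h k l, ω g h k * ω g (h * k) l * ω h k l = ω (g * h) k l * ω g h (k * l)

/-- Triviality of a 3-cocycle: it is a coboundary. -/
def IsCoboundary {G : Type*} [Group G] (ω : G → G → G → ℂˣ) : Prop :=
  ∃ β : G → G → ℂˣ, ∀ g h k, ω g h k = β h k * β g (h * k) / (β g h * β (g * h) k)

/-! ### Domain walls -/

/-- Domain wall tensors `e x y`, with the `x`-domain on the left and the `y`-domain on the
right. -/
abbrev WallTensors {G : Type*} [Group G] {d : ℕ} {U : MPURep G d} {I : Type*} [MulAction G I]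
    (S : GroundStates U I) : Type _ :=
  ∀ x y : I, Fin d → Matrix (Fin (S.D x)) (Fin (S.D y)) ℂ

section Walls

variable {G : Type*} [Group G] {d : ℕ} {U : MPURep G d} {I : Type*} [MulAction G I]
  {S : GroundStates U I}

/-- The periodic state `∑ Tr[e_{xy} A_y ⋯ A_y e_{yx} A_x ⋯ A_x] |s⟩` with `a` tensors `A_y` and
`b` tensors `A_x`. -/
def wallState (e : WallTensors S) (x y : I) (a b : ℕ) : (Fin (a + b + 2) → Fin d) → ℂ :=
  fun s =>
    (e x y (s ⟨0, by omega⟩)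
      * word (S.A y) (List.ofFn fun l : Fin a => s ⟨l + 1, by omega⟩)
      * e y x (s ⟨a + 1, by omega⟩)
      * word (S.A x) (List.ofFn fun l : Fin b => s ⟨a + 2 + l, by omega⟩)).trace

/-- The unitaries permute the domain walls: `U_g ψ(x,y) ∝ ψ(gx,gy)` for every pair of
sufficiently separated domain walls. -/
def PermutesWalls (e : WallTensors S) : Prop :=
  ∀ (g : G) (x y : I), ∃ ℓ : ℕ, ∀ a b : ℕ, ℓ ≤ a → ℓ ≤ b →
    ∃ c : ℂ, mpo (U.T g) (a + b + 2) *ᵥ wallState e x y a b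
      = c • wallState e (g • x) (g • y) a b

/-- The factors `B g y x` (written `B^g_{y,x}`) by which the symmetry locally maps the domain wall
`e_{y,x}` to `e_{gy,gx}`. -/
def IsWallPhase {r : ℕ} (W : ActionTensors S r) (e : WallTensors S)
    (B : G → I → I → ℂˣ) : Prop :=
  ∀ (g : G) (y x : I) (u v : List (Fin d)) (i : Fin d), u.length = r → v.length = r →
    W.Wh g y * word (act (U.T g) (S.A y)) u * act (U.T g) (e y x) i
        * word (act (U.T g) (S.A x)) v * W.W g x
      = (B g y x : ℂ) •
        (word (S.A (g • y)) u * e (g • y) (g • x) i * word (S.A (g • x)) v)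

/-- `Ahat` is a left inverse of the block tensor `⨁ₓ A_x`: `Ahat x` inverts `A_x` and annihilates
the other blocks. -/
def IsBlockLeftInverse (S : GroundStates U I)
    (Ahat : ∀ x, Fin d → Matrix (Fin (S.D x)) (Fin (S.D x)) ℂ) : Prop :=
  (∀ x, IsLeftInverse (Ahat x) (S.A x)) ∧
  ∀ x y, x ≠ y → ∀ a b a' b', ∑ i, Ahat x i a b * S.A y i a' b' = 0

variable [Fintype I]

/-- The left endpoint of a `g`-string (one open bond index `c`, to the right): on the block `x` it
replaces the tensor `A_x` by the domain wall `e_{x,gx}` followed by the action tensor. -/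
def leftEnd {r : ℕ} (W : ActionTensors S r) (e : WallTensors S)
    (Ahat : ∀ x, Fin d → Matrix (Fin (S.D x)) (Fin (S.D x)) ℂ) (g : G) (s t : Fin d) :
    Fin (U.χ g) → ℂ :=
  fun c => ∑ x, ∑ α, ∑ β, ∑ δ, Ahat x t α β * e x (g • x) s α δ * W.Wh g x δ (c, β)

/-- The right endpoint of a `g`-string (one open bond index `c`, to the left): on the block `x` it
replaces the tensor `A_x` by the action tensor followed by the domain wall `e_{gx,x}`. -/
def rightEnd {r : ℕ} (W : ActionTensors S r) (e : WallTensors S)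
    (Ahat : ∀ x, Fin d → Matrix (Fin (S.D x)) (Fin (S.D x)) ℂ) (g : G) (s t : Fin d) :
    Fin (U.χ g) → ℂ :=
  fun c => ∑ x, ∑ α, ∑ β, ∑ δ, Ahat x t α β * W.W g x (c, α) δ * e (g • x) x s δ β

/-- The operator on `N` sites that creates a `g`-domain wall at site `k` by a left endpoint at `k`
and a string of operator tensors on all sites to the right of `k`, the open bond at the right
end of the segment being contracted with the vector `a`. It is the identity to the left of `k`. -/
def leftWallOp {r : ℕ} (W : ActionTensors S r) (e : WallTensors S)
    (Ahat : ∀ x, Fin d → Matrix (Fin (S.D x)) (Fin (S.D x)) ℂ) (g : G) {N : ℕ}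
    (k : Fin N) (a : Fin (U.χ g) → ℂ) : Matrix (Fin N → Fin d) (Fin N → Fin d) ℂ :=
  fun s t => if ∀ l, l < k → s l = t l then
    (leftEnd W e Ahat g (s k) (t k) ᵥ*
      (List.ofFn fun l => if k < l then U.T g (s l) (t l) else 1).prod) ⬝ᵥ a
  else 0

/-- The mirror image of `leftWallOp`: a right endpoint at `k` and a string on all sites to the left
of `k`, the open bond at the left end of the segment being contracted with `a`. -/
def rightWallOp {r : ℕ} (W : ActionTensors S r) (e : WallTensors S)
    (Ahat : ∀ x, Fin d → Matrix (Fin (S.D x)) (Fin (S.D x)) ℂ) (g : G) {N : ℕ}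
    (k : Fin N) (a : Fin (U.χ g) → ℂ) : Matrix (Fin N → Fin d) (Fin N → Fin d) ℂ :=
  fun s t => if ∀ l, k < l → s l = t l then
    a ⬝ᵥ ((List.ofFn fun l => if l < k then U.T g (s l) (t l) else 1).prod *ᵥ
      rightEnd W e Ahat g (s k) (t k))
  else 0

/-- The ground state `ψ_x` on a segment of `N` sites, with the two outer bond indices fixed to `p`
and `q`. -/
def segmentState (S : GroundStates U I) (x : I) (N : ℕ) (p q : Fin (S.D x)) :
    (Fin N → Fin d) → ℂ :=
  fun s => word (S.A x) (List.ofFn s) p q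

end Walls

/-- The product `O n * ⋯ * O 1 * O 0`: the operator `O 0` acts first. -/
def orderedProd {ι : Type*} [Fintype ι] [DecidableEq ι] {n : ℕ}
    (O : Fin (n + 1) → Matrix ι ι ℂ) : Matrix ι ι ℂ :=
  (List.ofFn O).reverse.prod

end DomainWall

end

noncomputable section

set_option linter.unusedSectionVars false

namespace DomainWall

/-! ### Words -/

section Words

variable {σ n m k : Type*} [Fintype n] [DecidableEq n] [Fintype m] [DecidableEq m]
  [Fintype k] [DecidableEq k]

/-! The argument rests on the rigidity of local reductions. The letters of an injective tensor `A`
span the full matrix algebra, so an identity linear in the words of `A` of a fixed positive length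
holds for all matrices (`IsInjective.linearMap_ext`), and for any other tensor `B` there is a
combination of words of `B` whose companion in the words of `A` is the identity. Inserting such
combinations upgrades a reduction to one that moves through words with columns on one side only
(`IsReduction.strong`). It also shows that two reductions of `B` to `A` differ by a scalar behind
`r` columns: the matrix comparing them commutes with every matrix (`StrongReduction.rigid`).

Reductions exist because the global relations $U_gU_h=U_{gh}$ and $U_g\psi_x=\psi_{gx}$ equate the
traces of all non-empty words of `B` and `A`. An element of the span of the words of `B` whose
companion vanishes then has powers of trace zero, so it is nilpotent; the ideal of these elements is
nilpotent because the algebra is Artinian. A rank one idempotent lifts along the projection to the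
words of `A`, keeps its trace and hence its rank, and its image and coimage generate the tensors $V$
and $\widehat V$ (`exists_isReduction`).

The symbols $\omega$ and $L$ compare two composite reductions of one tower to one injective tensor,
so rigidity gives their existence and uniqueness. For $B$, the state $U_g\psi(x,y)$ is cut open
inside both domains; injectivity turns proportionality of the states into proportionality of
products of entries at the two walls, and the first wall is isolated by dividing by an entry of the
second (`exists_wallPhase`). Evaluating a tower in all possible ways gives the pentagon
$\omega(g,h,k)L^x_{gh,k}L^{kx}_{g,h}=L^x_{g,hk}L^x_{h,k}$ (`IsAssociator.mul_lSymbol`) and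
$L^y_{g,h}B^{gh}_{y,x}=L^x_{g,h}B^h_{y,x}B^g_{hy,hx}$ (`IsWallPhase.mul`). Inserting powers of $g$
and multiplying over the cyclic group, everything but the asserted products telescopes. As every
choice of fusion tensors can be paired with every choice of action tensors, the common value is
independent of both (`IsAssociator.prod_eq_wallPhase`). The cocycle condition makes
$\prod_i\omega(g,g^i,\cdot)$ multiplicative on $\langle g\rangle$, so $\Theta$ is a root of unity.

For the interchange, a string of $T_g$ passing through a wall $e_{gz,z}$ yields $B^g_{gz,z}$ and
moves the wall to its image under $g$ (`WallData.mul_wall`). If the walls are created from left to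
right, the string of the operator number $m+1$ crosses $m$ walls and yields
$\prod_{j<m}B^g_{g^{j+1}x,g^jx}$. In the rotated order the last string ends to the left of all walls
and yields nothing, while the earlier ones yield the same factors as before. The ratio is the
product over one full period, which is $\Theta$ (`WallData.exchange`). Mirror images follow by
transposing tensors and reflecting the chain. -/

@[simp]
theorem word_nil (B : σ → Matrix n n ℂ) : word B [] = 1 := rfl

@[simp]
theorem word_cons (B : σ → Matrix n n ℂ) (i : σ) (w : List σ) :
    word B (i :: w) = B i * word B w := by
  simp [word]

theorem word_append (B : σ → Matrix n n ℂ) (u w : List σ) :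
    word B (u ++ w) = word B u * word B w := by
  simp [word]

theorem word_transpose (B : σ → Matrix n n ℂ) (w : List σ) :
    word (fun i => (B i)ᵀ) w = (word B w.reverse)ᵀ := by
  induction w with
  | nil => simp
  | cons i w ih => simp [word_append, ih, Matrix.transpose_mul]

theorem word_submatrix (B : σ → Matrix n n ℂ) (f : m ≃ n) (w : List σ) :
    word (fun i => (B i).submatrix f f) w = (word B w).submatrix f f := by
  induction w with
  | nil => simp
  | cons i w ih => simp [ih, Matrix.submatrix_mul_equiv]

theorem exists_split (w : List σ) {a b : ℕ} (h : w.length = a + b) :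
    ∃ u v : List σ, w = u ++ v ∧ u.length = a ∧ v.length = b :=
  ⟨w.take a, w.drop a, by simp, by simp [h], by simp [h]⟩

/-- The span of the pairs `(B^w, A^w)` over the words `w` of length `l`. -/
def jointSpan (B : σ → Matrix n n ℂ) (A : σ → Matrix m m ℂ) (l : ℕ) :
    Submodule ℂ (Matrix n n ℂ × Matrix m m ℂ) :=
  Submodule.span ℂ {x | ∃ w : List σ, w.length = l ∧ x = (word B w, word A w)}

theorem jointSpan_mul {B : σ → Matrix n n ℂ} {A : σ → Matrix m m ℂ} {l l' : ℕ}
    {x y : Matrix n n ℂ × Matrix m m ℂ} (hx : x ∈ jointSpan B A l) (hy : y ∈ jointSpan B A l') :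
    x * y ∈ jointSpan B A (l + l') := by
  induction hx using Submodule.span_induction with
  | mem x hx =>
    obtain ⟨w, rfl, rfl⟩ := hx
    induction hy using Submodule.span_induction with
    | mem y hy =>
      obtain ⟨w', rfl, rfl⟩ := hy
      exact Submodule.subset_span ⟨w ++ w', by simp, by simp [word_append]⟩
    | zero => simp
    | add y z _ _ h1 h2 => rw [mul_add]; exact add_mem h1 h2
    | smul c y _ h => rw [mul_smul_comm]; exact Submodule.smul_mem _ _ h
  | zero => simp
  | add y z _ _ h1 h2 => rw [add_mul]; exact add_mem h1 h2
  | smul c y _ h => rw [smul_mul_assoc]; exact Submodule.smul_mem _ _ h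

/-- The transfer principle: an identity that equates a linear function of $B^w$ with one of $A^w$
for words of one length may be evaluated at a combination of words chosen so that its companion `y`
is a prescribed matrix. -/
theorem jointSpan_linear {B : σ → Matrix n n ℂ} {A : σ → Matrix m m ℂ} {l : ℕ} {M : Type*}
    [AddCommGroup M] [Module ℂ M] {f : Matrix n n ℂ →ₗ[ℂ] M} {g : Matrix m m ℂ →ₗ[ℂ] M}
    (h : ∀ w : List σ, w.length = l → f (word B w) = g (word A w))
    {x : Matrix n n ℂ} {y : Matrix m m ℂ} (hp : (x, y) ∈ jointSpan B A l) : f x = g y := by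
  have : jointSpan B A l ≤ LinearMap.eqLocus (f ∘ₗ LinearMap.fst ℂ _ _)
      (g ∘ₗ LinearMap.snd ℂ _ _) := by
    refine Submodule.span_le.2 ?_
    rintro _ ⟨w, hw, rfl⟩
    exact h w hw
  exact this hp

/-- The linear map `X ↦ M * X * N`. -/
def sandwich {p q : Type*} (M : Matrix p m ℂ) (N : Matrix m q ℂ) :
    Matrix m m ℂ →ₗ[ℂ] Matrix p q ℂ where
  toFun X := M * X * N
  map_add' X Y := by rw [Matrix.mul_add, Matrix.add_mul]
  map_smul' c X := by simp

@[simp]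
theorem sandwich_apply {p q : Type*} (M : Matrix p m ℂ) (N : Matrix m q ℂ) (X : Matrix m m ℂ) :
    sandwich M N X = M * X * N := rfl

variable [Fintype σ]

theorem IsLeftInverse.sum_smul {Ahat A : σ → Matrix n n ℂ} (h : IsLeftInverse Ahat A)
    (X : Matrix n n ℂ) : ∑ i, (∑ a, ∑ b, X a b * Ahat i a b) • A i = X := by
  ext a' b'
  simp only [Matrix.sum_apply, Matrix.smul_apply, smul_eq_mul, Finset.sum_mul]
  rw [Finset.sum_comm]
  have : ∀ a, ∑ i, ∑ b, X a b * Ahat i a b * A i a' b' = if a = a' then X a b' else 0 := by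
    intro a
    rw [Finset.sum_comm]
    simp only [mul_assoc, ← Finset.mul_sum]
    simp only [h a _ a' b', mul_ite, mul_one, mul_zero]
    by_cases haa : a = a' <;> simp [haa]
  simp [this]

/-- The left inverse supplies coefficients that write any matrix in the letters of `A`; the same
coefficients applied to the letters of an arbitrary `B` give the companion. -/
theorem IsInjective.exists_mem_jointSpan {A : σ → Matrix m m ℂ} (hA : IsInjective A)
    (B : σ → Matrix n n ℂ) (X : Matrix m m ℂ) : ∃ E, (E, X) ∈ jointSpan B A 1 := by
  obtain ⟨Ahat, h⟩ := hA
  refine ⟨∑ i, (∑ a, ∑ b, X a b * Ahat i a b) • B i, ?_⟩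
  have : (∑ i, (∑ a, ∑ b, X a b * Ahat i a b) • B i, X)
      = ∑ i, (∑ a, ∑ b, X a b * Ahat i a b) • (B i, A i) := by
    ext1
    · simp [Prod.fst_sum]
    · simp only [Prod.snd_sum, Prod.smul_snd, h.sum_smul]
  rw [this]
  exact Submodule.sum_mem _ fun i _ => Submodule.smul_mem _ _
    (Submodule.subset_span ⟨[i], rfl, by simp⟩)

theorem IsInjective.exists_one_mem_jointSpan {A : σ → Matrix m m ℂ} (hA : IsInjective A)
    (B : σ → Matrix n n ℂ) (l : ℕ) : ∃ E, (E, 1) ∈ jointSpan B A l := by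
  induction l with
  | zero => exact ⟨1, Submodule.subset_span ⟨[], rfl, rfl⟩⟩
  | succ l ih =>
    obtain ⟨E, hE⟩ := ih
    obtain ⟨F, hF⟩ := hA.exists_mem_jointSpan B 1
    exact ⟨E * F, by simpa using jointSpan_mul hE hF⟩

theorem IsInjective.exists_mem_jointSpan_succ {A : σ → Matrix m m ℂ} (hA : IsInjective A)
    (B : σ → Matrix n n ℂ) (X : Matrix m m ℂ) (l : ℕ) :
    ∃ E, (E, X) ∈ jointSpan B A (l + 1) := by
  obtain ⟨E, hE⟩ := hA.exists_one_mem_jointSpan B l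
  obtain ⟨F, hF⟩ := hA.exists_mem_jointSpan B X
  exact ⟨E * F, by simpa using jointSpan_mul hE hF⟩

theorem IsInjective.linearMap_ext {A : σ → Matrix m m ℂ} (hA : IsInjective A) {M : Type*}
    [AddCommGroup M] [Module ℂ M] (l : ℕ) {f g : Matrix m m ℂ →ₗ[ℂ] M}
    (h : ∀ w : List σ, w.length = l + 1 → f (word A w) = g (word A w)) (X : Matrix m m ℂ) :
    f X = g X := by
  obtain ⟨E, hE⟩ := hA.exists_mem_jointSpan_succ A X l
  rw [← jointSpan_linear (f := f) (g := f) (fun _ _ => rfl) hE, jointSpan_linear h hE]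

/-- Two sandwiches that agree on the words of a fixed positive length in an injective tensor
agree on all matrices. -/
theorem IsInjective.sandwich_ext {A : σ → Matrix m m ℂ} (hA : IsInjective A) {p q : Type*} (l : ℕ)
    {M M' : Matrix p m ℂ} {N N' : Matrix m q ℂ}
    (h : ∀ w : List σ, w.length = l + 1 → M * word A w * N = M' * word A w * N')
    (X : Matrix m m ℂ) : M * X * N = M' * X * N' :=
  hA.linearMap_ext l (f := sandwich M N) (g := sandwich M' N') h X

/-- Unlike `sandwich_ext`, length zero is allowed, since the empty word already yields the identity
matrix. -/
theorem IsInjective.sandwich_ext_one {A : σ → Matrix m m ℂ} (hA : IsInjective A) {p q : Type*}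
    (l : ℕ) {M M' : Matrix p m ℂ} {N N' : Matrix m q ℂ}
    (h : ∀ w : List σ, w.length = l → M * word A w * N = M' * word A w * N') :
    M * N = M' * N' := by
  obtain ⟨E, hE⟩ := hA.exists_one_mem_jointSpan A l
  have h1 := jointSpan_linear h hE (f := sandwich M N) (g := sandwich M' N')
  rw [jointSpan_linear (f := sandwich M N) (g := sandwich M N) (fun _ _ => rfl) hE] at h1
  simpa using h1

end Words

/-! ### Reductions -/

section Reductions

variable {σ n m k : Type*} [Fintype n] [DecidableEq n] [Fintype m] [DecidableEq m]
  [Fintype k] [DecidableEq k]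

/-- A reduction that moreover moves through words that have `r` further columns on the other
side. -/
structure StrongReduction (r : ℕ) (B : σ → Matrix n n ℂ) (A : σ → Matrix m m ℂ)
    (Vh : Matrix m n ℂ) (V : Matrix n m ℂ) : Prop extends IsReduction r B A Vh V where
  right : ∀ u w : List σ, u.length = r → word B u * word B w * V = word B u * V * word A w
  left : ∀ w v : List σ, v.length = r → Vh * word B w * word B v = word A w * Vh * word B v

variable {r : ℕ} {B : σ → Matrix n n ℂ} {C : σ → Matrix k k ℂ} {A : σ → Matrix m m ℂ}
  {Vh : Matrix m n ℂ} {V : Matrix n m ℂ}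

theorem IsReduction.transpose (h : IsReduction r B A Vh V) :
    IsReduction r (fun i => (B i)ᵀ) (fun i => (A i)ᵀ) Vᵀ Vhᵀ where
  contract w := by
    rw [word_transpose, word_transpose, ← h.contract w.reverse]
    simp [Matrix.transpose_mul, Matrix.mul_assoc]
  expand u w v hu hv hw := by
    have := congrArg Matrix.transpose (h.expand v.reverse w.reverse u.reverse (by simpa)
      (by simpa) (by simpa))
    simpa [word_transpose, Matrix.transpose_mul, Matrix.mul_assoc] using this

/-- Multiplying `expand` by `V` on the right gives the claim with a further word of `B` in front of
`V`. Injectivity replaces that word by a padding whose companion is the identity. The padding is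
then absorbed, because behind `r` columns it is invisible to `V`. -/
theorem IsReduction.right_of_isInjective [Fintype σ] (h : IsReduction r B A Vh V)
    (hA : IsInjective A) (u w : List σ) (hu : u.length = r) :
    word B u * word B w * V = word B u * V * word A w := by
  obtain ⟨E, hE⟩ := hA.exists_one_mem_jointSpan B r
  -- One more letter of padding keeps the middle word of `expand` non-empty even when `w` is empty.
  obtain ⟨F, hF⟩ := hA.exists_mem_jointSpan B 1
  have h1 : ∀ u w : List σ, u.length = r → w ≠ [] →
      word B u * word B w * E * V = word B u * V * word A w := by
    intro u w hu hw
    have := jointSpan_linear (f := sandwich (word B u * word B w) V)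
      (g := sandwich (word B u * V * word A w) 1) (fun v hv => ?_) hE
    · simpa using this
    · have e := congrArg (· * V) (h.expand u w v hu hv hw)
      simp only [sandwich_apply, Matrix.mul_one] at e ⊢
      rw [e, ← h.contract v]
      simp only [Matrix.mul_assoc]
  have h2 : ∀ u w : List σ, u.length = r →
      word B u * word B w * F * E * V = word B u * V * word A w := by
    intro u w hu
    have := jointSpan_linear (f := sandwich (word B u * word B w) (E * V))
      (g := sandwich (word B u * V * word A w) 1) (fun v hv => ?_) hF
    · simpa [Matrix.mul_assoc] using this
    · have e := h1 u (w ++ v) hu (by rintro e; simp_all)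
      simpa [word_append, Matrix.mul_assoc] using e
  -- The same word is split a second time so that its last `r` letters are the border behind which
  -- `F * E` disappears.
  obtain ⟨w', u', e, -, hu'⟩ := exists_split (u ++ w) (a := w.length) (b := r) (by simp; omega)
  have e' : word B u * word B w = word B w' * word B u' := by rw [← word_append, e, word_append]
  have h3 := h2 u' [] hu'
  simp only [word_nil, Matrix.mul_one] at h3
  rw [← h2 u w hu, e', Matrix.mul_assoc, ← h3]
  simp only [Matrix.mul_assoc]

theorem IsReduction.strong [Fintype σ] (h : IsReduction r B A Vh V) (hA : IsInjective A) :
    StrongReduction r B A Vh V where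
  toIsReduction := h
  right := h.right_of_isInjective hA
  left w v hv := by
    have hA' : IsInjective (fun i => (A i)ᵀ) := by
      obtain ⟨Ahat, hh⟩ := hA
      refine ⟨fun i => (Ahat i)ᵀ, fun a b a' b' => ?_⟩
      simp only [Matrix.transpose_apply]
      rw [hh]
      simp [and_comm]
    have := congrArg Matrix.transpose
      (h.transpose.right_of_isInjective hA' v.reverse w.reverse (by simpa))
    simpa [word_transpose, Matrix.transpose_mul, Matrix.mul_assoc] using this

theorem IsReduction.mono {r' : ℕ} (h : IsReduction r B A Vh V) (hr : r ≤ r') :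
    IsReduction r' B A Vh V where
  contract := h.contract
  expand u w v hu hv hw := by
    obtain ⟨u1, u2, rfl, -, hu2⟩ := exists_split u (a := r' - r) (b := r) (by omega)
    obtain ⟨v1, v2, rfl, hv1, -⟩ := exists_split v (a := r) (b := r' - r) (by omega)
    have := congrArg (fun M => word B u1 * M * word B v2) (h.expand u2 w v1 hu2 hv1 hw)
    simpa [word_append, Matrix.mul_assoc] using this

theorem StrongReduction.right_le (h : StrongReduction r B A Vh V) (u w : List σ)
    (hu : r ≤ u.length) : word B u * word B w * V = word B u * V * word A w := by
  obtain ⟨u1, u2, rfl, -, hu2⟩ := exists_split u (a := u.length - r) (b := r) (by omega)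
  have := congrArg (fun M => word B u1 * M) (h.right u2 w hu2)
  simpa [word_append, Matrix.mul_assoc] using this

theorem StrongReduction.left_le (h : StrongReduction r B A Vh V) (w v : List σ)
    (hv : r ≤ v.length) : Vh * word B w * word B v = word A w * Vh * word B v := by
  obtain ⟨v1, v2, rfl, hv1, -⟩ := exists_split v (a := r) (b := v.length - r) (by omega)
  have := congrArg (fun M => M * word B v2) (h.left w v1 hv1)
  simpa [word_append, Matrix.mul_assoc] using this

theorem StrongReduction.mono {r' : ℕ} (h : StrongReduction r B A Vh V) (hr : r ≤ r') :
    StrongReduction r' B A Vh V where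
  toIsReduction := h.toIsReduction.mono hr
  right u w hu := h.right_le u w (by omega)
  left w v hv := h.left_le w v (by omega)

theorem StrongReduction.refl (B : σ → Matrix n n ℂ) : StrongReduction r B B 1 1 where
  contract := by simp
  expand := by simp
  right := by simp
  left := by simp

/-- The outermost `r` columns serve the first reduction. The next `r'` columns become columns of `C`
and serve the second; carrying the intermediate tensors across them is what `right` and `left` are
needed for. -/
theorem StrongReduction.comp {r' : ℕ} {Wh : Matrix m k ℂ} {W : Matrix k m ℂ}
    {Uh : Matrix k n ℂ} {U : Matrix n k ℂ}
    (h : StrongReduction r B C Uh U) (h' : StrongReduction r' C A Wh W) :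
    StrongReduction (r + r') B A (Wh * Uh) (U * W) where
  contract w := by
    rw [← h'.contract, ← h.contract]
    simp only [Matrix.mul_assoc]
  right u w hu := by
    obtain ⟨u1, u2, rfl, hu1, hu2⟩ := exists_split u hu
    have e1 := congrArg (· * W) (h.right u1 (u2 ++ w) hu1)
    have e2 := congrArg (· * (W * word A w)) (h.right u1 u2 hu1)
    have e3 := congrArg (fun M => word B u1 * U * M) (h'.right u2 w hu2)
    simp only [word_append, Matrix.mul_assoc] at e1 e2 e3 ⊢
    rw [e1, e3, ← e2]
  left w v hv := by
    obtain ⟨v1, v2, rfl, hv1, hv2⟩ := exists_split v (hv.trans (add_comm _ _))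
    have e1 := congrArg (fun M => Wh * M) (h.left (w ++ v1) v2 hv2)
    have e2 := congrArg (fun M => word A w * Wh * M) (h.left v1 v2 hv2)
    have e3 := congrArg (· * (Uh * word B v2)) (h'.left w v1 hv1)
    simp only [word_append, Matrix.mul_assoc] at e1 e2 e3 ⊢
    rw [e1, e3, ← e2]
  expand u w v hu hv hw := by
    obtain ⟨u1, u2, rfl, hu1, hu2⟩ := exists_split u hu
    obtain ⟨v1, v2, rfl, hv1, hv2⟩ := exists_split v (hv.trans (add_comm _ _))
    have e1 := h.expand u1 (u2 ++ w ++ v1) v2 hu1 hv2 (by simp [hw])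
    have e2 := congrArg (fun M => word B u1 * U * M * (Uh * word B v2))
      (h'.expand u2 w v1 hu2 hv1 hw)
    have e3 := congrArg (· * (W * word A w * Wh * Uh * word B v1 * word B v2))
      (h.right u1 u2 hu1)
    have e4 := congrArg (fun M => word B u1 * U * word C u2 * (W * word A w * Wh * M))
      (h.left v1 v2 hv2)
    simp only [word_append, Matrix.mul_assoc] at e1 e2 e3 e4 ⊢
    rw [e1, e2, e3, e4]

theorem submatrix_id_mul {p q s : Type*} (X : Matrix p m ℂ) (Y : Matrix m q ℂ) (f : s → p) :
    X.submatrix f id * Y = (X * Y).submatrix f id := rfl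

theorem mul_submatrix_id {p q s : Type*} (X : Matrix p m ℂ) (Y : Matrix m q ℂ) (f : s → q) :
    X * Y.submatrix id f = (X * Y).submatrix id f := rfl

theorem StrongReduction.reindex (h : StrongReduction r B A Vh V) (f : k ≃ n) :
    StrongReduction r (fun i => (B i).submatrix f f) A (Vh.submatrix id f) (V.submatrix f id) where
  contract w := by
    rw [word_submatrix, Matrix.submatrix_mul_equiv, Matrix.submatrix_mul_equiv, h.contract]
    rfl
  right u w hu := by
    simp only [word_submatrix, Matrix.submatrix_mul_equiv, submatrix_id_mul, h.right u w hu]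
  left w v hv := by
    simp only [word_submatrix, Matrix.submatrix_mul_equiv, mul_submatrix_id, h.left w v hv]
  expand u w v hu hv hw := by
    simp only [word_submatrix, Matrix.submatrix_mul_equiv, submatrix_id_mul,
      mul_submatrix_id, h.expand u w v hu hv hw]
    rfl

/-- Two reductions to the same injective tensor agree up to a factor, behind `r` columns. -/
theorem StrongReduction.rigid [Fintype σ] [Nonempty m] {Vh' : Matrix m n ℂ} {V' : Matrix n m ℂ}
    (hA : IsInjective A) (h : StrongReduction r B A Vh V) (h' : StrongReduction r B A Vh' V') :
    ∃ c : ℂˣ, (∀ u : List σ, u.length = r → word B u * V' = (c : ℂ) • (word B u * V)) ∧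
      ∀ v : List σ, v.length = r → (c : ℂ) • (Vh' * word B v) = Vh * word B v := by
  obtain ⟨E, hE⟩ := hA.exists_one_mem_jointSpan B r
  -- The product $B^uB^wEV'$ is evaluated by moving `V'` to the left and by expanding with the first
  -- reduction; since `A` is injective, $A^w$ may then be any matrix.
  have h1 : ∀ u : List σ, u.length = r → ∀ X : Matrix m m ℂ,
      word B u * V' * X = word B u * V * X * (Vh * E * V') := by
    intro u hu X
    have := hA.sandwich_ext 0 (M := word B u * V') (N := 1) (M' := word B u * V)
      (N' := Vh * E * V') (fun w hw => ?_) X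
    · simpa using this
    · have e1 := jointSpan_linear (f := sandwich (word B u * word B w) V')
        (g := sandwich (word B u * V' * word A w) 1) (fun v hv => by
          simpa [word_append, Matrix.mul_assoc] using h'.right u (w ++ v) hu) hE
      have e2 := jointSpan_linear (f := sandwich (word B u * word B w) V' -
          sandwich (word B u * V * word A w * Vh) V') (g := 0) (fun v hv => by
        have e := congrArg (· * V') (h.expand u w v hu hv (by rintro rfl; simp at hw))
        simpa [sub_eq_zero] using e) hE
      rw [LinearMap.sub_apply, LinearMap.zero_apply, sub_eq_zero, e1] at e2
      simpa [Matrix.mul_assoc] using e2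
  set M := Vh * E * V'
  have h2 : ∀ u : List σ, u.length = r → word B u * V' = word B u * V * M := by
    intro u hu
    simpa using h1 u hu 1
  -- Stripping `V` off with `Vh` leaves $A^uMX=A^uXM$, so `M` is central and hence scalar.
  have h3 : ∀ X : Matrix m m ℂ, M * X = X * M := by
    intro X
    have := hA.sandwich_ext_one r (M := (1 : Matrix m m ℂ)) (M' := 1) (N := M * X) (N' := X * M) (fun u hu => ?_)
    · simpa using this
    · have e := h1 u hu X
      rw [h2 u hu] at e
      have e' := congrArg (fun Y => Vh * Y) e
      simp only [Matrix.one_mul]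
      rw [← h.contract u]
      simpa [Matrix.mul_assoc] using e'
  obtain ⟨c, hc⟩ : M ∈ Set.range (Matrix.scalar m) :=
    Matrix.mem_range_scalar_of_commute_single fun i j _ => (h3 _).symm
  have h4 : ∀ u : List σ, u.length = r → word B u * V' = c • (word B u * V) := by
    intro u hu
    rw [h2 u hu, ← hc]
    simp [Matrix.scalar_apply, ← Matrix.smul_one_eq_diagonal]
  have hc0 : c ≠ 0 := by
    rintro rfl
    have : (1 : Matrix m m ℂ) * 1 = 0 * 1 := hA.sandwich_ext_one r fun u hu => by
      have e := congrArg (fun Y => Vh' * Y) (h4 u hu)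
      simp only [zero_smul, Matrix.mul_zero] at e
      rw [← Matrix.mul_assoc, h'.contract] at e
      simp [e]
    simp at this
  refine ⟨Units.mk0 c hc0, h4, fun v hv => ?_⟩
  -- Both reductions expand the same word; the factor of the right tensors must be compensated by
  -- the left ones.
  have h5 : ∀ u : List σ, u.length = r → ∀ w, w ≠ [] →
      word A u * word A w * (Vh * word B v) = word A u * word A w * (c • (Vh' * word B v)) := by
    intro u hu w hw
    have e := h.expand u w v hu hv hw
    rw [h'.expand u w v hu hv hw, h4 u hu] at e
    have e' := congrArg (fun Y => Vh * Y) e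
    rw [← h.contract u]
    simp only [Matrix.smul_mul, Matrix.mul_smul, Matrix.mul_assoc] at e' ⊢
    exact e'.symm
  have := hA.sandwich_ext_one (r + 1) (M := (1 : Matrix m m ℂ)) (M' := 1) (N := Vh * word B v)
    (N' := c • (Vh' * word B v)) fun u hu => by
      obtain ⟨u1, u2, rfl, hu1, hu2⟩ := exists_split u hu
      rw [word_append, Matrix.one_mul]
      exact h5 u1 hu1 u2 (by rintro rfl; simp at hu2)
  rw [Matrix.one_mul, Matrix.one_mul] at this
  exact this.symm

end Reductions


/-! ### Existence of reductions -/

section Existence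

open Polynomial

variable {σ n m : Type*} [Fintype n] [DecidableEq n] [Fintype m] [DecidableEq m]

theorem exists_factorization_of_idempotent {e : Matrix n n ℂ} (he : e * e = e) :
    ∃ (k : ℕ) (V : Matrix n (Fin k) ℂ) (Vh : Matrix (Fin k) n ℂ), V * Vh = e ∧ Vh * V = 1 := by
  let f := Matrix.toLin' e
  have hf : ∀ x, f (f x) = f x := by
    intro x
    have := congrArg (fun M => Matrix.toLin' M x) he
    simpa [f, Matrix.toLin'_mul] using this
  let b := Module.finBasis ℂ (LinearMap.range f)
  let i := (LinearMap.range f).subtype ∘ₗ b.equivFun.symm.toLinearMap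
  let p := b.equivFun.toLinearMap ∘ₗ f.rangeRestrict
  refine ⟨_, LinearMap.toMatrix' i, LinearMap.toMatrix' p, ?_, ?_⟩
  · rw [← LinearMap.toMatrix'_comp]
    have : i ∘ₗ p = f := by
      ext x
      simp [i, p]
    rw [this]
    simp [f]
  · rw [← LinearMap.toMatrix'_comp]
    have : p ∘ₗ i = LinearMap.id := by
      have h1 : ∀ y : LinearMap.range f, f.rangeRestrict y = y := by
        rintro ⟨_, x, rfl⟩
        ext1
        simp [hf]
      refine LinearMap.ext fun x => ?_
      simp only [p, i, LinearMap.comp_apply, LinearEquiv.coe_coe, Submodule.subtype_apply, h1,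
        LinearEquiv.apply_symm_apply, LinearMap.id_apply]
    rw [this, LinearMap.toMatrix'_id]

/-- Write the minimal polynomial as $X^kq$ with $X\nmid q$. A Bézout identity between $X^{k+1}$ and
$q$ gives the idempotent `e` projecting onto the invertible part of `c`. It is a polynomial in `c`
without constant term, so its trace vanishes; in characteristic zero its rank vanishes too, and
$c^k=0$. -/
theorem isNilpotent_of_trace_pow_eq_zero {c : Matrix n n ℂ}
    (h : ∀ k : ℕ, (c ^ (k + 1)).trace = 0) : IsNilpotent c := by
  obtain ⟨q, hq, hq'⟩ := exists_eq_pow_rootMultiplicity_mul_and_not_dvd (minpoly ℂ c)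
    (minpoly.ne_zero (Matrix.isIntegral c)) 0
  simp only [map_zero, sub_zero] at hq hq'
  set k := rootMultiplicity 0 (minpoly ℂ c)
  obtain ⟨a, b, hab⟩ : IsCoprime (X ^ (k + 1) : ℂ[X]) q :=
    IsCoprime.pow_left ((irreducible_X.coprime_iff_not_dvd).2 hq')
  have htr : ∀ f : ℂ[X], (aeval c (f * X)).trace = 0 := by
    intro f
    induction f using Polynomial.induction_on' with
    | add f g hf hg => rw [add_mul, map_add, Matrix.trace_add, hf, hg, add_zero]
    | monomial j t =>
      rw [monomial_mul_X, aeval_monomial, ← Algebra.smul_def, Matrix.trace_smul, h, smul_zero]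
  set e := aeval c (a * X ^ (k + 1)) with he
  have he1 : e * (1 - e) = 0 := by
    have : (1 : Matrix n n ℂ) - e = aeval c (b * q) := by
      rw [he, ← map_one (aeval (R := ℂ) c), ← map_sub, ← hab]
      congr 1; ring
    rw [this, he, ← map_mul, show a * X ^ (k + 1) * (b * q) = a * X * b * (X ^ k * q) by ring,
      ← hq, map_mul, minpoly.aeval, mul_zero]
  obtain ⟨l, V, Vh, h1, h2⟩ := exists_factorization_of_idempotent (e := e) (by
    rw [mul_sub, mul_one, sub_eq_zero] at he1
    exact he1.symm)
  have hl : (l : ℂ) = 0 := by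
    have : e.trace = 0 := by
      rw [he, pow_succ, ← mul_assoc]
      exact htr _
    rw [← h1, Matrix.trace_mul_comm, h2] at this
    simpa using this
  have he0 : e = 0 := by
    rw [← h1]
    ext i j
    rw [Nat.cast_eq_zero] at hl
    subst hl
    simp [Matrix.mul_apply]
  refine ⟨k, ?_⟩
  have : aeval c (X ^ k * (a * X ^ (k + 1) + b * q)) = 0 := by
    rw [mul_add, map_add, map_mul, ← he, he0, show X ^ k * (b * q) = b * (X ^ k * q) by ring, ← hq,
      map_mul _ b, minpoly.aeval]
    simp
  simpa [hab] using this

/-- The span of the pairs `(B^w, A^w)` over all non-empty words `w`. -/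
def wordSpan (B : σ → Matrix n n ℂ) (A : σ → Matrix m m ℂ) :
    Submodule ℂ (Matrix n n ℂ × Matrix m m ℂ) :=
  Submodule.span ℂ {x | ∃ w : List σ, w ≠ [] ∧ x = (word B w, word A w)}

variable {B : σ → Matrix n n ℂ} {A : σ → Matrix m m ℂ}

theorem word_mem_wordSpan {w : List σ} (hw : w ≠ []) : (word B w, word A w) ∈ wordSpan B A :=
  Submodule.subset_span ⟨w, hw, rfl⟩

theorem wordSpan_mul {x y : Matrix n n ℂ × Matrix m m ℂ} (hx : x ∈ wordSpan B A)
    (hy : y ∈ wordSpan B A) : x * y ∈ wordSpan B A := by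
  induction hx using Submodule.span_induction with
  | mem x hx =>
    obtain ⟨w, hw, rfl⟩ := hx
    induction hy using Submodule.span_induction with
    | mem y hy =>
      obtain ⟨w', hw', rfl⟩ := hy
      exact Submodule.subset_span ⟨w ++ w', by simp [hw], by simp [word_append]⟩
    | zero => simp
    | add y z _ _ h1 h2 => rw [mul_add]; exact add_mem h1 h2
    | smul c y _ h => rw [mul_smul_comm]; exact Submodule.smul_mem _ _ h
  | zero => simp
  | add y z _ _ h1 h2 => rw [add_mul]; exact add_mem h1 h2
  | smul c y _ h => rw [smul_mul_assoc]; exact Submodule.smul_mem _ _ h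

theorem aeval_mul_X_mem_wordSpan {x : Matrix n n ℂ × Matrix m m ℂ} (hx : x ∈ wordSpan B A)
    (f : ℂ[X]) : aeval x (f * X) ∈ wordSpan B A := by
  induction f using Polynomial.induction_on' with
  | add f g hf hg => rw [add_mul, map_add]; exact add_mem hf hg
  | monomial j t =>
    rw [monomial_mul_X, aeval_monomial, ← Algebra.smul_def]
    refine Submodule.smul_mem _ _ ?_
    induction j with
    | zero => simpa using hx
    | succ j ih => rw [pow_succ]; exact wordSpan_mul ih hx

theorem exists_mem_wordSpan [Fintype σ] (hA : IsInjective A) (B : σ → Matrix n n ℂ)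
    (X : Matrix m m ℂ) : ∃ E, (E, X) ∈ wordSpan B A := by
  obtain ⟨E, hE⟩ := hA.exists_mem_jointSpan B X
  refine ⟨E, (Submodule.span_mono ?_ : jointSpan B A 1 ≤ wordSpan B A) hE⟩
  rintro _ ⟨w, hw, rfl⟩
  exact ⟨w, by rintro rfl; simp at hw, rfl⟩

theorem trace_eq_of_mem_wordSpan (htr : ∀ w : List σ, w ≠ [] → (word B w).trace = (word A w).trace)
    {c : Matrix n n ℂ} {a : Matrix m m ℂ} (h : (c, a) ∈ wordSpan B A) : c.trace = a.trace := by
  have : wordSpan B A ≤ LinearMap.eqLocus (Matrix.traceLinearMap n ℂ ℂ ∘ₗ LinearMap.fst ℂ _ _)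
      (Matrix.traceLinearMap m ℂ ℂ ∘ₗ LinearMap.snd ℂ _ _) := by
    refine Submodule.span_le.2 ?_
    rintro _ ⟨w, hw, rfl⟩
    exact htr w hw
  exact this h

/-- All pairs $(c^{k+1},0)$ stay in the span, so all powers of `c` have the trace of the zero
matrix. -/
theorem isNilpotent_of_mem_wordSpan
    (htr : ∀ w : List σ, w ≠ [] → (word B w).trace = (word A w).trace)
    {c : Matrix n n ℂ} (h : (c, 0) ∈ wordSpan B A) : IsNilpotent c := by
  have hk : ∀ k : ℕ, (c ^ (k + 1), 0) ∈ wordSpan B A := by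
    intro k
    induction k with
    | zero => simpa using h
    | succ k ih => simpa [pow_succ] using wordSpan_mul ih h
  refine isNilpotent_of_trace_pow_eq_zero fun k => ?_
  rw [trace_eq_of_mem_wordSpan htr (hk k), Matrix.trace_zero]

theorem exists_list_prod_eq_zero_of_mem_jacobson (R : Type*) [Ring R] [IsArtinianRing R] :
    ∃ r : ℕ, ∀ l : List R, l.length = r → (∀ c ∈ l, c ∈ Ideal.jacobson (⊥ : Ideal R)) →
      l.prod = 0 := by
  obtain ⟨r, hr⟩ := IsArtinianRing.isNilpotent_jacobson_bot (R := R)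
  have key : ∀ l : List R, (∀ c ∈ l, c ∈ Ideal.jacobson (⊥ : Ideal R)) →
      l.prod ∈ Ideal.jacobson (⊥ : Ideal R) ^ l.length := by
    intro l
    induction l using List.reverseRecOn with
    | nil =>
      intro _
      rw [List.length_nil, Submodule.pow_zero, Ideal.one_eq_top]
      trivial
    | append_singleton l c ih =>
      intro hl
      rw [List.prod_append, List.prod_singleton, List.length_append, List.length_singleton,
        Submodule.pow_succ]
      exact Ideal.mul_mem_mul (ih fun c hc => hl c (by simp [hc])) (hl c (by simp))
  refine ⟨r, fun l hl hl' => ?_⟩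
  have := key l hl'
  rw [hl, hr] at this
  exact this

/-- The kernel of the projection from the algebra of the words of `B` to that of the words of `A`
is nilpotent. -/
theorem exists_list_prod_eq_zero
    (htr : ∀ w : List σ, w ≠ [] → (word B w).trace = (word A w).trace) :
    ∃ r : ℕ, ∀ l : List (Matrix n n ℂ), l.length = r → (∀ c ∈ l, (c, 0) ∈ wordSpan B A) →
      l.prod = 0 := by
  -- The span of non-empty words need not contain a unit. After adjoining one it is a
  -- finite-dimensional, hence Artinian, ring in which `J` is a left ideal of nilpotent elements.
  let R := Algebra.adjoin ℂ (wordSpan B A : Set (Matrix n n ℂ × Matrix m m ℂ))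
  have hR : ∀ y ∈ R, ∀ x ∈ wordSpan B A, y * x ∈ wordSpan B A := by
    intro y hy
    induction hy using Algebra.adjoin_induction with
    | mem y hy => exact fun x hx => wordSpan_mul hy hx
    | algebraMap t =>
      intro x hx
      rw [← Algebra.smul_def]
      exact Submodule.smul_mem _ _ hx
    | add y z _ _ h1 h2 =>
      intro x hx
      rw [add_mul]
      exact add_mem (h1 x hx) (h2 x hx)
    | mul y z _ _ h1 h2 =>
      intro x hx
      rw [mul_assoc]
      exact h1 _ (h2 x hx)
  have : IsArtinianRing R := IsArtinianRing.of_finite ℂ R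
  let J : Ideal R :=
    { carrier := {y | (y : Matrix n n ℂ × Matrix m m ℂ) ∈ wordSpan B A ∧
        (y : Matrix n n ℂ × Matrix m m ℂ).2 = 0}
      add_mem' := fun ha hb => ⟨add_mem ha.1 hb.1, by simp [ha.2, hb.2]⟩
      zero_mem' := ⟨zero_mem _, rfl⟩
      smul_mem' := fun c x hx => ⟨hR _ c.2 _ hx.1, by simp [hx.2]⟩ }
  have hJnil : ∀ y ∈ J, IsNilpotent y := by
    rintro ⟨⟨c, a⟩, hy⟩ ⟨h1, h2⟩
    simp only at h2
    subst h2
    obtain ⟨k, hk⟩ := isNilpotent_of_mem_wordSpan htr h1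
    refine ⟨k + 1, ?_⟩
    ext1
    rw [SubmonoidClass.coe_pow]
    ext1
    · simp [pow_succ, hk]
    · simp
  have hJ : J ≤ Ideal.jacobson ⊥ := by
    intro x hx
    rw [Ideal.mem_jacobson_iff]
    intro y
    obtain ⟨u, hu⟩ := (hJnil (y * x) (J.mul_mem_left y hx)).isUnit_one_add
    refine ⟨↑u⁻¹, ?_⟩
    have : (↑u⁻¹ : R) * (1 + y * x) = 1 := by rw [← hu, Units.inv_mul]
    rw [Ideal.mem_bot, ← sub_eq_zero.2 this]
    noncomm_ring
  obtain ⟨r, hr⟩ := exists_list_prod_eq_zero_of_mem_jacobson R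
  refine ⟨r, fun l hl hl' => ?_⟩
  have key : ∀ l : List (Matrix n n ℂ), (∀ c ∈ l, (c, 0) ∈ wordSpan B A) →
      ∃ l' : List R, l'.length = l.length ∧ (∀ c ∈ l', c ∈ J) ∧ l'.prod.1.1 = l.prod := by
    intro l
    induction l with
    | nil => exact fun _ => ⟨[], rfl, by simp, rfl⟩
    | cons c l ih =>
      intro hl'
      obtain ⟨l', h1, h2, h3⟩ := ih fun c hc => hl' c (by simp [hc])
      have hc := hl' c (by simp)
      refine ⟨⟨(c, 0), Algebra.subset_adjoin hc⟩ :: l', by simp [h1], ?_, ?_⟩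
      · intro x hx
        rcases List.mem_cons.1 hx with rfl | hx
        · exact ⟨hc, rfl⟩
        · exact h2 x hx
      · rw [List.prod_cons, List.prod_cons, ← h3]
        rfl
  obtain ⟨l', h1, h2, h3⟩ := key l hl'
  rw [← h3, hr l' (by omega) fun c hc => hJ (h2 c hc)]
  rfl

/-- A tensor with the same traces of words as an injective tensor can be reduced to it. -/
theorem exists_isReduction [Fintype σ] [Nonempty m] (hA : IsInjective A)
    (htr : ∀ w : List σ, w ≠ [] → (word B w).trace = (word A w).trace) :
    ∃ r Vh V, IsReduction r B A Vh V := by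
  obtain ⟨o⟩ := ‹Nonempty m›
  set E : Matrix m m ℂ := Matrix.single o o 1 with hE
  have hEE : E * E = E := by simp [hE]
  -- an idempotent lift of a rank one idempotent
  obtain ⟨p, hp, hpp⟩ : ∃ p, (p, E) ∈ wordSpan B A ∧ p * p = p := by
    obtain ⟨c, hc⟩ := exists_mem_wordSpan hA B E
    have hd : (c * c - c, 0) ∈ wordSpan B A := by
      have := sub_mem (wordSpan_mul hc hc) hc
      simpa [hEE] using this
    obtain ⟨k, hk⟩ := isNilpotent_of_mem_wordSpan htr hd
    -- The polynomial $f=aX^{k+1}$ has $f(0)=0$ and $f(1)=1$, so $f(E)=E$. Moreover $f(1-f)$ is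
    -- divisible by $(X^2-X)^{k+1}$, which `c` annihilates, so $f(c)$ is idempotent.
    obtain ⟨a, b, hab⟩ : IsCoprime (X ^ (k + 1) : ℂ[X]) ((X - 1) ^ (k + 1)) := by
      refine IsCoprime.pow ⟨1, -1, by ring⟩
    set f : ℂ[X] := a * X ^ k * X with hf
    have hf1 : f.eval 1 = 1 := by
      have := congrArg (eval 1) hab
      simpa [hf] using this
    have hy := aeval_mul_X_mem_wordSpan hc (a * X ^ k)
    rw [← hf] at hy
    have h1 : (aeval (c, E) f).1 = aeval c f :=
      (aeval_algHom_apply (AlgHom.fst ℂ (Matrix n n ℂ) (Matrix m m ℂ)) (c, E) f).symm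
    have h2 : (aeval (c, E) f).2 = E := by
      have e1 : (aeval (c, E) f).2 = aeval E f :=
        (aeval_algHom_apply (AlgHom.snd ℂ (Matrix n n ℂ) (Matrix m m ℂ)) (c, E) f).symm
      have e2 : ∀ g : ℂ[X], aeval E (g * X) = g.eval 1 • E := by
        intro g
        induction g using Polynomial.induction_on' with
        | add f g hf hg => rw [add_mul, map_add, hf, hg, eval_add, add_smul]
        | monomial j t =>
          rw [monomial_mul_X, aeval_monomial, ← Algebra.smul_def]
          have : E ^ (j + 1) = E := IsIdempotentElem.pow_succ_eq _ hEE
          simp [this]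
      rw [e1, hf, e2]
      have : eval 1 (a * X ^ k) = 1 := by simpa [hf] using hf1
      rw [this, one_smul]
    refine ⟨aeval c f, ?_, ?_⟩
    · rw [← h1]
      nth_rewrite 2 [← h2]
      exact hy
    · have : f * (1 - f) = a * b * (X * X - X) ^ (k + 1) := by
        have : 1 - f = b * (X - 1) ^ (k + 1) := by
          rw [hf]; linear_combination -hab
        rw [this, hf, show (X * X - X : ℂ[X]) = X * (X - 1) by ring, mul_pow]
        ring
      have h3 := congrArg (aeval c) this
      simp only [map_mul, map_sub, map_one, map_pow, aeval_X] at h3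
      rw [pow_succ (c * c - c), hk, zero_mul, mul_zero, mul_sub, mul_one, sub_eq_zero] at h3
      simpa using h3.symm
  -- it has rank one
  obtain ⟨v, φ, hvφ⟩ : ∃ v φ : n → ℂ, p = Matrix.vecMulVec v φ := by
    obtain ⟨l, V, Vh, h1, h2⟩ := exists_factorization_of_idempotent hpp
    have hl : (l : ℂ) = 1 := by
      have := trace_eq_of_mem_wordSpan htr hp
      rw [← h1, Matrix.trace_mul_comm, h2] at this
      simpa [hE] using this
    have hl' : l = 1 := by exact_mod_cast hl
    subst hl'
    refine ⟨fun i => V i 0, fun i => Vh 0 i, ?_⟩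
    rw [← h1]
    ext i j
    simp [Matrix.mul_apply, Matrix.vecMulVec]
  -- As $p=v\varphi^{T}$, the scalar $\varphi^{T}zv$ is the trace of $pz$, which equals the trace of
  -- the companion $EZ$.
  have key : ∀ z Z, (z, Z) ∈ wordSpan B A → φ ⬝ᵥ z *ᵥ v = Z o o := by
    intro z Z hz
    have h1 := trace_eq_of_mem_wordSpan htr (wordSpan_mul hp hz)
    rw [hvφ, Matrix.vecMulVec_mul, Matrix.trace_vecMulVec, dotProduct_comm,
      ← Matrix.dotProduct_mulVec] at h1
    rw [h1, hE, Matrix.trace_single_mul]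
    simp
  choose c hc using fun a => exists_mem_wordSpan hA B (Matrix.single a o 1)
  choose d hd using fun b => exists_mem_wordSpan hA B (Matrix.single o b 1)
  -- The lifts `c a` and `d b` of matrix units in column and row `o` transport the one-dimensional
  -- image and coimage of `p` to all values of the bond index.
  let V : Matrix n m ℂ := Matrix.of fun i a => (c a *ᵥ v) i
  let Vh : Matrix m n ℂ := Matrix.of fun b i => (φ ᵥ* d b) i
  have hsand : ∀ z b a, (Vh * z * V) b a = φ ⬝ᵥ (d b * z * c a) *ᵥ v := by
    intro z b a
    rw [← Matrix.mulVec_mulVec, ← Matrix.mulVec_mulVec, Matrix.dotProduct_mulVec, Matrix.mul_assoc]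
    simp [V, Vh, Matrix.mul_apply, dotProduct, Matrix.mulVec]
  have hcon : ∀ z Z, (z, Z) ∈ wordSpan B A → Vh * z * V = Z := by
    intro z Z hz
    ext b a
    have := key (d b * z * c a) (Matrix.single o b 1 * Z * Matrix.single a o 1)
      (wordSpan_mul (wordSpan_mul (hd b) hz) (hc a))
    rw [hsand, this]
    simp
  have hone : Vh * V = 1 := by
    have : Vh * (1 : Matrix n n ℂ) * V = 1 := by
      ext b a
      have := key (d b * c a) (Matrix.single o b 1 * Matrix.single a o 1)
        (wordSpan_mul (hd b) (hc a))
      rw [hsand, mul_one, this]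
      by_cases hab : b = a
      · subst hab; simp
      · simp [hab]
    simpa using this
  have hcontract : ∀ w : List σ, Vh * word B w * V = word A w := by
    intro w
    by_cases hw : w = []
    · subst hw; simpa using hone
    · exact hcon _ _ (word_mem_wordSpan hw)
  -- In particular $V\widehat V$ is a companion of the identity, and $B^w-VA^w\widehat V$ is a
  -- companion of zero for every non-empty word.
  have hVXV : ∀ X, (V * X * Vh, X) ∈ wordSpan B A := by
    intro X
    have h1 : (∑ a, ∑ b, X a b • (c a * p * d b), X) ∈ wordSpan B A := by
      have : (∑ a, ∑ b, X a b • (c a * p * d b), X)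
          = ∑ a, ∑ b, X a b • ((c a, Matrix.single a o 1) * (p, E) * (d b, Matrix.single o b 1)) := by
        ext1
        · simp [Prod.fst_sum]
        · simp only [Prod.snd_sum, Prod.smul_snd, Prod.snd_mul]
          conv_lhs => rw [Matrix.matrix_eq_sum_single X]
          simp [hE, Matrix.smul_single]
      rw [this]
      exact Submodule.sum_mem _ fun a _ => Submodule.sum_mem _ fun b _ =>
        Submodule.smul_mem _ _ (wordSpan_mul (wordSpan_mul (hc a) hp) (hd b))
    have h2 : V * X * Vh = ∑ a, ∑ b, X a b • (c a * p * d b) := by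
      ext i j
      have : ∀ a b, (c a * p * d b) i j = V i a * Vh b j := by
        intro a b
        rw [hvφ, Matrix.mul_vecMulVec, Matrix.vecMulVec_mul]
        rfl
      simp only [Matrix.sum_apply, Matrix.smul_apply, this, Matrix.mul_apply, Finset.sum_mul]
      rw [Finset.sum_comm]
      refine Finset.sum_congr rfl fun a _ => Finset.sum_congr rfl fun b _ => ?_
      simp only [smul_eq_mul]; ring
    rw [h2]
    exact h1
  obtain ⟨r, hr⟩ := exists_list_prod_eq_zero htr
  set P := V * Vh with hP
  -- The letters compressed to the complement of `P` have companion zero, so their words of length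
  -- `r` vanish by nilpotency of the kernel. This is the origin of the nilpotency length.
  let D : σ → Matrix n n ℂ := fun i => (1 - P) * B i * (1 - P)
  have hD : ∀ i, (D i, 0) ∈ wordSpan B A := by
    intro i
    have hPm : (P, 1) ∈ wordSpan B A := by simpa using hVXV 1
    have hB : (B i, A i) ∈ wordSpan B A := by simpa using word_mem_wordSpan (w := [i]) (by simp)
    have := add_mem (sub_mem (sub_mem hB (wordSpan_mul hPm hB)) (wordSpan_mul hB hPm))
      (wordSpan_mul (wordSpan_mul hPm hB) hPm)
    have e : D i = B i - P * B i - B i * P + P * B i * P := by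
      simp only [D]; noncomm_ring
    rw [e]
    simpa using this
  have hDw : ∀ w : List σ, w.length = r → word D w = 0 := by
    intro w hw
    refine hr _ (by simpa using hw) ?_
    intro x hx
    obtain ⟨i, -, rfl⟩ := List.mem_map.1 hx
    exact hD i
  -- rows and columns that are invisible to the reduction are killed by long words
  have hrow : ∀ (v : List σ) (Y : Matrix n n ℂ), (∀ w : List σ, Y * word B w * V = 0) →
      Y * word B v = Y * word D v := by
    intro v
    induction v with
    | nil => simp
    | cons i v ih =>
      intro Y hY
      have h1 : Y * B i = Y * D i := by
        have e1 : Y * P = 0 := by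
          have := hY []
          rw [word_nil, Matrix.mul_one] at this
          rw [hP, ← Matrix.mul_assoc, this, Matrix.zero_mul]
        have e2 : Y * B i * P = 0 := by
          have := hY [i]
          rw [word_cons, word_nil, Matrix.mul_one] at this
          rw [hP, ← Matrix.mul_assoc, this, Matrix.zero_mul]
        have : Y * D i = Y * B i - Y * B i * P - (Y * P) * (B i * (1 - P)) := by
          simp only [D]; noncomm_ring
        rw [this, e1, e2]; simp
      rw [word_cons, word_cons, ← Matrix.mul_assoc, ← Matrix.mul_assoc, ← h1, ih]
      intro w
      have := hY (i :: w)
      simpa [Matrix.mul_assoc] using this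
  have hcol : ∀ (u : List σ) (Y : Matrix n m ℂ), (∀ w : List σ, Vh * word B w * Y = 0) →
      word B u * Y = word D u * Y := by
    intro u
    induction u using List.reverseRecOn with
    | nil => simp
    | append_singleton u i ih =>
      intro Y hY
      have h1 : B i * Y = D i * Y := by
        have e1 : P * Y = 0 := by
          have := hY []
          rw [word_nil, Matrix.mul_one] at this
          rw [hP, Matrix.mul_assoc, this, Matrix.mul_zero]
        have e2 : P * (B i * Y) = 0 := by
          have := hY [i]
          rw [word_cons, word_nil, Matrix.mul_one, Matrix.mul_assoc] at this
          rw [hP, Matrix.mul_assoc, this, Matrix.mul_zero]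
        have : D i * Y = B i * Y - P * (B i * Y) - (1 - P) * B i * (P * Y) := by
          simp only [D, Matrix.sub_mul, Matrix.mul_sub, Matrix.one_mul, Matrix.mul_one,
            Matrix.mul_assoc]
        rw [this, e1, e2]; simp
      rw [word_append, word_append, word_cons, word_nil, word_cons, word_nil, Matrix.mul_one,
        Matrix.mul_one, Matrix.mul_assoc, Matrix.mul_assoc, ← h1, ih]
      intro w
      have := hY (w ++ [i])
      simpa [word_append, Matrix.mul_assoc] using this
  refine ⟨r, Vh, V, hcontract, fun u w v hu hv hw => ?_⟩
  -- The defect `j` of the expansion has companion zero, hence vanishes between `Vh` and `V`, also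
  -- when surrounded by further words. So the words to its left and right may be replaced by words
  -- of `D`, which are zero at length `r`.
  have hj : (word B w - V * word A w * Vh, 0) ∈ wordSpan B A := by
    simpa using sub_mem (word_mem_wordSpan (B := B) (A := A) hw) (hVXV (word A w))
  set j := word B w - V * word A w * Vh with hjdef
  have h1 : ∀ v' : List σ, word B u * j * word B v' * V = 0 := by
    intro v'
    have hjv : (j * word B v', 0) ∈ wordSpan B A := by
      by_cases hv' : v' = []
      · subst hv'; simpa using hj
      · simpa using wordSpan_mul hj (word_mem_wordSpan hv')
    rw [Matrix.mul_assoc, Matrix.mul_assoc, hcol, hDw u hu, Matrix.zero_mul]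
    intro u'
    have : (word B u' * (j * word B v'), 0) ∈ wordSpan B A := by
      by_cases hu' : u' = []
      · subst hu'; simpa using hjv
      · simpa using wordSpan_mul (word_mem_wordSpan hu') hjv
    have := hcon _ _ this
    simpa [Matrix.mul_assoc] using this
  have h2 : word B u * j * word B v = 0 := by
    rw [hrow v _ h1, hDw v hv, Matrix.mul_zero]
  rw [hjdef, Matrix.mul_sub, Matrix.sub_mul, sub_eq_zero] at h2
  rw [h2]
  simp only [Matrix.mul_assoc]

end Existence


/-! ### Sums over configurations -/

section Sums

variable {α M : Type*} [Fintype α] [AddCommMonoid M]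

theorem sum_ofFn_succ (f : List α → M) (n : ℕ) :
    ∑ t : Fin (n + 1) → α, f (List.ofFn t) = ∑ i, ∑ t : Fin n → α, f (i :: List.ofFn t) := by
  rw [← (Fin.consEquiv (fun _ : Fin (n + 1) => α)).sum_comp, Fintype.sum_prod_type]
  simp [Fin.consEquiv, List.ofFn_succ]

theorem sum_ofFn_add (f : List α → M) (a b : ℕ) :
    ∑ t : Fin (a + b) → α, f (List.ofFn t)
      = ∑ u : Fin a → α, ∑ v : Fin b → α, f (List.ofFn u ++ List.ofFn v) := by
  induction a generalizing f with
  | zero =>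
    have : ∀ n, n = b → ∑ t : Fin n → α, f (List.ofFn t) = ∑ t : Fin b → α, f (List.ofFn t) := by
      rintro n rfl; rfl
    rw [this (0 + b) (zero_add b)]
    simp
  | succ a ih =>
    have : ∀ n, n = a + b + 1 → ∑ t : Fin n → α, f (List.ofFn t)
        = ∑ t : Fin (a + b + 1) → α, f (List.ofFn t) := by
      rintro n rfl; rfl
    rw [this _ (by omega), sum_ofFn_succ,
      sum_ofFn_succ (fun l => ∑ v : Fin b → α, f (l ++ List.ofFn v))]
    exact Finset.sum_congr rfl fun i _ => ih fun l => f (i :: l)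

theorem sum_ofFn_wall (f : List α → M) (a b : ℕ) :
    ∑ t : Fin (a + b + 2) → α, f (List.ofFn t)
      = ∑ i, ∑ u : Fin a → α, ∑ j, ∑ v : Fin b → α,
        f (i :: (List.ofFn u ++ j :: List.ofFn v)) := by
  have : ∀ n, n = a + (b + 1) + 1 → ∑ t : Fin n → α, f (List.ofFn t)
      = ∑ t : Fin (a + (b + 1) + 1) → α, f (List.ofFn t) := by
    rintro n rfl; rfl
  rw [this _ (by omega), sum_ofFn_succ]
  refine Finset.sum_congr rfl fun i _ => ?_
  rw [sum_ofFn_add fun l => f (i :: l)]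
  refine Finset.sum_congr rfl fun u _ => ?_
  rw [sum_ofFn_succ fun l => f (i :: (List.ofFn u ++ l))]

end Sums

/-! ### Operators and states as traces of words -/

section Contraction

variable {d : ℕ} {m n k : Type*} [Fintype n] [DecidableEq n] [Fintype m] [DecidableEq m]
  [Fintype k] [DecidableEq k]

/-- The product of an operator tensor along a word of outputs and a word of inputs. -/
def opWord (T : Fin d → Fin d → Matrix m m ℂ) (u v : List (Fin d)) : Matrix m m ℂ :=
  (List.zipWith T u v).prod

@[simp]
theorem opWord_nil (T : Fin d → Fin d → Matrix m m ℂ) (v : List (Fin d)) : opWord T [] v = 1 := by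
  simp [opWord]

@[simp]
theorem opWord_cons (T : Fin d → Fin d → Matrix m m ℂ) (i j : Fin d) (u v : List (Fin d)) :
    opWord T (i :: u) (j :: v) = T i j * opWord T u v := by
  simp [opWord]

theorem opWord_append (T : Fin d → Fin d → Matrix m m ℂ) {u u' : List (Fin d)}
    (h : u.length = u'.length) (v v' : List (Fin d)) :
    opWord T (u ++ v) (u' ++ v') = opWord T u u' * opWord T v v' := by
  simp [opWord, List.zipWith_append h]

theorem opWord_ofFn (T : Fin d → Fin d → Matrix m m ℂ) {N : ℕ} (s t : Fin N → Fin d) :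
    opWord T (List.ofFn s) (List.ofFn t) = (List.ofFn fun l => T (s l) (t l)).prod := by
  rw [opWord]
  congr 1
  refine List.ext_getElem (by simp) fun i h1 h2 => by simp

theorem word_act (T : Fin d → Fin d → Matrix m m ℂ) (A : Fin d → Matrix n n ℂ) {N : ℕ}
    {u : List (Fin d)} (hu : u.length = N) :
    word (act T A) u = ∑ t : Fin N → Fin d, opWord T u (List.ofFn t) ⊗ₖ word A (List.ofFn t) := by
  induction u generalizing N with
  | nil =>
    obtain rfl : N = 0 := by simpa using hu.symm
    simp
  | cons i u ih =>
    obtain ⟨N, rfl⟩ : ∃ k, N = k + 1 := ⟨u.length, by simpa using hu.symm⟩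
    rw [sum_ofFn_succ fun l => opWord T (i :: u) l ⊗ₖ word A l, word_cons, ih (by simpa using hu),
      act, Finset.sum_mul]
    simp [Matrix.mul_kronecker_mul, Finset.mul_sum]

theorem word_stack (T : Fin d → Fin d → Matrix m m ℂ) (T' : Fin d → Fin d → Matrix n n ℂ) {N : ℕ}
    {w : List (Fin d × Fin d)} (hw : w.length = N) :
    word (stack T T') w = ∑ t : Fin N → Fin d,
      opWord T (w.map Prod.fst) (List.ofFn t) ⊗ₖ opWord T' (List.ofFn t) (w.map Prod.snd) := by
  induction w generalizing N with
  | nil =>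
    obtain rfl : N = 0 := by simpa using hw.symm
    simp
  | cons i w ih =>
    obtain ⟨N, rfl⟩ : ∃ k, N = k + 1 := ⟨w.length, by simpa using hw.symm⟩
    rw [sum_ofFn_succ fun l => opWord T ((i :: w).map Prod.fst) l ⊗ₖ
      opWord T' l ((i :: w).map Prod.snd), word_cons, ih (by simpa using hw), stack, Finset.sum_mul]
    simp [Matrix.mul_kronecker_mul, Finset.mul_sum]

theorem word_uncurry (T : Fin d → Fin d → Matrix m m ℂ) (w : List (Fin d × Fin d)) :
    word (fun p : Fin d × Fin d => T p.1 p.2) w = opWord T (w.map Prod.fst) (w.map Prod.snd) := by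
  induction w with
  | nil => simp
  | cons i w ih => simp [ih]

theorem mpo_eq_trace {χ : ℕ} (T : Fin d → Fin d → Matrix (Fin χ) (Fin χ) ℂ)
    {N : ℕ} (s t : Fin N → Fin d) :
    mpo T N s t = (opWord T (List.ofFn s) (List.ofFn t)).trace := by
  rw [opWord_ofFn]; rfl

theorem mpo_mulVec_mps {χ D : ℕ} (T : Fin d → Fin d → Matrix (Fin χ) (Fin χ) ℂ)
    (A : Fin d → Matrix (Fin D) (Fin D) ℂ) {N : ℕ} (s : Fin N → Fin d) :
    (mpo T N *ᵥ mps A N) s = (word (act T A) (List.ofFn s)).trace := by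
  rw [word_act T A (List.length_ofFn), Matrix.trace_sum]
  simp [Matrix.mulVec, dotProduct, Matrix.trace_kronecker, mpo_eq_trace, mps]

theorem mpo_mul_mpo {χ χ' : ℕ} (T : Fin d → Fin d → Matrix (Fin χ) (Fin χ) ℂ)
    (T' : Fin d → Fin d → Matrix (Fin χ') (Fin χ') ℂ) {N : ℕ} {w : List (Fin d × Fin d)}
    (hw : w.length = N) {s t : Fin N → Fin d} (hs : List.ofFn s = w.map Prod.fst)
    (ht : List.ofFn t = w.map Prod.snd) :
    (mpo T N * mpo T' N) s t = (word (stack T T') w).trace := by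
  rw [word_stack T T' hw, Matrix.trace_sum]
  simp [Matrix.mul_apply, Matrix.trace_kronecker, mpo_eq_trace, hs, ht]

theorem exists_ofFn_eq {α : Type*} (w : List α) : ∃ s : Fin w.length → α, List.ofFn s = w :=
  ⟨w.get, List.ofFn_get w⟩

end Contraction

/-! ### Existence of fusion and action tensors, and action on domain wall states -/

section Representation

variable {G : Type*} [Group G] {d : ℕ} {U : MPURep G d} {I : Type*} [MulAction G I]

/-- The representation property on a chain of `w.length` sites, read entry by entry. Only non-empty
words arise because chains have at least one site, and this is exactly the input of
`exists_isReduction`. -/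
theorem MPURep.trace_stack (U : MPURep G d) (g h : G) {w : List (Fin d × Fin d)} (hw : w ≠ []) :
    (word (stack (U.T g) (U.T h)) w).trace
      = (word (fun p : Fin d × Fin d => U.T (g * h) p.1 p.2) w).trace := by
  have hs : List.ofFn (fun l : Fin w.length => (w.get l).1) = w.map Prod.fst :=
    List.ext_getElem (by simp) fun i h1 h2 => by simp
  have ht : List.ofFn (fun l : Fin w.length => (w.get l).2) = w.map Prod.snd :=
    List.ext_getElem (by simp) fun i h1 h2 => by simp
  rw [← mpo_mul_mpo (U.T g) (U.T h) rfl hs ht, U.map_mul g h _ (List.length_pos_iff.2 hw),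
    mpo_eq_trace, hs, ht, word_uncurry]

theorem GroundStates.trace_act (S : GroundStates U I) (g : G) (x : I) {w : List (Fin d)}
    (hw : w ≠ []) :
    (word (act (U.T g) (S.A x)) w).trace = (word (S.A (g • x)) w).trace := by
  obtain ⟨s, hs⟩ := exists_ofFn_eq w
  have := congrFun (S.permute g x _ (List.length_pos_iff.2 hw)) s
  rw [mpo_mulVec_mps, hs] at this
  rw [this, mps, hs]

/-- With bond dimension zero every trace, and hence the operator on one site, would vanish,
contradicting unitarity. -/
theorem MPURep.χ_pos (U : MPURep G d) (hd : 0 < d) (g : G) : 0 < U.χ g := by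
  rcases Nat.eq_zero_or_pos (U.χ g) with h | h
  · exfalso
    have hu := U.unitary g 1 one_pos
    have h0 : mpo (U.T g) 1 = 0 := by
      ext s t
      have : IsEmpty (Fin (U.χ g)) := by rw [h]; infer_instance
      simp [mpo, Matrix.trace]
    rw [h0, Matrix.mem_unitaryGroup_iff] at hu
    have := congrFun (congrFun hu fun _ => ⟨0, hd⟩) fun _ => ⟨0, hd⟩
    simp at this
  · exact h

theorem exists_fusionTensors [Finite G] (U : MPURep G d) (hd : 0 < d) :
    ∃ r, Nonempty (FusionTensors U r) := by
  have : ∀ p : G × G, ∃ r Vh V, IsReduction r (stack (U.T p.1) (U.T p.2))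
      (fun q : Fin d × Fin d => U.T (p.1 * p.2) q.1 q.2) Vh V := by
    intro p
    have : Nonempty (Fin (U.χ (p.1 * p.2))) := ⟨⟨0, U.χ_pos hd _⟩⟩
    exact exists_isReduction (U.injective _) fun w hw => U.trace_stack p.1 p.2 hw
  choose r Vh V h using this
  cases nonempty_fintype G
  refine ⟨Finset.univ.sup r, ⟨⟨fun g h => V (g, h), fun g h => Vh (g, h), fun g g' =>
    (h (g, g')).mono (Finset.le_sup (Finset.mem_univ _))⟩⟩⟩

theorem exists_actionTensors [Finite G] [Finite I] (S : GroundStates U I) (hD : ∀ x, 0 < S.D x) :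
    ∃ r, Nonempty (ActionTensors S r) := by
  have : ∀ p : G × I, ∃ r Vh V, IsReduction r (act (U.T p.1) (S.A p.2)) (S.A (p.1 • p.2)) Vh V := by
    intro p
    have : Nonempty (Fin (S.D (p.1 • p.2))) := ⟨⟨0, hD _⟩⟩
    exact exists_isReduction (S.injective _) fun w hw => S.trace_act p.1 p.2 hw
  choose r Vh V h using this
  cases nonempty_fintype G
  cases nonempty_fintype I
  refine ⟨Finset.univ.sup r, ⟨⟨fun g h => V (g, h), fun g h => Vh (g, h), fun g g' =>
    (h (g, g')).mono (Finset.le_sup (Finset.mem_univ _))⟩⟩⟩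

/-- Regard fusion tensors as fusion tensors of a larger nilpotency length. -/
def FusionTensors.mono {r r' : ℕ} (F : FusionTensors U r) (h : r ≤ r') : FusionTensors U r' where
  V := F.V
  Vh := F.Vh
  isReduction g k := (F.isReduction g k).mono h

/-- Regard action tensors as action tensors of a larger nilpotency length. -/
def ActionTensors.mono {S : GroundStates U I} {r r' : ℕ} (W : ActionTensors S r) (h : r ≤ r') :
    ActionTensors S r' where
  W := W.W
  Wh := W.Wh
  isReduction g x := (W.isReduction g x).mono h

/-! ### Domain wall states -/

variable {S : GroundStates U I}

theorem wallState_eq_trace (e : WallTensors S) (x y : I) {a b : ℕ} {t : Fin (a + b + 2) → Fin d}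
    {i j : Fin d} {u v : List (Fin d)} (h : List.ofFn t = i :: (u ++ j :: v)) (hu : u.length = a)
    (hv : v.length = b) :
    wallState e x y a b t
      = (e x y i * word (S.A y) u * e y x j * word (S.A x) v).trace := by
  have ht : ∀ l (hl : l < a + b + 2),
      t ⟨l, hl⟩ = (i :: (u ++ j :: v))[l]'(by rw [← h, List.length_ofFn]; exact hl) := by
    intro l hl
    simp only [← h, List.getElem_ofFn]
  have h0 : t ⟨0, by omega⟩ = i := by rw [ht]; rfl
  have h1 : (List.ofFn fun l : Fin a => t ⟨l + 1, by omega⟩) = u :=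
    List.ext_getElem (by simp [hu]) fun l h1 h2 => by
      rw [List.getElem_ofFn, ht]
      simp [List.getElem_append_left h2]
  have h2 : t ⟨a + 1, by omega⟩ = j := by
    rw [ht]
    simp [List.getElem_append_right, hu]
  have h3 : (List.ofFn fun l : Fin b => t ⟨a + 2 + l, by omega⟩) = v :=
    List.ext_getElem (by simp [hv]) fun l h1 h2 => by
      rw [List.getElem_ofFn, ht]
      have : a + 2 + l = (a + (l + 1)) + 1 := by omega
      simp only [this, List.getElem_cons_succ]
      rw [List.getElem_append_right (by omega)]
      have : a + (l + 1) - u.length = l + 1 := by omega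
      simp only [this, List.getElem_cons_succ]
  rw [wallState, h0, h1, h2, h3]

theorem mpo_mulVec_wallState (e : WallTensors S) (g : G) (x y : I) {a b : ℕ}
    {s : Fin (a + b + 2) → Fin d}
    {i j : Fin d} {u v : List (Fin d)} (h : List.ofFn s = i :: (u ++ j :: v)) (hu : u.length = a)
    (hv : v.length = b) :
    (mpo (U.T g) (a + b + 2) *ᵥ wallState e x y a b) s
      = (act (U.T g) (e x y) i * word (act (U.T g) (S.A y)) u * act (U.T g) (e y x) j
        * word (act (U.T g) (S.A x)) v).trace := by
  -- The summand is rewritten as a function of a list, so that the sum can be split at the two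
  -- walls. The value at lists of the wrong length is irrelevant.
  let F : List (Fin d) → ℂ := fun l => if hl : l.length = a + b + 2 then
    (opWord (U.T g) (List.ofFn s) l).trace * wallState e x y a b (fun k => l[k]) else 0
  have hF : ∀ t : Fin (a + b + 2) → Fin d,
      mpo (U.T g) (a + b + 2) s t * wallState e x y a b t = F (List.ofFn t) := by
    intro t
    simp only [F]
    rw [dif_pos List.length_ofFn, mpo_eq_trace]
    congr 2
    ext k
    simp only [Fin.getElem_fin, List.getElem_ofFn]
  rw [Matrix.mulVec, dotProduct]
  simp only [hF]
  rw [sum_ofFn_wall]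
  have hF' : ∀ (i' j' : Fin d) (u' : Fin a → Fin d) (v' : Fin b → Fin d),
      F (i' :: (List.ofFn u' ++ j' :: List.ofFn v'))
        = ((U.T g i i' ⊗ₖ e x y i') * (opWord (U.T g) u (List.ofFn u') ⊗ₖ word (S.A y) (List.ofFn u'))
          * (U.T g j j' ⊗ₖ e y x j')
          * (opWord (U.T g) v (List.ofFn v') ⊗ₖ word (S.A x) (List.ofFn v'))).trace := by
    intro i' j' u' v'
    have hl : (i' :: (List.ofFn u' ++ j' :: List.ofFn v')).length = a + b + 2 := by
      simp; omega
    simp only [F]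
    rw [dif_pos hl, wallState_eq_trace (i := i') (j := j') (u := List.ofFn u') (v := List.ofFn v')
      e x y ?_ (by simp) (by simp), h, opWord_cons, opWord_append _ (by simp [hu]), opWord_cons]
    · simp only [← Matrix.mul_kronecker_mul, Matrix.trace_kronecker, Matrix.mul_assoc]
    · refine List.ext_getElem (by simp [hl]) fun l h1 h2 => by
        simp only [List.getElem_ofFn, Fin.getElem_fin]
  simp only [hF']
  rw [word_act _ _ hu, word_act _ _ hv, act, act]
  simp only [← Matrix.trace_sum, Matrix.mul_assoc]
  simp only [Matrix.sum_mul]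
  simp only [Matrix.mul_sum]

end Representation


/-! ### Local domain wall phases -/

section WallPhase

variable {σ n n' m m' : Type*} [Fintype n] [DecidableEq n] [Fintype m] [DecidableEq m]
  [Fintype n'] [DecidableEq n'] [Fintype m'] [DecidableEq m']

/-- The action on a wall between two reductions that holds for `r` columns on both sides holds for
more columns. -/
theorem StrongReduction.wall_le {r : ℕ} {B : σ → Matrix n n ℂ} {A : σ → Matrix m m ℂ}
    {Vh : Matrix m n ℂ} {V : Matrix n m ℂ} {B' : σ → Matrix n' n' ℂ} {A' : σ → Matrix m' m' ℂ}
    {Vh' : Matrix m' n' ℂ} {V' : Matrix n' m' ℂ} (h : StrongReduction r B A Vh V)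
    (h' : StrongReduction r B' A' Vh' V') {E : Matrix n n' ℂ} {E' : Matrix m m' ℂ} {c : ℂ}
    (hE : ∀ u v : List σ, u.length = r → v.length = r →
      Vh * word B u * E * word B' v * V' = c • (word A u * E' * word A' v))
    {u v : List σ} (hu : r ≤ u.length) (hv : r ≤ v.length) :
    Vh * word B u * E * word B' v * V' = c • (word A u * E' * word A' v) := by
  obtain ⟨u1, u2, rfl, -, hu2⟩ := exists_split u (a := u.length - r) (b := r) (by omega)
  obtain ⟨v1, v2, rfl, hv1, -⟩ := exists_split v (a := r) (b := v.length - r) (by omega)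
  have e1 := congrArg (· * (E * (word B' v1 * (word B' v2 * V')))) (h.left u1 u2 hu2)
  have e2 := congrArg (fun M => word A u1 * Vh * word B u2 * E * M) (h'.right v1 v2 hv1)
  have e3 := congrArg (fun M => word A u1 * M * word A' v2) (hE u2 v1 hu2 hv1)
  simp only [word_append, Matrix.mul_assoc, Matrix.mul_smul, Matrix.smul_mul] at e1 e2 e3 ⊢
  rw [e1, e2, e3]

theorem trace_mul_single_mul_single (X : Matrix m m' ℂ) (Y : Matrix m' m ℂ) (a : m) (b a' : m')
    (b' : m) :
    (X * Matrix.single b a' (1 : ℂ) * Y * Matrix.single b' a (1 : ℂ)).trace = X a b * Y a' b' := by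
  rw [Matrix.trace_mul_single]
  simp [Matrix.mul_apply, Matrix.single_apply, ite_and]

variable [Fintype σ] {A : σ → Matrix m m ℂ} {A' : σ → Matrix m' m' ℂ}

/-- Two products around a ring are proportional as soon as their contractions with long words in
injective tensors are. -/
theorem IsInjective.entries_of_trace (hA : IsInjective A) (hA' : IsInjective A') (l : ℕ)
    {X X' : Matrix m m' ℂ} {Y Y' : Matrix m' m ℂ} {c : ℂ}
    (h : ∀ w w' : List σ, w.length = l + 1 → w'.length = l + 1 →
      (X * word A' w * Y * word A w').trace = c * (X' * word A' w * Y' * word A w').trace)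
    (a : m) (b a' : m') (b' : m) : X a b * Y a' b' = c * (X' a b * Y' a' b') := by
  have h1 : ∀ w : List σ, w.length = l + 1 → ∀ N : Matrix m m ℂ,
      (X * word A' w * Y * N).trace = c * (X' * word A' w * Y' * N).trace := by
    intro w hw N
    have := hA.linearMap_ext l
      (f := Matrix.traceLinearMap m ℂ ℂ ∘ₗ sandwich (X * word A' w * Y) (1 : Matrix m m ℂ))
      (g := c • Matrix.traceLinearMap m ℂ ℂ ∘ₗ sandwich (X' * word A' w * Y') (1 : Matrix m m ℂ))
      (fun w' hw' => by simpa using h w w' hw hw') N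
    simpa using this
  have h2 : ∀ (M : Matrix m' m' ℂ) (N : Matrix m m ℂ),
      (X * M * Y * N).trace = c * (X' * M * Y' * N).trace := by
    intro M N
    have := hA'.linearMap_ext l (f := Matrix.traceLinearMap m ℂ ℂ ∘ₗ sandwich X (Y * N))
      (g := c • Matrix.traceLinearMap m ℂ ℂ ∘ₗ sandwich X' (Y' * N))
      (fun w hw => by simpa [Matrix.mul_assoc] using h1 w hw N) M
    simpa [Matrix.mul_assoc] using this
  simpa only [trace_mul_single_mul_single] using h2 (Matrix.single b a' 1) (Matrix.single b' a 1)

/-- Combinations of words of any given length include the identity on either side, so a non-zero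
tensor cannot be annihilated by all of them. This makes factors on wall tensors well defined. -/
theorem IsInjective.exists_word_mul_ne_zero (hA : IsInjective A) (hA' : IsInjective A')
    {e : σ → Matrix m m' ℂ} (he : e ≠ 0) (l l' : ℕ) :
    ∃ (u : List σ) (i : σ) (v : List σ), u.length = l ∧ v.length = l' ∧
      word A u * e i * word A' v ≠ 0 := by
  by_contra! h
  refine he (funext fun i => ?_)
  have h1 : ∀ u : List σ, u.length = l → word A u * e i = 0 := by
    intro u hu
    have := hA'.sandwich_ext_one l' (M := word A u * e i) (N := (1 : Matrix m' m' ℂ)) (M' := 0)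
      (N' := 0) fun v hv => by simpa using h u i v hu hv
    simpa using this
  have := hA.sandwich_ext_one l (M := (1 : Matrix m m ℂ)) (N := e i) (M' := 0)
    (N' := 0) fun v hv => by simpa using h1 v hv
  simpa using this

end WallPhase

/-! ### Existence and uniqueness of the domain wall phases -/

section WallPhase

variable {G : Type*} [Group G] {d : ℕ} {U : MPURep G d} {I : Type*} [MulAction G I]
  {S : GroundStates U I} {r : ℕ}

theorem ActionTensors.strong (W : ActionTensors S r) (g : G) (x : I) :
    StrongReduction r (act (U.T g) (S.A x)) (S.A (g • x)) (W.Wh g x) (W.W g x) :=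
  (W.isReduction g x).strong (S.injective _)

theorem FusionTensors.strong (F : FusionTensors U r) (g h : G) :
    StrongReduction r (stack (U.T g) (U.T h)) (fun p : Fin d × Fin d => U.T (g * h) p.1 p.2)
      (F.Vh g h) (F.V g h) :=
  (F.isReduction g h).strong (U.injective _)

/-- If the state vanished, `entries_of_trace` with factor zero would make every product of an entry
of one wall and an entry of the other vanish. -/
theorem wallState_ne_zero {e : WallTensors S} (he0 : ∀ x y, e x y ≠ 0) (x y : I) (l : ℕ) :
    wallState e x y (l + 1) (l + 1) ≠ 0 := by
  intro h
  obtain ⟨_, i, _, _, _, hi⟩ :=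
    (S.injective x).exists_word_mul_ne_zero (S.injective y) (he0 x y) 0 0
  obtain ⟨_, j, _, _, _, hj⟩ :=
    (S.injective y).exists_word_mul_ne_zero (S.injective x) (he0 y x) 0 0
  have hi' : e x y i ≠ 0 := by rintro h; simp [h] at hi
  have hj' : e y x j ≠ 0 := by rintro h; simp [h] at hj
  have key := (S.injective x).entries_of_trace (S.injective y) l (X := e x y i) (Y := e y x j)
    (X' := e x y i) (Y' := e y x j) (c := 0) fun w w' hw hw' => by
      have hl : (i :: (w ++ j :: w')).length = l + 1 + (l + 1) + 2 := by simp [hw, hw']; omega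
      have h1 := congrFun h fun k => (i :: (w ++ j :: w'))[k]
      rw [wallState_eq_trace (i := i) (j := j) (u := w) (v := w') e x y ?_ hw hw'] at h1
      · simpa using h1
      · refine List.ext_getElem (by rw [List.length_ofFn, hl]) fun k h1 h2 => by
          simp only [List.getElem_ofFn, Fin.getElem_fin]
  obtain ⟨a, b, hab⟩ : ∃ a b, e x y i a b ≠ 0 := by
    by_contra! hh; exact hi' (Matrix.ext hh)
  obtain ⟨a', b', hab'⟩ : ∃ a b, e y x j a b ≠ 0 := by
    by_contra! hh; exact hj' (Matrix.ext hh)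
  have := key a b a' b'
  simp_all

theorem MPURep.mulVec_ne_zero (U : MPURep G d) (g : G) {N : ℕ} (hN : 0 < N)
    {ψ : (Fin N → Fin d) → ℂ} (h : ψ ≠ 0) : mpo (U.T g) N *ᵥ ψ ≠ 0 := by
  intro h0
  have h1 := Matrix.mem_unitaryGroup_iff'.1 (U.unitary g N hN)
  apply h
  rw [← Matrix.one_mulVec ψ, ← h1, ← Matrix.mulVec_mulVec, h0, Matrix.mulVec_zero]

/-- In both long domains of $U_g\psi(x,y)$ the middle part is reduced to words of `S.A`. What
remains is a ring with a block `X` around the first wall and a block `Y` around the second, while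
the image state has the blocks `X'` and `Y'`. Injectivity opens the ring and gives
$X_{ab}Y_{a'b'}=c\,X'_{ab}Y'_{a'b'}$ with one `c` for all letters, so `X` is a fixed multiple of
`X'`. -/
theorem exists_wallPhase (W : ActionTensors S r) {e : WallTensors S} (he0 : ∀ x y, e x y ≠ 0)
    (he : PermutesWalls e) (g : G) (x y : I) :
    ∃ c : ℂˣ, ∀ (u v : List (Fin d)) (i : Fin d), u.length = r → v.length = r →
      W.Wh g x * word (act (U.T g) (S.A x)) u * act (U.T g) (e x y) i
        * word (act (U.T g) (S.A y)) v * W.W g y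
      = (c : ℂ) • (word (S.A (g • x)) u * e (g • x) (g • y) i * word (S.A (g • y)) v) := by
  obtain ⟨ℓ, hℓ⟩ := he g x y
  -- Each domain consists of `r` sites at either wall and a non-empty middle word that is reduced;
  -- the middle also makes the domain longer than the separation required by `he`.
  set N := r + (ℓ + 1) + r with hN
  obtain ⟨c, hc⟩ := hℓ N N (by omega) (by omega)
  -- The unitary is injective and the two-wall state is not zero.
  have hc0 : c ≠ 0 := by
    rintro rfl
    rw [zero_smul] at hc
    obtain ⟨l, hl⟩ : ∃ l, N = l + 1 := ⟨r + ℓ + r, by omega⟩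
    rw [hl] at hc
    exact U.mulVec_ne_zero g (by omega) (wallState_ne_zero he0 x y l) hc
  let X : List (Fin d) → Fin d → List (Fin d) → Matrix (Fin (S.D (g • x))) (Fin (S.D (g • y))) ℂ :=
    fun u i v => W.Wh g x * word (act (U.T g) (S.A x)) u * act (U.T g) (e x y) i
        * word (act (U.T g) (S.A y)) v * W.W g y
  let Y : List (Fin d) → Fin d → List (Fin d) → Matrix (Fin (S.D (g • y))) (Fin (S.D (g • x))) ℂ :=
    fun u i v => W.Wh g y * word (act (U.T g) (S.A y)) u * act (U.T g) (e y x) i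
        * word (act (U.T g) (S.A x)) v * W.W g x
  let X' : List (Fin d) → Fin d → List (Fin d) → Matrix (Fin (S.D (g • x))) (Fin (S.D (g • y))) ℂ :=
    fun u i v => word (S.A (g • x)) u * e (g • x) (g • y) i * word (S.A (g • y)) v
  let Y' : List (Fin d) → Fin d → List (Fin d) → Matrix (Fin (S.D (g • y))) (Fin (S.D (g • x))) ℂ :=
    fun u i v => word (S.A (g • y)) u * e (g • y) (g • x) i * word (S.A (g • x)) v
  have key : ∀ (u u' v v' : List (Fin d)) (i j : Fin d), u.length = r → u'.length = r →
      v.length = r → v'.length = r → ∀ a b a' b',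
      X u i v a b * Y u' j v' a' b' = c * (X' u i v a b * Y' u' j v' a' b') := by
    intro u u' v v' i j hu hu' hv hv'
    refine (S.injective (g • x)).entries_of_trace (S.injective (g • y)) ℓ fun w w' hw hw' => ?_
    have hw0 : w ≠ [] := by rintro rfl; simp at hw
    have hw0' : w' ≠ [] := by rintro rfl; simp at hw'
    have hl1 : (v ++ w ++ u').length = N := by simp [hu', hw, hv, hN, add_assoc]
    have hl2 : (v' ++ w' ++ u).length = N := by simp [hu, hw', hv', hN, add_assoc]
    have hl : (i :: ((v ++ w ++ u') ++ j :: (v' ++ w' ++ u))).length = N + N + 2 := by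
      rw [List.length_cons, List.length_append, List.length_cons, hl1, hl2]; omega
    have hs : List.ofFn (fun k : Fin (N + N + 2) =>
        (i :: ((v ++ w ++ u') ++ j :: (v' ++ w' ++ u)))[k])
        = i :: ((v ++ w ++ u') ++ j :: (v' ++ w' ++ u)) :=
      List.ext_getElem (by rw [List.length_ofFn, hl]) fun k h1 h2 => by
        simp only [List.getElem_ofFn, Fin.getElem_fin]
    have h1 := congrFun hc fun k => (i :: ((v ++ w ++ u') ++ j :: (v' ++ w' ++ u)))[k]
    rw [mpo_mulVec_wallState e g x y hs hl1 hl2, Pi.smul_apply,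
      wallState_eq_trace e _ _ hs hl1 hl2] at h1
    simp only [word_append] at h1
    rw [(W.isReduction g y).expand v w u' hv hu' hw0, (W.isReduction g x).expand v' w' u hv' hu hw0']
      at h1
    have e1 : (X u i v * word (S.A (g • y)) w * Y u' j v' * word (S.A (g • x)) w').trace
        = (act (U.T g) (e x y) i * (word (act (U.T g) (S.A y)) v * W.W g y * word (S.A (g • y)) w
          * W.Wh g y * word (act (U.T g) (S.A y)) u') * act (U.T g) (e y x) j
          * (word (act (U.T g) (S.A x)) v' * W.W g x * word (S.A (g • x)) w' * W.Wh g x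
          * word (act (U.T g) (S.A x)) u)).trace := by
      have : X u i v * word (S.A (g • y)) w * Y u' j v' * word (S.A (g • x)) w'
        = (W.Wh g x * word (act (U.T g) (S.A x)) u) * (act (U.T g) (e x y) i
          * (word (act (U.T g) (S.A y)) v * W.W g y * word (S.A (g • y)) w
          * W.Wh g y * word (act (U.T g) (S.A y)) u') * act (U.T g) (e y x) j
          * (word (act (U.T g) (S.A x)) v' * W.W g x * word (S.A (g • x)) w')) := by
        simp only [X, Y, Matrix.mul_assoc]
      rw [this, Matrix.trace_mul_comm]
      simp only [Matrix.mul_assoc]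
    have e2 : (X' u i v * word (S.A (g • y)) w * Y' u' j v' * word (S.A (g • x)) w').trace
        = (e (g • x) (g • y) i * (word (S.A (g • y)) v * word (S.A (g • y)) w
          * word (S.A (g • y)) u') * e (g • y) (g • x) j * (word (S.A (g • x)) v'
          * word (S.A (g • x)) w' * word (S.A (g • x)) u)).trace := by
      have : (X' u i v * word (S.A (g • y)) w * Y' u' j v' * word (S.A (g • x)) w')
        = word (S.A (g • x)) u * (e (g • x) (g • y) i * (word (S.A (g • y)) v * word (S.A (g • y)) w
          * word (S.A (g • y)) u') * e (g • y) (g • x) j * (word (S.A (g • x)) v'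
          * word (S.A (g • x)) w')) := by simp only [X', Y', Matrix.mul_assoc]
      rw [this, Matrix.trace_mul_comm]
      simp only [Matrix.mul_assoc]
    rw [e1, e2, h1, smul_eq_mul]
  obtain ⟨u0, i0, v0, hu0, hv0, h0⟩ := (S.injective (g • x)).exists_word_mul_ne_zero
    (S.injective (g • y)) (he0 (g • x) (g • y)) r r
  obtain ⟨u1, i1, v1, hu1, hv1, h1⟩ := (S.injective (g • y)).exists_word_mul_ne_zero
    (S.injective (g • x)) (he0 (g • y) (g • x)) r r
  obtain ⟨a, b, hab⟩ : ∃ a b, X' u0 i0 v0 a b ≠ 0 := by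
    by_contra! hh; exact h0 (Matrix.ext hh)
  obtain ⟨a', b', hab'⟩ : ∃ a b, Y' u1 i1 v1 a b ≠ 0 := by
    by_contra! hh; exact h1 (Matrix.ext hh)
  -- Dividing by this entry of the second wall isolates the first wall; it cannot vanish because the
  -- corresponding product of entries of `X'` and `Y'` does not.
  have hY : Y u1 i1 v1 a' b' ≠ 0 := by
    intro h
    have := key u0 u1 v0 v1 i0 i1 hu0 hu1 hv0 hv1 a b a' b'
    rw [h, mul_zero] at this
    exact mul_ne_zero hc0 (mul_ne_zero hab hab') this.symm
  refine ⟨Units.mk0 (c * Y' u1 i1 v1 a' b' / Y u1 i1 v1 a' b')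
    (div_ne_zero (mul_ne_zero hc0 hab') hY), fun u v i hu hv => ?_⟩
  ext a2 b2
  have := key u u1 v v1 i i1 hu hu1 hv hv1 a2 b2 a' b'
  change X u i v a2 b2 = _ * X' u i v a2 b2
  rw [Units.val_mk0]
  field_simp
  rw [this]
  ring

theorem existsUnique_isWallPhase (W : ActionTensors S r) {e : WallTensors S}
    (he0 : ∀ x y, e x y ≠ 0) (he : PermutesWalls e) : ∃! B, IsWallPhase W e B := by
  choose B hB using exists_wallPhase W he0 he
  refine ⟨B, fun g y x u v i hu hv => hB g y x u v i hu hv, fun B' hB' => ?_⟩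
  funext g y x
  obtain ⟨u, i, v, hu, hv, h⟩ := (S.injective (g • y)).exists_word_mul_ne_zero
    (S.injective (g • x)) (he0 (g • y) (g • x)) r r
  have h1 := hB' g y x u v i hu hv
  rw [hB g y x u v i hu hv] at h1
  exact Units.ext (smul_left_injective ℂ h h1).symm

end WallPhase


/-! ### Tensors glued along a contracted index -/

section Glue

variable {σ τ₁ τ₂ K m m' n n' k k' l l' : Type*} [Fintype K]
  [Fintype n] [DecidableEq n] [Fintype m] [DecidableEq m]
  [Fintype n'] [DecidableEq n'] [Fintype m'] [DecidableEq m']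
  [Fintype k] [DecidableEq k] [Fintype k'] [DecidableEq k']
  [Fintype l] [DecidableEq l] [Fintype l'] [DecidableEq l']

/-- The tensor `∑ κ, P (p s κ) ⊗ Q (q s κ)`; it covers both `act` and `stack`. -/
def glue (P : τ₁ → Matrix m m ℂ) (Q : τ₂ → Matrix n n' ℂ) (p : σ → K → τ₁) (q : σ → K → τ₂) :
    σ → Matrix (m × n) (m × n') ℂ :=
  fun s => ∑ κ, P (p s κ) ⊗ₖ Q (q s κ)

variable {P : τ₁ → Matrix m m ℂ} {P' : τ₁ → Matrix m' m' ℂ} {Q : τ₂ → Matrix n n ℂ}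
  {Q' : τ₂ → Matrix n' n' ℂ} {p : σ → K → τ₁} {q : σ → K → τ₂}

/-- Two linear maps that agree on products of words agree on the words of the glued tensors. -/
theorem glue_linear {M : Type*} [AddCommGroup M] [Module ℂ M] (w : List σ)
    {f : Matrix (m × n) (m × n) ℂ →ₗ[ℂ] M} {g : Matrix (m' × n') (m' × n') ℂ →ₗ[ℂ] M}
    (h : ∀ a b, a.length = w.length → b.length = w.length →
      f (word P a ⊗ₖ word Q b) = g (word P' a ⊗ₖ word Q' b)) :
    f (word (glue P Q p q) w) = g (word (glue P' Q' p q) w) := by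
  induction w generalizing f g with
  | nil => simpa using h [] [] rfl rfl
  | cons i w ih =>
    rw [word_cons, word_cons]
    simp only [glue, Finset.sum_mul, map_sum]
    refine Finset.sum_congr rfl fun κ _ => ?_
    refine ih (f := f ∘ₗ LinearMap.mulLeft ℂ (P (p i κ) ⊗ₖ Q (q i κ)))
      (g := g ∘ₗ LinearMap.mulLeft ℂ (P' (p i κ) ⊗ₖ Q' (q i κ))) fun a b ha hb => ?_
    have := h (p i κ :: a) (q i κ :: b) (by simp [ha]) (by simp [hb])
    simpa [Matrix.mul_kronecker_mul] using this

variable {r : ℕ} {Vh : Matrix m' m ℂ} {V : Matrix m m' ℂ} {Wh : Matrix n' n ℂ} {W : Matrix n n' ℂ}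

/-- Words of a glued tensor are sums of Kronecker products of words of the factors, and on each
summand the identities hold factor by factor. Hence reductions of single layers give reductions of
towers. -/
theorem StrongReduction.glue (hP : StrongReduction r P P' Vh V) (hQ : StrongReduction r Q Q' Wh W)
    (p : σ → K → τ₁) (q : σ → K → τ₂) :
    StrongReduction r (glue P Q p q) (glue P' Q' p q) (Vh ⊗ₖ Wh) (V ⊗ₖ W) where
  contract w := glue_linear (f := sandwich (Vh ⊗ₖ Wh) (V ⊗ₖ W)) (g := LinearMap.id) w
    fun a b _ _ => by
      simp only [sandwich_apply, ← Matrix.mul_kronecker_mul, hP.contract, hQ.contract,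
        LinearMap.id_apply]
  right u w hu := by
    have := glue_linear (P := P) (P' := P') (Q := Q) (Q' := Q') (p := p) (q := q) w
      (f := sandwich (word (DomainWall.glue P Q p q) u) (V ⊗ₖ W))
      (g := sandwich (word (DomainWall.glue P Q p q) u * (V ⊗ₖ W)) (1 : Matrix (m' × n') (m' × n') ℂ)) fun a b _ _ => by
      have := glue_linear (P := P) (P' := P) (Q := Q) (Q' := Q) (p := p) (q := q) u
        (f := sandwich (1 : Matrix (m × n) (m × n) ℂ) (word P a ⊗ₖ word Q b * (V ⊗ₖ W)))
        (g := sandwich (1 : Matrix (m × n) (m × n) ℂ) ((V ⊗ₖ W) * (word P' a ⊗ₖ word Q' b))) fun c d hc hd => by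
        have e1 := hP.right c a (hc.trans hu)
        have e2 := hQ.right d b (hd.trans hu)
        simp only [sandwich_apply, ← Matrix.mul_kronecker_mul, Matrix.one_mul, Matrix.mul_assoc]
          at e1 e2 ⊢
        rw [e1, e2]
      simpa [Matrix.mul_assoc] using this
    simpa using this
  left w v hv := by
    have := glue_linear (P := P) (P' := P') (Q := Q) (Q' := Q') (p := p) (q := q) w
      (f := sandwich (Vh ⊗ₖ Wh) (word (DomainWall.glue P Q p q) v))
      (g := sandwich (1 : Matrix (m' × n') (m' × n') ℂ)
        ((Vh ⊗ₖ Wh) * word (DomainWall.glue P Q p q) v)) fun a b _ _ => by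
      have := glue_linear (P := P) (P' := P) (Q := Q) (Q' := Q) (p := p) (q := q) v
        (f := sandwich ((Vh ⊗ₖ Wh) * (word P a ⊗ₖ word Q b)) (1 : Matrix (m × n) (m × n) ℂ))
        (g := sandwich ((word P' a ⊗ₖ word Q' b) * (Vh ⊗ₖ Wh)) (1 : Matrix (m × n) (m × n) ℂ))
        fun c d hc hd => by
        have e1 := hP.left a c (hc.trans hv)
        have e2 := hQ.left b d (hd.trans hv)
        simp only [sandwich_apply, ← Matrix.mul_kronecker_mul, Matrix.mul_one, Matrix.mul_assoc]
          at e1 e2 ⊢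
        rw [e1, e2]
      simpa [Matrix.mul_assoc] using this
    simpa [Matrix.mul_assoc] using this
  expand u w v hu hv hw := by
    have := glue_linear (P := P) (P' := P') (Q := Q) (Q' := Q') (p := p) (q := q) w
      (f := sandwich (word (DomainWall.glue P Q p q) u) (word (DomainWall.glue P Q p q) v))
      (g := sandwich (word (DomainWall.glue P Q p q) u * (V ⊗ₖ W))
        ((Vh ⊗ₖ Wh) * word (DomainWall.glue P Q p q) v)) fun a b ha hb => by
      have := glue_linear (P := P) (P' := P) (Q := Q) (Q' := Q) (p := p) (q := q) u
        (f := sandwich (1 : Matrix (m × n) (m × n) ℂ) (word P a ⊗ₖ word Q b * word (DomainWall.glue P Q p q) v))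
        (g := sandwich (1 : Matrix (m × n) (m × n) ℂ) ((V ⊗ₖ W) * (word P' a ⊗ₖ word Q' b) * ((Vh ⊗ₖ Wh)
          * word (DomainWall.glue P Q p q) v))) fun c d hc hd => by
        have := glue_linear (P := P) (P' := P) (Q := Q) (Q' := Q) (p := p) (q := q) v
          (f := sandwich ((word P c ⊗ₖ word Q d) * (word P a ⊗ₖ word Q b)) (1 : Matrix (m × n) (m × n) ℂ))
          (g := sandwich ((word P c ⊗ₖ word Q d) * (V ⊗ₖ W) * (word P' a ⊗ₖ word Q' b)
            * (Vh ⊗ₖ Wh)) (1 : Matrix (m × n) (m × n) ℂ)) fun c' d' hc' hd' => by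
          have hw' := List.length_pos_iff.2 hw
          have e1 := hP.expand c a c' (hc.trans hu) (hc'.trans hv) (by rintro rfl; simp at ha; omega)
          have e2 := hQ.expand d b d' (hd.trans hu) (hd'.trans hv) (by rintro rfl; simp at hb; omega)
          simp only [sandwich_apply, ← Matrix.mul_kronecker_mul, Matrix.mul_one, Matrix.mul_assoc]
            at e1 e2 ⊢
          rw [e1, e2]
        simpa [Matrix.mul_assoc] using this
      simpa [Matrix.mul_assoc] using this
    simpa [Matrix.mul_assoc] using this

/-- Reductions on the two sides of a wall may be glued. -/
theorem glue_wall {Qy : τ₂ → Matrix n n ℂ} {Qx : τ₂ → Matrix k k ℂ} {Qy' : τ₂ → Matrix n' n' ℂ}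
    {Qx' : τ₂ → Matrix k' k' ℂ} {E : τ₂ → Matrix n k ℂ} {E' : τ₂ → Matrix n' k' ℂ} {β : ℂ}
    {Kh : Matrix n' n ℂ} {K' : Matrix k k' ℂ} {u v : List σ} (i : σ)
    (hP : ∀ w, Vh * word P w * V = word P' w)
    (hQ : ∀ a j b, a.length = u.length → b.length = v.length →
      Kh * word Qy a * E j * word Qx b * K' = β • (word Qy' a * E' j * word Qx' b)) :
    (Vh ⊗ₖ Kh) * word (glue P Qy p q) u * glue P E p q i * word (glue P Qx p q) v * (V ⊗ₖ K')
      = β • (word (glue P' Qy' p q) u * glue P' E' p q i * word (glue P' Qx' p q) v) := by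
  have h1 : ∀ a b, a.length = u.length → b.length = u.length → ∀ κ a' b', a'.length = v.length →
      b'.length = v.length →
      (Vh ⊗ₖ Kh) * (word P a ⊗ₖ word Qy b) * (P (p i κ) ⊗ₖ E (q i κ)) * (word P a' ⊗ₖ word Qx b')
        * (V ⊗ₖ K') = β • ((word P' a ⊗ₖ word Qy' b) * (P' (p i κ) ⊗ₖ E' (q i κ))
          * (word P' a' ⊗ₖ word Qx' b')) := by
    intro a b ha hb κ a' b' ha' hb'
    have e1 := hP (a ++ p i κ :: a')
    have e2 := hQ b (q i κ) b' hb hb'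
    simp only [word_append, word_cons, ← Matrix.mul_assoc] at e1
    simp only [← Matrix.mul_kronecker_mul, e1, e2, Matrix.kronecker_smul]
  have h2 : ∀ a b, a.length = u.length → b.length = u.length →
      (Vh ⊗ₖ Kh) * (word P a ⊗ₖ word Qy b) * glue P E p q i * word (glue P Qx p q) v
        * (V ⊗ₖ K') = β • ((word P' a ⊗ₖ word Qy' b) * glue P' E' p q i
          * word (glue P' Qx' p q) v) := by
    intro a b ha hb
    have := glue_linear (P := P) (P' := P') (Q := Qx) (Q' := Qx') (p := p) (q := q) v
      (f := sandwich ((Vh ⊗ₖ Kh) * (word P a ⊗ₖ word Qy b) * glue P E p q i) (V ⊗ₖ K'))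
      (g := β • sandwich ((word P' a ⊗ₖ word Qy' b) * glue P' E' p q i)
        (1 : Matrix (m' × k') (m' × k') ℂ)) fun a' b' ha' hb' => by
      simp only [sandwich_apply, LinearMap.smul_apply, Matrix.mul_one, glue, Matrix.mul_sum,
        Matrix.sum_mul, Finset.smul_sum]
      exact Finset.sum_congr rfl fun κ _ => h1 a b ha hb κ a' b' ha' hb'
    simpa using this
  have := glue_linear (P := P) (P' := P') (Q := Qy) (Q' := Qy') (p := p) (q := q) u
    (f := sandwich (Vh ⊗ₖ Kh) (glue P E p q i * word (glue P Qx p q) v * (V ⊗ₖ K')))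
    (g := β • sandwich (1 : Matrix (m' × n') (m' × n') ℂ) (glue P' E' p q i * word (glue P' Qx' p q) v)) fun a b ha hb => by
    have := h2 a b ha hb
    simpa [Matrix.mul_assoc] using this
  simpa [Matrix.mul_assoc] using this

end Glue

/-! ### Towers of operator tensors on a state tensor -/

section Towers

variable {d : ℕ} {a b c m m' n n' k k' : Type*} [Fintype n] [DecidableEq n] [Fintype m]
  [DecidableEq m] [Fintype n'] [DecidableEq n'] [Fintype m'] [DecidableEq m']
  [Fintype a] [DecidableEq a] [Fintype b] [DecidableEq b] [Fintype c] [DecidableEq c]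
  [Fintype k] [DecidableEq k] [Fintype k'] [DecidableEq k']

/-- The fusion `V` of the two topmost layers of a tower. -/
def fuse (n : Type*) [DecidableEq n] (V : Matrix (a × b) c ℂ) : Matrix (a × b × n) (c × n) ℂ :=
  (V ⊗ₖ (1 : Matrix n n ℂ)).submatrix (Equiv.prodAssoc a b n).symm id

/-- The splitting `Vh` of the topmost layer of a tower into two. -/
def unfuse (n : Type*) [DecidableEq n] (Vh : Matrix c (a × b) ℂ) : Matrix (c × n) (a × b × n) ℂ :=
  (Vh ⊗ₖ (1 : Matrix n n ℂ)).submatrix id (Equiv.prodAssoc a b n).symm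

theorem act_eq_glue (T : Fin d → Fin d → Matrix m m ℂ) (A : Fin d → Matrix n n' ℂ) :
    act T A = glue (fun p : Fin d × Fin d => T p.1 p.2) A (fun i j => (i, j)) (fun _ j => j) := rfl

theorem act_stack (T : Fin d → Fin d → Matrix a a ℂ) (T' : Fin d → Fin d → Matrix b b ℂ)
    (A : Fin d → Matrix n n' ℂ) :
    act (fun i j => stack T T' (i, j)) A = fun i => (act T (act T' A) i).submatrix
      (Equiv.prodAssoc a b n) (Equiv.prodAssoc a b n') := by
  funext i
  ext ⟨⟨x, y⟩, z⟩ ⟨⟨x', y'⟩, z'⟩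
  simp only [act, stack, Matrix.sum_apply, Matrix.kroneckerMap_apply, Matrix.submatrix_apply,
    Equiv.prodAssoc_apply, Finset.mul_sum, Finset.sum_mul]
  rw [Finset.sum_comm]
  simp only [mul_assoc]

theorem act_act_eq_submatrix (T : Fin d → Fin d → Matrix a a ℂ) (T' : Fin d → Fin d → Matrix b b ℂ)
    (A : Fin d → Matrix n n' ℂ) :
    act T (act T' A) = fun i => (act (fun i j => stack T T' (i, j)) A i).submatrix
      (Equiv.prodAssoc a b n).symm (Equiv.prodAssoc a b n').symm := by
  rw [act_stack]
  ext
  simp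

variable {r : ℕ} {A : Fin d → Matrix n n ℂ} {A' : Fin d → Matrix n' n' ℂ}
  {T : Fin d → Fin d → Matrix a a ℂ} {T' : Fin d → Fin d → Matrix b b ℂ}
  {T'' : Fin d → Fin d → Matrix c c ℂ}

theorem StrongReduction.act {Wh : Matrix n' n ℂ} {W : Matrix n n' ℂ}
    (h : StrongReduction r A A' Wh W) (T : Fin d → Fin d → Matrix a a ℂ) :
    StrongReduction r (act T A) (act T A') ((1 : Matrix a a ℂ) ⊗ₖ Wh) ((1 : Matrix a a ℂ) ⊗ₖ W) :=
  ((StrongReduction.refl fun p : Fin d × Fin d => T p.1 p.2).mono (Nat.zero_le r)).glue h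
    (fun i j => (i, j)) (fun _ j => j)

/-- The fusion is glued to the trivial reduction of `A` and reassociated. As `A` is arbitrary, it
may itself be a tower. -/
theorem StrongReduction.fuse {Vh : Matrix c (a × b) ℂ} {V : Matrix (a × b) c ℂ}
    (h : StrongReduction r (stack T T') (fun p : Fin d × Fin d => T'' p.1 p.2) Vh V)
    (A : Fin d → Matrix n n ℂ) :
    StrongReduction r (DomainWall.act T (DomainWall.act T' A)) (DomainWall.act T'' A) (unfuse n Vh)
      (fuse n V) := by
  have := (h.glue ((StrongReduction.refl A).mono (Nat.zero_le r)) (fun i j : Fin d => (i, j))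
    (fun _ j => j)).reindex (Equiv.prodAssoc a b n).symm
  rw [act_act_eq_submatrix]
  exact this

/-- Two matrices agree behind all sufficiently long words of `C`. -/
def EvEq {σ : Type*} (C : σ → Matrix n n ℂ) (X Y : Matrix n m ℂ) : Prop :=
  ∃ R : ℕ, ∀ u : List σ, R ≤ u.length → word C u * X = word C u * Y

section EvEq

variable {σ : Type*} {C : σ → Matrix n n ℂ} {D : σ → Matrix m m ℂ} {X Y Z : Matrix n k ℂ}

theorem EvEq.of_length {R : ℕ} (h : ∀ u : List σ, u.length = R → word C u * X = word C u * Y) :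
    EvEq C X Y := by
  refine ⟨R, fun u hu => ?_⟩
  obtain ⟨u1, u2, rfl, -, hu2⟩ := exists_split u (a := u.length - R) (b := R) (by omega)
  rw [word_append, Matrix.mul_assoc, Matrix.mul_assoc, h u2 hu2]

theorem EvEq.symm (h : EvEq C X Y) : EvEq C Y X := by
  obtain ⟨R, h⟩ := h
  exact ⟨R, fun u hu => (h u hu).symm⟩

theorem EvEq.trans (h : EvEq C X Y) (h' : EvEq C Y Z) : EvEq C X Z := by
  obtain ⟨R, h⟩ := h
  obtain ⟨R', h'⟩ := h'
  exact ⟨max R R', fun u hu => (h u (le_trans (le_max_left _ _) hu)).trans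
    (h' u (le_trans (le_max_right _ _) hu))⟩

theorem EvEq.smul (c : ℂ) (h : EvEq C X Y) : EvEq C (c • X) (c • Y) := by
  obtain ⟨R, h⟩ := h
  exact ⟨R, fun u hu => by rw [Matrix.mul_smul, Matrix.mul_smul, h u hu]⟩

theorem EvEq.mul_right (h : EvEq C X Y) (Z : Matrix k k' ℂ) : EvEq C (X * Z) (Y * Z) := by
  obtain ⟨R, h⟩ := h
  exact ⟨R, fun u hu => by rw [← Matrix.mul_assoc, ← Matrix.mul_assoc, h u hu]⟩

/-- Behind `r` columns, `V` moves to the left and turns the remaining columns of `C` into columns of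
`D`, where the hypothesis applies. -/
theorem EvEq.of_reduction {Vh : Matrix m n ℂ} {V : Matrix n m ℂ} (hV : StrongReduction r C D Vh V)
    {X Y : Matrix m k ℂ} (h : EvEq D X Y) : EvEq C (V * X) (V * Y) := by
  obtain ⟨R, h⟩ := h
  refine ⟨r + R, fun u hu => ?_⟩
  obtain ⟨u1, u2, rfl, hu1, hu2⟩ := exists_split u (a := r) (b := u.length - r) (by omega)
  have e1 := congrArg (· * X) (hV.right u1 u2 hu1)
  have e2 := congrArg (· * Y) (hV.right u1 u2 hu1)
  simp only [word_append, Matrix.mul_assoc] at e1 e2 ⊢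
  rw [e1, e2, h u2 (by omega)]

theorem EvEq.act {X Y : Matrix n k ℂ} (h : EvEq A X Y) (T : Fin d → Fin d → Matrix a a ℂ) :
    EvEq (act T A) ((1 : Matrix a a ℂ) ⊗ₖ X) ((1 : Matrix a a ℂ) ⊗ₖ Y) := by
  obtain ⟨R, h⟩ := h
  refine ⟨R, fun u hu => ?_⟩
  have := glue_linear (P := fun p : Fin d × Fin d => T p.1 p.2) (Q := A)
    (P' := fun p : Fin d × Fin d => T p.1 p.2) (Q' := A) (p := fun i j => (i, j))
    (q := fun _ j => j) u (f := sandwich (1 : Matrix (a × n) (a × n) ℂ) ((1 : Matrix a a ℂ) ⊗ₖ X))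
    (g := sandwich (1 : Matrix (a × n) (a × n) ℂ) ((1 : Matrix a a ℂ) ⊗ₖ Y)) fun w w' hw hw' => by
      simp only [sandwich_apply, Matrix.one_mul, ← Matrix.mul_kronecker_mul, h w' (hw'.symm ▸ hu)]
  simpa [act_eq_glue] using this

/-- The factor between two reductions to the same tensor is unique. -/
theorem EvEq.smul_unique [Fintype σ] [Nonempty m] (hD : IsInjective D) {Vh : Matrix m n ℂ}
    {V : Matrix n m ℂ} (hV : StrongReduction r C D Vh V) {c c' : ℂ}
    (h : EvEq C (c • V) (c' • V)) : c = c' := by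
  obtain ⟨R, h⟩ := h
  by_contra hne
  have : (1 : Matrix m m ℂ) * 1 = 0 * 1 := hD.sandwich_ext_one R fun u hu => by
    have h1 := congrArg (fun M => Vh * M) (h u hu.ge)
    simp only [Matrix.mul_smul, ← Matrix.mul_assoc, hV.contract] at h1
    have h2 : (c - c') • word D u = 0 := by rw [sub_smul, h1, sub_self]
    simpa using (smul_eq_zero.1 h2).resolve_left (sub_ne_zero.2 hne)
  simp at this

/-- If two reductions to the same tensor differ by a factor, their left parts differ by the inverse
factor. -/
theorem EvEq.left [Fintype σ] (hD : IsInjective D) {Vh Vh' : Matrix m n ℂ}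
    {V V' : Matrix n m ℂ} (hV : StrongReduction r C D Vh V) (hV' : StrongReduction r C D Vh' V')
    {c : ℂ} (h : EvEq C V' (c • V)) :
    ∀ v : List σ, r ≤ v.length → c • (Vh' * word C v) = Vh * word C v := by
  intro v hv
  obtain ⟨R, h⟩ := h
  obtain ⟨v1, v2, rfl, hv1, -⟩ := exists_split v (a := r) (b := v.length - r) (by omega)
  -- The test word has `R` letters for the comparison of `V'` with `V`, `r` letters as the border of
  -- `expand` and one letter as its non-empty middle.
  have h1 := hD.sandwich_ext_one ((R + r) + 1) (M := (1 : Matrix m m ℂ)) (M' := 1)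
    (N := Vh * word C v1) (N' := c • (Vh' * word C v1)) fun u hu => by
      obtain ⟨u1, u2, rfl, hu1, hu2⟩ := exists_split u hu
      have hne : u2 ≠ [] := by rintro rfl; simp at hu2
      have e1 := (hV.mono (Nat.le_add_left r R)).right_le
      obtain ⟨u3, u4, rfl, hu3, hu4⟩ := exists_split u1 hu1
      have e := hV.expand u4 u2 v1 hu4 hv1 hne
      rw [hV'.expand u4 u2 v1 hu4 hv1 hne] at e
      have e2 := congrArg (fun Y => Vh * (word C u3 * Y)) e
      have e3 := congrArg (· * (word D u2 * Vh' * word C v1)) (h (u3 ++ u4) (by simp; omega))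
      have e4 := congrArg (· * (word D u2 * Vh * word C v1)) (hV.contract (u3 ++ u4))
      have e5 := congrArg (· * (word D u2 * Vh' * word C v1)) (hV.contract (u3 ++ u4))
      simp only [word_append, Matrix.mul_assoc, Matrix.one_mul, Matrix.mul_smul, Matrix.smul_mul]
        at e2 e3 e4 e5 ⊢
      rw [← e4, ← e2, e3, Matrix.mul_smul, e5]
  simp only [Matrix.one_mul] at h1
  rw [word_append, ← Matrix.mul_assoc, ← Matrix.mul_assoc, h1, Matrix.smul_mul]

end EvEq

end Towers


/-! ### Associators and L-symbols -/

section Symbols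

variable {G : Type*} [Group G] {d : ℕ} {U : MPURep G d} {I : Type*} [MulAction G I]
  {S : GroundStates U I} {r : ℕ}

/-- The fusion tensor of `g` and `h`, with its target written as `k = g * h`. -/
def FusionTensors.to (F : FusionTensors U r) (g h k : G) (e : k = g * h) :
    Matrix (Fin (U.χ g) × Fin (U.χ h)) (Fin (U.χ k)) ℂ :=
  (F.V g h).submatrix id (Fin.cast (congrArg U.χ e))

/-- The left part of the fusion tensor of `g` and `h`, with its target written as `k = g * h`. -/
def FusionTensors.hatTo (F : FusionTensors U r) (g h k : G) (e : k = g * h) :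
    Matrix (Fin (U.χ k)) (Fin (U.χ g) × Fin (U.χ h)) ℂ :=
  (F.Vh g h).submatrix (Fin.cast (congrArg U.χ e)) id

theorem FusionTensors.strong_to (F : FusionTensors U r) (g h k : G) (e : k = g * h) :
    StrongReduction r (stack (U.T g) (U.T h)) (fun p : Fin d × Fin d => U.T k p.1 p.2)
      (F.hatTo g h k e) (F.to g h k e) := by
  subst e
  exact F.strong g h

/-- The action tensor of `g` on `x`, with its target written as `y = g • x`. -/
def ActionTensors.to (W : ActionTensors S r) (g : G) (x y : I) (e : y = g • x) :
    Matrix (Fin (U.χ g) × Fin (S.D x)) (Fin (S.D y)) ℂ :=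
  (W.W g x).submatrix id (Fin.cast (congrArg S.D e))

/-- The left part of the action tensor of `g` on `x`, with its target written as `y = g • x`. -/
def ActionTensors.hatTo (W : ActionTensors S r) (g : G) (x y : I) (e : y = g • x) :
    Matrix (Fin (S.D y)) (Fin (U.χ g) × Fin (S.D x)) ℂ :=
  (W.Wh g x).submatrix (Fin.cast (congrArg S.D e)) id

theorem ActionTensors.strong_to (W : ActionTensors S r) (g : G) (x y : I) (e : y = g • x) :
    StrongReduction r (act (U.T g) (S.A x)) (S.A y) (W.hatTo g x y e) (W.to g x y e) := by
  subst e
  exact W.strong g x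

theorem mul_eq_mul_submatrix {n n' k : Type*} [Fintype n] [Fintype n'] (N : Matrix n n ℂ)
    (f : n' ≃ n) (X : Matrix n' k ℂ) :
    N.submatrix f f * X = (N * X.submatrix f.symm id).submatrix f id := by
  rw [← Matrix.submatrix_mul_equiv _ _ _ f _]
  simp

theorem submatrix_left_injective {n n' k : Type*} (f : n' ≃ n) :
    Function.Injective fun X : Matrix n k ℂ => X.submatrix f id := by
  intro X Y h
  have := congrArg (fun Z => Z.submatrix f.symm id) h
  simpa using this

theorem EvEq.of_reindex {σ n n' k : Type*} [Fintype n] [DecidableEq n] [Fintype n'] [DecidableEq n']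
    [Fintype k] [DecidableEq k] {C : σ → Matrix n n ℂ} {f : n' ≃ n} {X Y : Matrix n' k ℂ} {R : ℕ}
    (h : ∀ u : List σ, u.length = R → word (fun i => (C i).submatrix f f) u * X
      = word (fun i => (C i).submatrix f f) u * Y) :
    EvEq C (X.submatrix f.symm id) (Y.submatrix f.symm id) := by
  refine EvEq.of_length (R := R) fun u hu => ?_
  have := h u hu
  rw [word_submatrix, mul_eq_mul_submatrix, mul_eq_mul_submatrix] at this
  exact submatrix_left_injective f this

/-- The targets are free variables with equations, so that the casts along `mul_smul` disappear by
substitution and several instances can be chained in one diagram. -/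
theorem IsLSymbol.evEq {F : FusionTensors U r} {W : ActionTensors S r} {L : I → G → G → ℂˣ}
    (hL : IsLSymbol F W L) {g h a : G} {x y z : I} (ha : a = g * h) (hy : y = h • x)
    (hz : z = g • y) (hz' : z = a • x) :
    EvEq (act (U.T g) (act (U.T h) (S.A x)))
      (fuse (Fin (S.D x)) (F.to g h a ha) * W.to a x z hz')
      ((L x g h : ℂ) • (((1 : Matrix (Fin (U.χ g)) (Fin (U.χ g)) ℂ) ⊗ₖ W.to h x y hy)
        * W.to g y z hz)) := by
  subst ha hy hz'
  have := EvEq.of_reindex (C := act (U.T g) (act (U.T h) (S.A x))) (f := Equiv.prodAssoc _ _ _)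
    (X := (F.V g h ⊗ₖ (1 : Matrix (Fin (S.D x)) (Fin (S.D x)) ℂ)) * W.W (g * h) x)
    (Y := (L x g h : ℂ) • (((1 : Matrix (Fin (U.χ g)) (Fin (U.χ g)) ℂ) ⊗ₖ W.W h x).submatrix
      (Equiv.prodAssoc _ _ _) id * W.to g (h • x) ((g * h) • x) hz)) (R := 3 * r) fun u hu => by
    have e := hL x g h u hu
    rw [act_stack] at e
    rw [← Matrix.mul_assoc, e, Matrix.mul_smul, Matrix.mul_assoc]
    rfl
  convert this using 1
  · ext ⟨i, j, k⟩ l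
    simp only [Matrix.submatrix_apply, Matrix.mul_apply]
    rfl
  · ext ⟨i, j, k⟩ l
    simp only [Matrix.smul_apply, Matrix.submatrix_apply, Matrix.mul_apply]
    rfl

/-- The associator lives on three operator layers; tensoring it with the identity on the bond of `A`
puts these layers on top of a state, where it can be compared with L-symbols. -/
theorem IsAssociator.evEq {F : FusionTensors U r} {ω : G → G → G → ℂˣ} (hω : IsAssociator F ω)
    {g h k a b c : G} (ha : a = g * h) (hb : b = h * k) (hc : c = a * k) (hc' : c = g * b)
    {n : Type*} [Fintype n] [DecidableEq n] (A : Fin d → Matrix n n ℂ) :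
    EvEq (act (U.T g) (act (U.T h) (act (U.T k) A)))
      (((1 : Matrix (Fin (U.χ g)) (Fin (U.χ g)) ℂ) ⊗ₖ fuse n (F.to h k b hb))
        * fuse n (F.to g b c hc'))
      ((ω g h k : ℂ) • (fuse (Fin (U.χ k) × n) (F.to g h a ha) * fuse n (F.to a k c hc))) := by
  subst ha hb hc
  set X1 := ((1 : Matrix (Fin (U.χ g)) (Fin (U.χ g)) ℂ) ⊗ₖ F.V h k).submatrix
    (Equiv.prodAssoc _ _ _) id * F.to g (h * k) (g * h * k) hc' with hX1
  set X2 := (F.V g h ⊗ₖ (1 : Matrix (Fin (U.χ k)) (Fin (U.χ k)) ℂ)) * F.V (g * h) k with hX2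
  let C := stack (fun i j => stack (U.T g) (U.T h) (i, j)) (U.T k)
  have hC : ∀ w : List (Fin d × Fin d), w.length = 3 * r →
      word C w * X1 = (ω g h k : ℂ) • (word C w * X2) := by
    intro w hw
    have e := hω g h k w hw
    rw [Matrix.mul_assoc, Matrix.mul_assoc] at e
    exact e
  let O : Matrix (((Fin (U.χ g) × Fin (U.χ h)) × Fin (U.χ k)) × n)
    (((Fin (U.χ g) × Fin (U.χ h)) × Fin (U.χ k)) × n) ℂ := 1
  have h1 : ∀ u : List (Fin d), u.length = 3 * r →
      word (act (fun i j => C (i, j)) A) u * (X1 ⊗ₖ (1 : Matrix n n ℂ))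
        = word (act (fun i j => C (i, j)) A) u
          * ((ω g h k : ℂ) • (X2 ⊗ₖ (1 : Matrix n n ℂ))) := by
    intro u hu
    have := glue_linear (P := C) (Q := A) (P' := C) (Q' := A) (p := fun i j : Fin d => (i, j))
      (q := fun _ j => j) u (f := sandwich O (X1 ⊗ₖ (1 : Matrix n n ℂ)))
      (g := sandwich O ((ω g h k : ℂ) • (X2 ⊗ₖ (1 : Matrix n n ℂ))))
      fun w w' hw hw' => by
        simp only [O, sandwich_apply, Matrix.one_mul, Matrix.mul_smul, ← Matrix.mul_kronecker_mul,
          hC w (hw.trans hu), Matrix.smul_kronecker]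
    simp only [O, sandwich_apply, Matrix.one_mul] at this
    exact this
  let f1 := Equiv.prodAssoc (Fin (U.χ g) × Fin (U.χ h)) (Fin (U.χ k)) n
  let f2 := Equiv.prodAssoc (Fin (U.χ g)) (Fin (U.χ h)) (Fin (U.χ k) × n)
  have h2 : act (fun i j => C (i, j)) A = fun i =>
      (act (U.T g) (act (U.T h) (act (U.T k) A)) i).submatrix (f1.trans f2) (f1.trans f2) := by
    simp only [C]
    rw [act_stack, act_stack]
    rfl
  rw [h2] at h1
  have := EvEq.of_reindex h1
  convert this using 1
  · have e1 : X1 ⊗ₖ (1 : Matrix n n ℂ)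
        = (((1 : Matrix (Fin (U.χ g)) (Fin (U.χ g)) ℂ) ⊗ₖ F.V h k).submatrix
          (Equiv.prodAssoc _ _ _) id ⊗ₖ (1 : Matrix n n ℂ))
          * (F.to g (h * k) (g * h * k) hc' ⊗ₖ (1 : Matrix n n ℂ)) := by
      rw [← Matrix.mul_kronecker_mul, Matrix.mul_one]
    rw [e1, ← Matrix.submatrix_mul_equiv _ _ _ (Equiv.prodAssoc _ _ _).symm _]
    congr 1
    ext ⟨i, j, l, q⟩ ⟨i', j', q'⟩
    simp [fuse, f1, f2, mul_assoc, FusionTensors.to]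
  · have e2 : X2 ⊗ₖ (1 : Matrix n n ℂ)
        = ((F.V g h ⊗ₖ (1 : Matrix (Fin (U.χ k)) (Fin (U.χ k)) ℂ)) ⊗ₖ (1 : Matrix n n ℂ))
          * (F.V (g * h) k ⊗ₖ (1 : Matrix n n ℂ)) := by
      rw [← Matrix.mul_kronecker_mul, Matrix.mul_one]
    rw [e2, Matrix.submatrix_smul, Pi.smul_apply, Pi.smul_apply,
      ← Matrix.submatrix_mul_equiv _ _ _ (Equiv.prodAssoc _ _ _).symm _]
    congr 2
    ext ⟨i, j, l, q⟩ ⟨i', l', q'⟩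
    simp only [fuse, f1, f2, FusionTensors.to, Matrix.one_apply, Prod.ext_iff, ite_and,
      Matrix.submatrix_apply, Matrix.kroneckerMap_apply, Equiv.symm_trans_apply,
      Equiv.prodAssoc_symm_apply, id_eq]
    split_ifs <;> simp_all

end Symbols


/-! ### Existence and uniqueness of the symbols -/

section Existence

/-- Existence is rigidity. Uniqueness holds because `Vh` turns the columns in front of `V` into
words of an injective tensor, which are not all zero. -/
theorem StrongReduction.existsUnique_factor {σ n m : Type*} [Fintype n] [DecidableEq n] [Fintype m]
    [DecidableEq m] [Fintype σ] [Nonempty m] {r R : ℕ} {B : σ → Matrix n n ℂ}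
    {A : σ → Matrix m m ℂ} {Vh Vh' : Matrix m n ℂ} {V V' : Matrix n m ℂ} (hA : IsInjective A)
    (h : StrongReduction r B A Vh V) (h' : StrongReduction r B A Vh' V') (hR : r ≤ R) :
    ∃! c : ℂˣ, ∀ u : List σ, u.length = R → word B u * V' = (c : ℂ) • (word B u * V) := by
  obtain ⟨c, hc, -⟩ := (h.mono hR).rigid hA (h'.mono hR)
  refine ⟨c, hc, fun c' hc' => Units.ext ?_⟩
  refine EvEq.smul_unique hA h (EvEq.of_length (R := R) fun u hu => ?_)
  rw [Matrix.mul_smul, Matrix.mul_smul, ← hc u hu, ← hc' u hu]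

theorem stack_assoc {d : ℕ} {a b c : Type*} (T : Fin d → Fin d → Matrix a a ℂ)
    (T' : Fin d → Fin d → Matrix b b ℂ) (T'' : Fin d → Fin d → Matrix c c ℂ) :
    stack (fun i j => stack T T' (i, j)) T'' = fun p =>
      (stack T (fun i j => stack T' T'' (i, j)) p).submatrix
        (Equiv.prodAssoc a b c) (Equiv.prodAssoc a b c) := by
  funext i
  ext ⟨⟨x, y⟩, z⟩ ⟨⟨x', y'⟩, z'⟩
  simp only [stack, Matrix.sum_apply, Matrix.kroneckerMap_apply, Matrix.submatrix_apply,
    Equiv.prodAssoc_apply, Finset.mul_sum, Finset.sum_mul]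
  rw [Finset.sum_comm]
  simp only [mul_assoc]

variable {G : Type*} [Group G] {d : ℕ} {U : MPURep G d} {I : Type*} [MulAction G I]
  {S : GroundStates U I} {r : ℕ}

/-- Fusing and then acting, or acting twice, are two composite reductions of one tower to $A_{ghx}$.
Both have length `r + r`, so the `3 * r` columns are enough. -/
theorem existsUnique_isLSymbol (F : FusionTensors U r) (W : ActionTensors S r)
    (hD : ∀ x, 0 < S.D x) : ∃! L, IsLSymbol F W L := by
  have key : ∀ x g h, ∃! c : ℂˣ, ∀ w : List (Fin d), w.length = 3 * r →
      word (act (fun i j => stack (U.T g) (U.T h) (i, j)) (S.A x)) w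
        * (F.V g h ⊗ₖ (1 : Matrix (Fin (S.D x)) (Fin (S.D x)) ℂ))
        * W.W (g * h) x
      = (c : ℂ) •
        (word (act (fun i j => stack (U.T g) (U.T h) (i, j)) (S.A x)) w
          * ((1 : Matrix (Fin (U.χ g)) (Fin (U.χ g)) ℂ) ⊗ₖ W.W h x).submatrix
              (Equiv.prodAssoc _ _ _) id
          * (W.W g (h • x)).submatrix id (Fin.cast (congrArg S.D (mul_smul g h x)))) := by
    intro x g h
    have : Nonempty (Fin (S.D ((g * h) • x))) := ⟨⟨0, hD _⟩⟩
    have h1 : StrongReduction (r + r)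
        (act (fun i j => stack (U.T g) (U.T h) (i, j)) (S.A x)) _ _ _ :=
      ((F.strong g h).glue ((StrongReduction.refl (S.A x)).mono (Nat.zero_le r))
        (fun i j : Fin d => (i, j)) (fun _ j => j)).comp (W.strong (g * h) x)
    have h2 := (((W.strong h x).act (U.T g)).reindex (Equiv.prodAssoc _ _ _)).comp
      (W.strong_to g (h • x) ((g * h) • x) (mul_smul g h x))
    rw [← act_stack] at h2
    simp only [Matrix.mul_assoc]
    exact h2.existsUnique_factor (S.injective _) h1 (by omega)
  choose L hL hu using key
  exact ⟨L, hL, fun L' h' => funext fun x => funext fun g => funext fun h =>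
    hu x g h _ (h' x g h)⟩

/-- The two bracketings are composite reductions of length `r + r` of three layers to the injective
tensor of the total product. -/
theorem existsUnique_isAssociator (F : FusionTensors U r) (hd : 0 < d) :
    ∃! ω, IsAssociator F ω := by
  have key : ∀ g h k, ∃! c : ℂˣ, ∀ w : List (Fin d × Fin d), w.length = 3 * r →
    word (stack (fun i j => stack (U.T g) (U.T h) (i, j)) (U.T k)) w
        * ((1 : Matrix (Fin (U.χ g)) (Fin (U.χ g)) ℂ) ⊗ₖ F.V h k).submatrix
            (Equiv.prodAssoc _ _ _) id
        * (F.V g (h * k)).submatrix id (Fin.cast (congrArg U.χ (mul_assoc g h k)))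
      = (c : ℂ) •
        (word (stack (fun i j => stack (U.T g) (U.T h) (i, j)) (U.T k)) w
          * (F.V g h ⊗ₖ (1 : Matrix (Fin (U.χ k)) (Fin (U.χ k)) ℂ))
          * F.V (g * h) k) := by
    intro g h k
    have : Nonempty (Fin (U.χ (g * h * k))) := ⟨⟨0, U.χ_pos hd _⟩⟩
    have hr : ∀ g, StrongReduction r (fun p : Fin d × Fin d => U.T g p.1 p.2)
      (fun p : Fin d × Fin d => U.T g p.1 p.2) 1 1 :=
      fun g => (StrongReduction.refl _).mono (Nat.zero_le r)
    have h1 : StrongReduction (r + r)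
        (stack (fun i j => stack (U.T g) (U.T h) (i, j)) (U.T k)) _ _ _ :=
      ((F.strong g h).glue (hr k)
        (fun (s : Fin d × Fin d) k => (s.1, k)) (fun s k => (k, s.2))).comp (F.strong (g * h) k)
    have h2 := (((hr g).glue (F.strong h k)
        (fun (s : Fin d × Fin d) k => (s.1, k)) (fun s k => (k, s.2))).reindex
          (Equiv.prodAssoc _ _ _)).comp
      (F.strong_to g (h * k) (g * h * k) (mul_assoc g h k))
    have h3 := stack_assoc (U.T g) (U.T h) (U.T k)
    simp only [Matrix.mul_assoc]
    refine h1.existsUnique_factor (Vh' := F.hatTo g (h * k) _ (mul_assoc g h k)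
      * ((1 : Matrix (Fin (U.χ g)) (Fin (U.χ g)) ℂ) ⊗ₖ F.Vh h k).submatrix id
        (Equiv.prodAssoc _ _ _)) (U.injective _) ?_ (by omega)
    rw [h3]
    exact h2
  choose ω hω hu using key
  exact ⟨ω, hω, fun ω' h' => funext fun x => funext fun g => funext fun h =>
    hu x g h _ (h' x g h)⟩

theorem IsAssociator.mono {F : FusionTensors U r} {ω : G → G → G → ℂˣ} (h : IsAssociator F ω)
    {r' : ℕ} (hr : r ≤ r') : IsAssociator (F.mono hr) ω := by
  intro x g k w hw
  obtain ⟨w1, w2, rfl, -, hw2⟩ := exists_split w (a := 3 * r' - 3 * r) (b := 3 * r) (by omega)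
  have := h x g k w2 hw2
  simp only [word_append, Matrix.mul_assoc] at this ⊢
  rw [← Matrix.mul_smul]
  exact congrArg (_ * ·) this

theorem IsWallPhase.mono {W : ActionTensors S r} {e : WallTensors S} {B : G → I → I → ℂˣ}
    (h : IsWallPhase W e B) {r' : ℕ} (hr : r ≤ r') : IsWallPhase (W.mono hr) e B := by
  intro g y x u v i hu hv
  exact (W.strong g y).wall_le (W.strong g x) (fun u v hu hv => h g y x u v i hu hv)
    (by omega) (by omega)

end Existence

/-! ### Relations between the symbols -/

section Relations

variable {G : Type*} [Group G] {d : ℕ} {U : MPURep G d} {I : Type*} [MulAction G I]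
  {S : GroundStates U I} {r : ℕ}

theorem one_kronecker_mul {a n m k : Type*} [Fintype a] [DecidableEq a] [Fintype m]
    (X : Matrix n m ℂ) (Y : Matrix m k ℂ) :
    ((1 : Matrix a a ℂ) ⊗ₖ X) * ((1 : Matrix a a ℂ) ⊗ₖ Y) = (1 : Matrix a a ℂ) ⊗ₖ (X * Y) := by
  rw [← Matrix.mul_kronecker_mul, Matrix.one_mul]

/-- Fusing the top layers and acting on the layers below commute. This is the trivial square that
closes the pentagon diagram. -/
theorem fuse_mul_one_kronecker {a b c n n' : Type*} [Fintype a] [Fintype b] [Fintype c]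
    [DecidableEq a] [DecidableEq b] [DecidableEq c] [Fintype n] [DecidableEq n] [Fintype n']
    [DecidableEq n'] (V : Matrix (a × b) c ℂ) (X : Matrix n n' ℂ) :
    fuse n V * ((1 : Matrix c c ℂ) ⊗ₖ X)
      = ((1 : Matrix a a ℂ) ⊗ₖ ((1 : Matrix b b ℂ) ⊗ₖ X)) * fuse n' V := by
  have h1 : fuse n V * ((1 : Matrix c c ℂ) ⊗ₖ X)
      = (V ⊗ₖ X).submatrix (Equiv.prodAssoc a b n).symm id := by
    rw [fuse, submatrix_id_mul, ← Matrix.mul_kronecker_mul, Matrix.mul_one, Matrix.one_mul]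
  have h2 : (1 : Matrix a a ℂ) ⊗ₖ ((1 : Matrix b b ℂ) ⊗ₖ X)
      = ((1 : Matrix (a × b) (a × b) ℂ) ⊗ₖ X).submatrix (Equiv.prodAssoc a b n).symm
        (Equiv.prodAssoc a b n').symm := by
    ext ⟨i, j, k⟩ ⟨i', j', k'⟩
    simp only [Matrix.one_apply, Prod.ext_iff, ite_and, Matrix.kroneckerMap_apply,
      Matrix.submatrix_apply, Equiv.prodAssoc_symm_apply]
    split_ifs <;> simp
  rw [h1, h2, fuse, Matrix.submatrix_mul_equiv, ← Matrix.mul_kronecker_mul, Matrix.one_mul,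
    Matrix.mul_one]

/-- The pentagon relation between associators and L-symbols. -/
theorem IsAssociator.mul_lSymbol {F : FusionTensors U r} {W : ActionTensors S r}
    {ω : G → G → G → ℂˣ} {L : I → G → G → ℂˣ} (hω : IsAssociator F ω) (hL : IsLSymbol F W L)
    (hD : ∀ x, 0 < S.D x) (g h k : G) (x : I) :
    ω g h k * L x (g * h) k * L (k • x) g h = L x g (h * k) * L x h k := by
  obtain ⟨a, ha⟩ : ∃ a, a = g * h := ⟨_, rfl⟩
  obtain ⟨b, hb⟩ : ∃ b, b = h * k := ⟨_, rfl⟩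
  obtain ⟨c, hc⟩ : ∃ c, c = a * k := ⟨_, rfl⟩
  obtain ⟨s, hs⟩ : ∃ s, s = k • x := ⟨_, rfl⟩
  obtain ⟨t, ht⟩ : ∃ t, t = h • s := ⟨_, rfl⟩
  obtain ⟨u, hu⟩ : ∃ u, u = g • t := ⟨_, rfl⟩
  have hc' : c = g * b := by rw [hc, ha, hb, mul_assoc]
  have ht' : t = b • x := by rw [ht, hs, hb, mul_smul]
  have hu1 : u = a • s := by rw [hu, ht, ha, mul_smul]
  have hu2 : u = c • x := by rw [hu1, hc, hs, mul_smul]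
  have : Nonempty (Fin (S.D u)) := ⟨⟨0, hD _⟩⟩
  rw [← ha, ← hb, ← hs]
  -- The five edges: `A1` reassociates; `A2` and `A3` resolve the bracketing with `h` and `k` fused
  -- first; `A4` and `A5` resolve the other one. Both paths end at the successive action of `k`, `h`
  -- and `g`.
  have A1 := (hω.evEq ha hb hc hc' (S.A x)).mul_right (W.to c x u hu2)
  have A2 := EvEq.of_reduction (((F.strong_to h k b hb).fuse (S.A x)).act (U.T g))
    (hL.evEq hc' ht' hu hu2)
  have A3 := (((hL.evEq hb hs ht ht').act (U.T g)).mul_right (W.to g t u hu)).smul (L x g b : ℂ)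
  have A4 := (EvEq.of_reduction ((F.strong_to g h a ha).fuse (act (U.T k) (S.A x)))
    (hL.evEq hc hs hu1 hu2)).smul (ω g h k : ℂ)
  have A5 := (EvEq.of_reduction (((W.strong_to k x s hs).act (U.T h)).act (U.T g))
    (hL.evEq ha ht hu hu1)).smul ((ω g h k : ℂ) * L x a k)
  simp only [Matrix.mul_smul, Matrix.smul_mul, Matrix.kronecker_smul, smul_smul,
    ← one_kronecker_mul, ← Matrix.mul_assoc, fuse_mul_one_kronecker] at A1 A2 A3 A4 A5
  have A := ((A5.symm.trans A4.symm).trans A1.symm).trans (A2.trans A3)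
  have hY := ((((W.strong_to k x s hs).act (U.T h)).act (U.T g)).comp
    ((W.strong_to h s t ht).act (U.T g))).comp (W.strong_to g t u hu)
  exact Units.ext (EvEq.smul_unique (S.injective u) hY A)

/-- The pentagon expresses `ω` by L-symbols at any base point. With $\omega(g,h,k)$ based at $lx$
and the other values at $x$, all L-symbols in the cocycle identity cancel. -/
theorem IsAssociator.isCocycle [Nonempty I] {F : FusionTensors U r} {W : ActionTensors S r}
    {ω : G → G → G → ℂˣ} {L : I → G → G → ℂˣ} (hω : IsAssociator F ω) (hL : IsLSymbol F W L)
    (hD : ∀ x, 0 < S.D x) : IsCocycle ω := by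
  intro g h k l
  obtain ⟨x⟩ := ‹Nonempty I›
  have e := hω.mul_lSymbol hL hD
  have E : ∀ g h k x, ω g h k = L x g (h * k) * L x h k / (L x (g * h) k * L (k • x) g h) := by
    intro g h k x
    rw [← e, mul_assoc, mul_div_cancel_right]
  rw [E g h k (l • x), E g (h * k) l x, E h k l x, E (g * h) k l x, E g h (k * l) x,
    mul_smul, ← mul_assoc h k l, ← mul_assoc g h k]
  refine Units.ext ?_
  simp only [Units.val_mul, Units.val_div_eq_div_val]
  field_simp

end Relations


/-! ### Products of the symbols along cyclic subgroups -/

section Composition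

variable {G : Type*} [Group G] {d : ℕ} {U : MPURep G d} {I : Type*} [MulAction G I]
  {S : GroundStates U I} {r : ℕ}

theorem IsWallPhase.to {W : ActionTensors S r} {e : WallTensors S} {B : G → I → I → ℂˣ}
    (hB : IsWallPhase W e B) {g : G} {y x y' x' : I} (hy : y' = g • y) (hx : x' = g • x)
    {u v : List (Fin d)} (i : Fin d) (hu : r ≤ u.length) (hv : r ≤ v.length) :
    W.hatTo g y y' hy * word (act (U.T g) (S.A y)) u * act (U.T g) (e y x) i
        * word (act (U.T g) (S.A x)) v * W.to g x x' hx
      = (B g y x : ℂ) • (word (S.A y') u * e y' x' i * word (S.A x') v) := by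
  subst hy hx
  exact (W.strong g y).wall_le (W.strong g x) (fun u v hu hv => hB g y x u v i hu hv) hu hv

/-- The wall phases of a product of two group elements. -/
theorem IsWallPhase.mul {F : FusionTensors U r} {W : ActionTensors S r} {e : WallTensors S}
    {L : I → G → G → ℂˣ} {B : G → I → I → ℂˣ} (hL : IsLSymbol F W L) (hB : IsWallPhase W e B)
    (he0 : ∀ x y, e x y ≠ 0) (hD : ∀ x, 0 < S.D x) (g h : G) (y x : I) :
    L y g h * B (g * h) y x = L x g h * B h y x * B g (h • y) (h • x) := by
  obtain ⟨a, ha⟩ : ∃ a, a = g * h := ⟨_, rfl⟩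
  obtain ⟨y1, hy1⟩ : ∃ s, s = h • y := ⟨_, rfl⟩
  obtain ⟨x1, hx1⟩ : ∃ s, s = h • x := ⟨_, rfl⟩
  obtain ⟨y2, hy2⟩ : ∃ s, s = g • y1 := ⟨_, rfl⟩
  obtain ⟨x2, hx2⟩ : ∃ s, s = g • x1 := ⟨_, rfl⟩
  have hy3 : y2 = a • y := by rw [hy2, hy1, ha, mul_smul]
  have hx3 : x2 = a • x := by rw [hx2, hx1, ha, mul_smul]
  have : Nonempty (Fin (S.D y2)) := ⟨⟨0, hD _⟩⟩
  rw [← ha, ← hy1, ← hx1]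
  obtain ⟨R, hR⟩ := hL.evEq ha hx1 hx2 hx3
  have hleft := EvEq.left (S.injective y2)
    (((W.strong_to h y y1 hy1).act (U.T g)).comp (W.strong_to g y1 y2 hy2))
    (((F.strong_to g h a ha).fuse (S.A y)).comp (W.strong_to a y y2 hy3))
    (hL.evEq ha hy1 hy2 hy3)
  -- The left word covers the length `r + r` of the composite reductions; the right word covers the
  -- range `R` of the eventual equality and the `r` columns of the wall phase.
  obtain ⟨u, i, v, hu, hv, h0⟩ := (S.injective y2).exists_word_mul_ne_zero (S.injective x2)
    (he0 y2 x2) (r + r) (R + r)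
  replace hR := hR v (by omega)
  replace hleft := hleft u (by omega)
  have hfuse : unfuse (Fin (S.D y)) (F.hatTo g h a ha)
        * word (act (U.T g) (act (U.T h) (S.A y))) u * act (U.T g) (act (U.T h) (e y x)) i
        * word (act (U.T g) (act (U.T h) (S.A x))) v * fuse (Fin (S.D x)) (F.to g h a ha)
      = word (act (U.T a) (S.A y)) u * act (U.T a) (e y x) i
        * word (act (U.T a) (S.A x)) v := by
    have := glue_wall (p := fun i j : Fin d => (i, j)) (q := fun _ j => j) (u := u) (v := v)
      (Qy := S.A y) (Qx := S.A x) (E := e y x) (Qy' := S.A y) (Qx' := S.A x) (E' := e y x)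
      (β := 1) (Kh := 1) (K' := 1) i (F.strong_to g h a ha).contract (by simp)
    rw [one_smul] at this
    rw [act_eq_glue (U.T a), act_eq_glue (U.T a), act_eq_glue (U.T a), ← this,
      act_act_eq_submatrix, act_act_eq_submatrix, act_act_eq_submatrix, word_submatrix,
      word_submatrix, unfuse, fuse]
    simp only [Matrix.submatrix_mul_equiv]
    rfl
  have hact : ((1 : Matrix (Fin (U.χ g)) (Fin (U.χ g)) ℂ) ⊗ₖ W.hatTo h y y1 hy1)
        * word (act (U.T g) (act (U.T h) (S.A y))) u * act (U.T g) (act (U.T h) (e y x)) i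
        * word (act (U.T g) (act (U.T h) (S.A x))) v
        * ((1 : Matrix (Fin (U.χ g)) (Fin (U.χ g)) ℂ) ⊗ₖ W.to h x x1 hx1)
      = (B h y x : ℂ) • (word (act (U.T g) (S.A y1)) u * act (U.T g) (e y1 x1) i
        * word (act (U.T g) (S.A x1)) v) :=
    glue_wall (P := fun p : Fin d × Fin d => U.T g p.1 p.2)
      (P' := fun p : Fin d × Fin d => U.T g p.1 p.2) (p := fun i j : Fin d => (i, j))
      (q := fun _ j => j) i (by simp) fun a j b ha' hb' =>
        hB.to hy1 hx1 j (by omega) (by omega)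
  have e1 := hB.to hy3 hx3 (u := u) (v := v) i (by omega) (by omega)
  -- The same wall under both layers yields $B^{gh}$ via `hfuse` and $B^hB^g$ via `hact`. Exchanging
  -- the reductions costs $L^x$ on the right and $L^y$, on the opposite side of the equation, on the
  -- left.
  have e2 := hB.to hy2 hx2 (u := u) (v := v) i (by omega) (by omega)
  have f1 := congrArg (fun M => W.hatTo a y y2 hy3 * M * W.to a x x2 hx3) hfuse
  have f2 := congrArg (fun M => W.hatTo g y1 y2 hy2 * M * W.to g x1 x2 hx2) hact
  have f3 := congrArg (fun M => (W.hatTo a y y2 hy3 * unfuse (Fin (S.D y)) (F.hatTo g h a ha)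
    * word (act (U.T g) (act (U.T h) (S.A y))) u) * act (U.T g) (act (U.T h) (e y x)) i * M) hR
  have f4 := congrArg (fun M => M * (act (U.T g) (act (U.T h) (e y x)) i
    * (word (act (U.T g) (act (U.T h) (S.A x))) v
      * (((1 : Matrix (Fin (U.χ g)) (Fin (U.χ g)) ℂ) ⊗ₖ W.to h x x1 hx1)
        * W.to g x1 x2 hx2)))) hleft
  simp only [Matrix.mul_assoc, Matrix.mul_smul, Matrix.smul_mul] at e1 e2 f1 f2 f3 f4 h0
  rw [e1] at f1
  rw [e2, f4.symm] at f2
  rw [f1] at f3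
  have f5 := congrArg (fun M => (L y g h : ℂ) • M) f3
  simp only [smul_comm (L y g h : ℂ) (L x g h : ℂ), f2, smul_smul] at f5
  refine Units.ext ?_
  simpa [mul_assoc] using smul_left_injective ℂ h0 f5

end Composition


/-! ### Cyclic products -/

section Cyclic

theorem prod_Icc_one {M : Type*} [CommMonoid M] (n : ℕ) (f : ℕ → M) :
    ∏ i ∈ Finset.Icc 1 n, f i = ∏ i ∈ Finset.range n, f (i + 1) := by
  induction n with
  | zero => simp
  | succ n ih => rw [Finset.prod_Icc_succ_top (by omega), ih, Finset.prod_range_succ]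

theorem prod_range_shift {M : Type*} [CommMonoid M] {n : ℕ} {f : ℕ → M} (h : f n = f 0) :
    ∏ i ∈ Finset.range n, f (i + 1) = ∏ i ∈ Finset.range n, f i := by
  cases n with
  | zero => simp
  | succ n => rw [Finset.prod_range_succ, Finset.prod_range_succ', h]

variable {G : Type*} [Group G] {d : ℕ} {U : MPURep G d} {I : Type*} [MulAction G I]
  {S : GroundStates U I} {r : ℕ}

/-- The powers of `g` over a full period return to $1$, so the shift only rotates the factors. Every
telescoping below is an instance of this. -/
theorem prod_orderOf_shift {M : Type*} [CommMonoid M] (g : G) (f : G → M) :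
    ∏ i ∈ Finset.range (orderOf g), f (g ^ (i + 1)) = ∏ i ∈ Finset.range (orderOf g), f (g ^ i) :=
  prod_range_shift (f := fun i => f (g ^ i)) (by simp [pow_orderOf_eq_one])

theorem prod_orderOf_shift_pow {M : Type*} [CommMonoid M] (g : G) (f : G → M) (k : ℕ) :
    ∏ i ∈ Finset.range (orderOf g), f (g ^ i * g ^ k) = ∏ i ∈ Finset.range (orderOf g), f (g ^ i) := by
  induction k with
  | zero => simp
  | succ k ih =>
    rw [← ih, ← prod_orderOf_shift g fun a => f (a * g ^ k)]
    simp only [pow_succ, mul_assoc, ← pow_succ']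

/-- `IsWallPhase.mul` for $g$ and $g^i$ gives the quotient of L-symbols times
$B^{g^{i+1}}_{y,x}/B^{g^i}_{y,x}$, and the latter telescopes around the cycle. -/
theorem IsWallPhase.prod_eq {F : FusionTensors U r} {W : ActionTensors S r} {e : WallTensors S}
    {L : I → G → G → ℂˣ} {B : G → I → I → ℂˣ} (hL : IsLSymbol F W L) (hB : IsWallPhase W e B)
    (he0 : ∀ x y, e x y ≠ 0) (hD : ∀ x, 0 < S.D x) (g : G) (y x : I) :
    ∏ i ∈ Finset.range (orderOf g), B g (g ^ i • y) (g ^ i • x)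
      = ∏ i ∈ Finset.Icc 1 (orderOf g), L y g (g ^ i) / L x g (g ^ i) := by
  rw [prod_Icc_one, prod_orderOf_shift g fun a => L y g a / L x g a]
  have h : ∀ i, B g (g ^ i • y) (g ^ i • x)
      = L y g (g ^ i) / L x g (g ^ i) * (B (g ^ (i + 1)) y x / B (g ^ i) y x) := by
    intro i
    have := hB.mul hL he0 hD g (g ^ i) y x
    rw [pow_succ', div_mul_div_comm, this, mul_div_cancel_left]
  simp only [h, Finset.prod_mul_distrib, Finset.prod_div_distrib]
  rw [prod_orderOf_shift g fun a => B a y x, div_self', mul_one]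

theorem IsWallPhase.prod_orderOf {F : FusionTensors U r} {W : ActionTensors S r} {e : WallTensors S}
    {L : I → G → G → ℂˣ} {B : G → I → I → ℂˣ} (hL : IsLSymbol F W L) (hB : IsWallPhase W e B)
    (he0 : ∀ x y, e x y ≠ 0) (hD : ∀ x, 0 < S.D x) (g : G) (x : I) :
    ∏ i ∈ Finset.Icc 1 (orderOf g), B g (g ^ i • x) (g ^ (i - 1) • x)
      = ∏ i ∈ Finset.Icc 1 (orderOf g), L (g • x) g (g ^ i) / L x g (g ^ i) := by
  rw [prod_Icc_one, ← hB.prod_eq hL he0 hD]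
  simp only [Nat.add_sub_cancel, pow_succ, mul_smul]

theorem IsWallPhase.prod_orderOf_swap {F : FusionTensors U r} {W : ActionTensors S r}
    {e : WallTensors S} {L : I → G → G → ℂˣ} {B : G → I → I → ℂˣ} (hL : IsLSymbol F W L)
    (hB : IsWallPhase W e B) (he0 : ∀ x y, e x y ≠ 0) (hD : ∀ x, 0 < S.D x) (g : G) (x : I) :
    ∏ i ∈ Finset.Icc 1 (orderOf g), B g (g ^ (i - 1) • x) (g ^ i • x)
      = (∏ i ∈ Finset.Icc 1 (orderOf g), L (g • x) g (g ^ i) / L x g (g ^ i))⁻¹ := by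
  rw [prod_Icc_one, ← Finset.prod_inv_distrib]
  simp only [inv_div]
  rw [← hB.prod_eq hL he0 hD]
  simp only [Nat.add_sub_cancel, pow_succ, mul_smul]

/-- `IsWallPhase.mul` with the second element equal to $1$ has the same factor $B^g_{y,x}$ on both
sides. -/
theorem IsWallPhase.lSymbol_one {F : FusionTensors U r} {W : ActionTensors S r}
    {e : WallTensors S} {L : I → G → G → ℂˣ} {B : G → I → I → ℂˣ} (hL : IsLSymbol F W L)
    (hB : IsWallPhase W e B) (he0 : ∀ x y, e x y ≠ 0) (hD : ∀ x, 0 < S.D x) (g : G) {y x : I}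
    (h : B 1 y x = 1) : L y g 1 = L x g 1 := by
  have := hB.mul hL he0 hD g 1 y x
  simpa [h] using this

/-- The pentagon for $g,g^i,g$ gives
$\omega^{-1}(g,g^i,g)=\frac{L^{gx}_{g,g^i}}{L^x_{g,g^{i+1}}}\cdot\frac{L^x_{g^{i+1},g}}{L^x_{g^i,g}}$.
Over a period the last fraction telescopes, and the shift in the first denominator is immaterial. -/
theorem IsAssociator.prod_orderOf {F : FusionTensors U r} {W : ActionTensors S r}
    {ω : G → G → G → ℂˣ} {L : I → G → G → ℂˣ} (hω : IsAssociator F ω) (hL : IsLSymbol F W L)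
    (hD : ∀ x, 0 < S.D x) (g : G) (x : I) :
    ∏ i ∈ Finset.Icc 1 (orderOf g), (ω g (g ^ i) g)⁻¹
      = ∏ i ∈ Finset.Icc 1 (orderOf g), L (g • x) g (g ^ i) / L x g (g ^ i) := by
  rw [prod_Icc_one, prod_Icc_one, prod_orderOf_shift g fun a => (ω g a g)⁻¹,
    prod_orderOf_shift g fun a => L (g • x) g a / L x g a]
  have h : ∀ i, (ω g (g ^ i) g)⁻¹ = L (g • x) g (g ^ i) / L x g (g ^ (i + 1))
      * (L x (g ^ (i + 1)) g / L x (g ^ i) g) := by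
    intro i
    have := hω.mul_lSymbol hL hD g (g ^ i) g x
    rw [← pow_succ', ← pow_succ] at this
    rw [div_mul_div_comm, ← this, mul_comm (L (g • x) g (g ^ i)), mul_assoc, mul_comm (ω g (g ^ i) g),
      ← div_div, div_self', one_div]
  simp only [h, Finset.prod_mul_distrib, Finset.prod_div_distrib]
  rw [prod_orderOf_shift g fun a => L x a g, div_self', mul_one, prod_orderOf_shift g fun a => L x g a]

/-- In the product over $i$ of the cocycle identities for $g,g^i,g^j,l$, the terms
$\omega(g^i,g^j,l)$ and $\omega(g^{i+1},g^j,l)$ cancel by a shift. So the product over $i$ is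
multiplicative in the third argument, along powers of `g`. -/
theorem IsCocycle.prod_mul {ω : G → G → G → ℂˣ} (hω : IsCocycle ω) (g : G) (j : ℕ) (l : G) :
    (∏ i ∈ Finset.range (orderOf g), ω g (g ^ i) (g ^ j))
        * ∏ i ∈ Finset.range (orderOf g), ω g (g ^ i) l
      = ∏ i ∈ Finset.range (orderOf g), ω g (g ^ i) (g ^ j * l) := by
  have h := Finset.prod_congr rfl fun i (_ : i ∈ Finset.range (orderOf g)) =>
    hω g (g ^ i) (g ^ j) l
  simp only [Finset.prod_mul_distrib, ← pow_succ'] at h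
  rw [prod_orderOf_shift_pow g (fun a => ω g a l) j,
    prod_orderOf_shift g fun a => ω a (g ^ j) l, mul_comm] at h
  exact mul_left_cancel h

theorem IsCocycle.prod_pow {ω : G → G → G → ℂˣ} (hω : IsCocycle ω) (g : G) :
    (∏ i ∈ Finset.range (orderOf g), ω g (g ^ i) g) ^ orderOf g = 1 := by
  have h1 : ∏ i ∈ Finset.range (orderOf g), ω g (g ^ i) 1 = 1 := by
    simpa using hω.prod_mul g 0 1
  have h : ∀ m : ℕ, (∏ i ∈ Finset.range (orderOf g), ω g (g ^ i) g) ^ m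
      = ∏ i ∈ Finset.range (orderOf g), ω g (g ^ i) (g ^ m) := by
    intro m
    induction m with
    | zero => simpa using h1.symm
    | succ m ih => rw [pow_succ, ih, hω.prod_mul, ← pow_succ]
  rw [h, pow_orderOf_eq_one, h1]

theorem IsCocycle.norm_prod [Finite G] {ω : G → G → G → ℂˣ} (hω : IsCocycle ω) (g : G) :
    ‖((∏ i ∈ Finset.Icc 1 (orderOf g), (ω g (g ^ i) g)⁻¹ : ℂˣ) : ℂ)‖ = 1 := by
  refine Complex.norm_eq_one_of_pow_eq_one (n := orderOf g) ?_ (orderOf_pos g).ne'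
  rw [← Units.val_pow_eq_pow_val, Units.val_eq_one, prod_Icc_one,
    prod_orderOf_shift g fun a => (ω g a g)⁻¹, Finset.prod_inv_distrib, inv_pow, hω.prod_pow, inv_one]

theorem IsCoboundary.prod_eq_one {ω : G → G → G → ℂˣ} (hω : IsCoboundary ω) (g : G) :
    ∏ i ∈ Finset.Icc 1 (orderOf g), (ω g (g ^ i) g)⁻¹ = 1 := by
  obtain ⟨β, hβ⟩ := hω
  rw [prod_Icc_one, prod_orderOf_shift g fun a => (ω g a g)⁻¹, Finset.prod_inv_distrib, inv_eq_one]
  simp only [hβ, Finset.prod_mul_distrib, Finset.prod_div_distrib, ← pow_succ, ← pow_succ']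
  rw [prod_orderOf_shift g fun a => β g a, prod_orderOf_shift g fun a => β a g,
    mul_comm, div_self']

end Cyclic

/-! ### On-site symmetries -/

section OnSite

variable {G : Type*} [Group G] {d : ℕ} {U : MPURep G d} {r : ℕ}

/-- Chains of one and two sites show that the trace is multiplicative on the letters of `U.T g`. By
injectivity it is multiplicative on the whole matrix algebra, which fails for $E_{01}E_{10}$ as soon
as the bond dimension exceeds one. -/
theorem MPURep.IsOnSite.χ_eq_one (hU : U.IsOnSite) (hd : 0 < d) (g : G) : U.χ g = 1 := by
  obtain ⟨u, hu⟩ := hU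
  have h1 : ∀ i j, (U.T g i j).trace = u g i j := by
    intro i j
    simpa [mpo] using hu g 1 one_pos (fun _ => i) (fun _ => j)
  have h2 : ∀ i j i' j', (U.T g i j * U.T g i' j').trace = u g i j * u g i' j' := by
    intro i j i' j'
    simpa [mpo, Fin.prod_univ_two] using hu g 2 two_pos ![i, i'] ![j, j']
  have h3 : ∀ i j (Y : Matrix (Fin (U.χ g)) (Fin (U.χ g)) ℂ),
      (U.T g i j * Y).trace = (U.T g i j).trace * Y.trace := by
    intro i j Y
    refine (U.injective g).linearMap_ext 0
      (f := Matrix.traceLinearMap _ ℂ ℂ ∘ₗ LinearMap.mulLeft ℂ (U.T g i j))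
      (g := (U.T g i j).trace • Matrix.traceLinearMap _ ℂ ℂ) (fun w hw => ?_) Y
    obtain ⟨p, rfl⟩ := List.length_eq_one_iff.1 hw
    simp [h1, h2]
  have h4 : ∀ X Y : Matrix (Fin (U.χ g)) (Fin (U.χ g)) ℂ, (X * Y).trace = X.trace * Y.trace := by
    intro X Y
    refine (U.injective g).linearMap_ext 0
      (f := Matrix.traceLinearMap _ ℂ ℂ ∘ₗ LinearMap.mulRight ℂ Y)
      (g := Y.trace • Matrix.traceLinearMap _ ℂ ℂ) (fun w hw => ?_) X |>.trans (by simp [mul_comm])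
    obtain ⟨p, rfl⟩ := List.length_eq_one_iff.1 hw
    simp [h3, mul_comm]
  refine le_antisymm (not_lt.1 fun hlt => ?_) (U.χ_pos hd g)
  have := h4 (Matrix.single ⟨0, by omega⟩ ⟨1, hlt⟩ 1) (Matrix.single ⟨1, hlt⟩ ⟨0, by omega⟩ 1)
  rw [Matrix.single_mul_single_same] at this
  simp [Matrix.trace_single_eq_of_ne] at this

/-- All bonds are one-dimensional, so fusion tensors are non-zero numbers and their coboundary
satisfies the defining equation of `ω`; uniqueness of the associator finishes. -/
theorem MPURep.IsOnSite.isCoboundary (hU : U.IsOnSite) (hd : 0 < d) {F : FusionTensors U r}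
    {ω : G → G → G → ℂˣ} (hω : IsAssociator F ω) : IsCoboundary ω := by
  have : ∀ g, Subsingleton (Fin (U.χ g)) := fun g => by
    rw [hU.χ_eq_one hd g]; infer_instance
  let o : ∀ g, Fin (U.χ g) := fun g => ⟨0, U.χ_pos hd g⟩
  have ho : ∀ g (a : Fin (U.χ g)), a = o g := fun g a => Subsingleton.elim _ _
  have hv : ∀ g h, F.V g h (o g, o h) (o (g * h)) ≠ 0 := by
    intro g h h0
    have h1 := (F.isReduction g h).contract []
    have h2 : F.V g h = 0 := by
      ext ⟨a, b⟩ c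
      rw [ho _ a, ho _ b, ho _ c, h0]; rfl
    have h3 := congrFun (congrFun h1 (o (g * h))) (o (g * h))
    simp [h2] at h3
  refine ⟨fun g h => Units.mk0 _ (hv g h), ?_⟩
  have key : IsAssociator F fun g h k => Units.mk0 _ (hv h k) * Units.mk0 _ (hv g (h * k))
      / (Units.mk0 _ (hv g h) * Units.mk0 _ (hv (g * h) k)) := by
    intro g h k w _
    rw [Matrix.mul_assoc, Matrix.mul_assoc, ← Matrix.mul_smul]
    congr 1
    ext ⟨⟨a, b⟩, c⟩ z
    have hz : Fin.cast (congrArg U.χ (mul_assoc g h k)) (o (g * h * k)) = o (g * (h * k)) := ho _ _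
    rw [Matrix.smul_apply, Matrix.mul_apply, Matrix.mul_apply,
      Fintype.sum_subsingleton _ (o g, o (h * k)), Fintype.sum_subsingleton _ (o (g * h), o k)]
    have h1 := hv g h
    have h2 := hv (g * h) k
    simp only [Matrix.submatrix_apply, id_eq, Matrix.kroneckerMap_apply, ho _ a, ho _ b, ho _ c,
      ho _ z, hz, Equiv.prodAssoc_apply, Matrix.one_apply_eq, Units.val_div_eq_div_val, Units.val_mul,
      Units.val_mk0, smul_eq_mul, one_mul, mul_one]
    field_simp
  exact fun g h k => congrFun (congrFun (congrFun
    ((existsUnique_isAssociator F hd).unique hω key) g) h) k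

end OnSite


/-! ### Strings with an endpoint, acting on states with an open bond -/

section StringOperators

variable {d : ℕ} {a n n' : Type*} [Fintype a] [DecidableEq a] [Fintype n] [DecidableEq n]
  [Fintype n'] [DecidableEq n']

/-- A string of `k` operator tensors `T` followed by an endpoint `E`, acting on a state `Φ` with an
open bond at the left end. -/
def strOp (T : Fin d → Fin d → Matrix a a ℂ) (E : Fin d → Fin d → a → ℂ) :
    ℕ → (List (Fin d) → n → ℂ) → List (Fin d) → a × n → ℂ
  -- Default value for an endpoint beyond the last site.
  | _, _, [] => 0
  | 0, Φ, i :: s => fun c => ∑ j, E i j c.1 * Φ (j :: s) c.2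
  | k + 1, Φ, i :: s => ∑ j, (T i j ⊗ₖ (1 : Matrix n n ℂ)) *ᵥ strOp T E k (fun u => Φ (j :: u)) s

variable {T : Fin d → Fin d → Matrix a a ℂ} {E : Fin d → Fin d → a → ℂ}

theorem one_kronecker_mulVec (M : Matrix n' n ℂ) (v : a × n → ℂ) (c : a × n') :
    (((1 : Matrix a a ℂ) ⊗ₖ M) *ᵥ v) c = ∑ y, M c.2 y * v (c.1, y) := by
  simp [Matrix.mulVec, dotProduct, Fintype.sum_prod_type, Matrix.one_apply, ite_mul]

theorem strOp_mulVec (M : Matrix n' n ℂ) (k : ℕ) (Φ : List (Fin d) → n → ℂ) (s : List (Fin d)) :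
    strOp T E k (fun u => M *ᵥ Φ u) s = ((1 : Matrix a a ℂ) ⊗ₖ M) *ᵥ strOp T E k Φ s := by
  induction s generalizing k Φ with
  | nil => simp [strOp]
  | cons i s ih =>
    cases k with
    | zero =>
      funext c
      rw [one_kronecker_mulVec]
      simp only [strOp, Matrix.mulVec, dotProduct, Finset.mul_sum]
      rw [Finset.sum_comm]
      exact Finset.sum_congr rfl fun y _ => Finset.sum_congr rfl fun j _ => by ring
    | succ k =>
      simp only [strOp, ih, Matrix.mulVec_sum, Matrix.mulVec_mulVec, ← Matrix.mul_kronecker_mul,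
        Matrix.mul_one, Matrix.one_mul]

/-- A string passing over a site with tensor `A` replaces it by the column `act T A`; the rest of
the string acts on the rest of the state. -/
theorem strOp_cons {Φ : List (Fin d) → n → ℂ} {Ψ : List (Fin d) → n' → ℂ}
    {A : Fin d → Matrix n n' ℂ} (h : ∀ j u, Φ (j :: u) = A j *ᵥ Ψ u) (k : ℕ) (i : Fin d)
    (s : List (Fin d)) :
    strOp T E (k + 1) Φ (i :: s) = act T A i *ᵥ strOp T E k Ψ s := by
  simp only [strOp, h, strOp_mulVec, act, Matrix.sum_mulVec, Matrix.mulVec_mulVec,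
    ← Matrix.mul_kronecker_mul, Matrix.mul_one, Matrix.one_mul]

/-- Prolong a state by `m` tensors `A`. -/
def pad (A : Fin d → Matrix n n ℂ) (m : ℕ) (Φ : List (Fin d) → n → ℂ) (s : List (Fin d)) : n → ℂ :=
  word A (s.take m) *ᵥ Φ (s.drop m)

/-- Prolong a state by a single tensor. -/
def wall (A : Fin d → Matrix n n' ℂ) (Φ : List (Fin d) → n' → ℂ) : List (Fin d) → n → ℂ
  | [] => 0
  | i :: s => A i *ᵥ Φ s

theorem pad_zero (A : Fin d → Matrix n n ℂ) (Φ : List (Fin d) → n → ℂ) : pad A 0 Φ = Φ := by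
  funext s
  simp [pad]

theorem pad_add (A : Fin d → Matrix n n ℂ) (k m : ℕ) (Φ : List (Fin d) → n → ℂ) :
    pad A (k + m) Φ = pad A k (pad A m Φ) := by
  funext s
  simp only [pad, Matrix.mulVec_mulVec, ← word_append, List.take_add, List.drop_drop]

theorem pad_append (A : Fin d → Matrix n n ℂ) (Φ : List (Fin d) → n → ℂ) (u s : List (Fin d)) :
    pad A u.length Φ (u ++ s) = word A u *ᵥ Φ s := by
  simp [pad]

theorem strOp_pad (A : Fin d → Matrix n n ℂ) (Φ : List (Fin d) → n → ℂ) (k : ℕ)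
    (u s : List (Fin d)) :
    strOp T E (u.length + k) (pad A u.length Φ) (u ++ s) = word (act T A) u *ᵥ strOp T E k Φ s := by
  induction u with
  | nil => simp [pad_zero]
  | cons i u ih =>
    rw [List.length_cons, List.cons_append, word_cons, Nat.add_right_comm,
      strOp_cons (A := A) (Ψ := pad A u.length Φ) (fun j v => by simp [pad]), ih,
      Matrix.mulVec_mulVec]

theorem strOp_wall (A : Fin d → Matrix n n' ℂ) (Φ : List (Fin d) → n' → ℂ) (k : ℕ) (i : Fin d)
    (s : List (Fin d)) :
    strOp T E (k + 1) (wall A Φ) (i :: s) = act T A i *ᵥ strOp T E k Φ s :=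
  strOp_cons (fun _ _ => rfl) k i s

/-- The operator with an endpoint `E` at site `k`, a string of operator tensors to the left of `k`,
whose open bond is contracted with `v`, and the identity to the right of `k`. -/
def stringOp (T : Fin d → Fin d → Matrix a a ℂ) (E : Fin d → Fin d → a → ℂ) {N : ℕ} (k : Fin N)
    (v : a → ℂ) : Matrix (Fin N → Fin d) (Fin N → Fin d) ℂ :=
  fun s t => if ∀ l, k < l → s l = t l then
    v ⬝ᵥ ((List.ofFn fun l => if l < k then T (s l) (t l) else 1).prod *ᵥ E (s k) (t k))
  else 0

theorem sum_cons {α M : Type*} [Fintype α] [AddCommMonoid M] {N : ℕ} (f : (Fin (N + 1) → α) → M) :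
    ∑ t, f t = ∑ j, ∑ t : Fin N → α, f (Fin.cons j t) := by
  rw [← (Fin.consEquiv fun _ => α).sum_comp, Fintype.sum_prod_type]
  rfl

/-- Identifies the recursion along the chain with the matrix elements of the string operator whose
left bond is still open. A state without open bond has the bond `Unit`. -/
theorem strOp_ofFn (f : List (Fin d) → ℂ) {N : ℕ} (k : Fin N) (s : Fin N → Fin d) (c : a) :
    strOp T E k (fun u (_ : Unit) => f u) (List.ofFn s) (c, ()) = ∑ t : Fin N → Fin d,
      if ∀ l, k < l → s l = t l then
        ((List.ofFn fun l => if l < k then T (s l) (t l) else 1).prod *ᵥ E (s k) (t k)) c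
          * f (List.ofFn t)
      else 0 := by
  induction N generalizing f c with
  | zero => exact k.elim0
  | succ N ih =>
    rw [sum_cons, List.ofFn_succ]
    refine Fin.cases ?_ (fun k => ?_) k
    · rw [Fin.val_zero]
      simp only [strOp]
      refine Finset.sum_congr rfl fun j _ => ?_
      rw [Finset.sum_eq_single fun l => s l.succ]
      · have : (List.ofFn fun l : Fin (N + 1) => if l < 0 then
            T (s l) ((Fin.cons j fun l => s l.succ : Fin (N + 1) → Fin d) l) else 1).prod = 1 := by
          simp
        rw [if_pos, this]
        · simp
        · refine Fin.cases (by simp) (by simp)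
      · intro t _ ht
        rw [if_neg]
        intro h
        exact ht (funext fun l => by simpa using (h l.succ (Fin.succ_pos l)).symm)
      · simp
    · rw [Fin.val_succ]
      simp only [strOp, Finset.sum_apply]
      refine Finset.sum_congr rfl fun j _ => ?_
      have h1 : ∀ c' : a, strOp T E k (fun u (_ : Unit) => f (j :: u)) (List.ofFn fun i => s i.succ)
          (c', ()) = _ := fun c' => ih (fun u => f (j :: u)) k (fun i => s i.succ) c'
      simp only [Matrix.mulVec, dotProduct, Fintype.sum_prod_type, Matrix.kroneckerMap_apply,
        Finset.univ_unique, Finset.sum_singleton, Matrix.one_apply_eq, mul_one]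
      simp only [PUnit.default_eq_unit, h1, Finset.mul_sum]
      rw [Finset.sum_comm]
      refine Finset.sum_congr rfl fun t _ => ?_
      have h2 : (∀ l, k.succ < l → s l = (Fin.cons j t : Fin (N + 1) → Fin d) l)
          ↔ ∀ l, k < l → s l.succ = t l := by
        refine ⟨fun h l hl => by simpa using h l.succ (by simpa using hl), fun h => ?_⟩
        refine Fin.cases (fun h => absurd h (by simp)) fun l hl => ?_
        simpa using h l (by simpa using hl)
      simp only [h2]
      split_ifs
      · rw [List.ofFn_succ, List.prod_cons]
        simp only [Fin.succ_pos, if_true, Fin.cons_zero, Fin.cons_succ, Fin.succ_lt_succ_iff,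
          List.ofFn_succ]
        simp only [← mul_assoc, ← Finset.sum_mul]
        exact congrArg (· * _) (congrFun (Matrix.mulVec_mulVec (E (s k.succ) (t k)) (T (s 0) j) _) c)
      · simp

theorem stringOp_mulVec (f : List (Fin d) → ℂ) {N : ℕ} (k : Fin N) (v : a → ℂ) (s : Fin N → Fin d) :
    (stringOp T E k v *ᵥ fun t => f (List.ofFn t)) s
      = ∑ c, v c * strOp T E k (fun u (_ : Unit) => f u) (List.ofFn s) (c, ()) := by
  simp only [strOp_ofFn, Finset.mul_sum]
  rw [Finset.sum_comm]
  simp only [Matrix.mulVec, dotProduct, stringOp]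
  refine Finset.sum_congr rfl fun t _ => ?_
  split_ifs
  · simp only [Finset.sum_mul, mul_assoc]
  · simp

theorem stringOp_mulVec_dotProduct (ρ : n → ℂ) (Φ : List (Fin d) → n → ℂ) {N : ℕ} (k : Fin N)
    (v : a → ℂ) (s : Fin N → Fin d) :
    (stringOp T E k v *ᵥ fun t => ρ ⬝ᵥ Φ (List.ofFn t)) s
      = (fun c => v c.1 * ρ c.2) ⬝ᵥ strOp T E k Φ (List.ofFn s) := by
  rw [stringOp_mulVec fun u => ρ ⬝ᵥ Φ u]
  have := strOp_mulVec (T := T) (E := E) (Matrix.of fun (_ : Unit) => ρ) k Φ (List.ofFn s)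
  have h : ∀ c, strOp T E k (fun u (_ : Unit) => ρ ⬝ᵥ Φ u) (List.ofFn s) (c, ())
      = ∑ y, ρ y * strOp T E k Φ (List.ofFn s) (c, y) := fun c =>
    (congrFun this (c, ())).trans (one_kronecker_mulVec _ _ _)
  simp only [h]
  simp only [dotProduct, Fintype.sum_prod_type, Finset.mul_sum, mul_assoc]

end StringOperators


/-! ### Moving strings through domain walls -/

/-- The local tensors of a symmetry that maps the ground state `x` to `φ x`, with the endpoints of
its strings. -/
structure WallData (d : ℕ) (I : Type*) (r : ℕ) where
  /-- the action on the ground states -/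
  φ : I → I
  /-- the bond dimension of the symmetry -/
  χ : ℕ
  /-- the bond dimensions of the ground states -/
  D : I → ℕ
  /-- the operator tensor -/
  T : Fin d → Fin d → Matrix (Fin χ) (Fin χ) ℂ
  /-- the state tensors -/
  A : ∀ x, Fin d → Matrix (Fin (D x)) (Fin (D x)) ℂ
  /-- the right action tensors -/
  W : ∀ x, Matrix (Fin χ × Fin (D x)) (Fin (D (φ x))) ℂ
  /-- the left action tensors -/
  Wh : ∀ x, Matrix (Fin (D (φ x))) (Fin χ × Fin (D x)) ℂ
  strong : ∀ x, StrongReduction r (act T (A x)) (A (φ x)) (Wh x) (W x)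
  /-- the domain walls -/
  e : ∀ x, Fin d → Matrix (Fin (D (φ x))) (Fin (D x)) ℂ
  /-- the domain wall phases -/
  B : I → ℂ
  phase : ∀ x (u v : List (Fin d)) i, u.length = r → v.length = r →
    Wh (φ x) * word (act T (A (φ x))) u * act T (e x) i * word (act T (A x)) v * W x
      = B x • (word (A (φ (φ x))) u * e (φ x) i * word (A (φ x)) v)
  /-- the endpoint of a string -/
  E : Fin d → Fin d → Fin χ → ℂ
  create : ∀ x i (v : Fin (D x) → ℂ) c,
    ∑ j, E i j c.1 * (A x j *ᵥ v) c.2 = (W x *ᵥ (e x i *ᵥ v)) c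

theorem word_mulVec_eq_pad {d : ℕ} {n : Type*} [Fintype n] [DecidableEq n]
    (A : Fin d → Matrix n n ℂ) (q : n → ℂ) (b : ℕ) :
    (fun s => word A s *ᵥ q) = pad A b fun s => word A s *ᵥ q := by
  funext s
  simp only [pad, Matrix.mulVec_mulVec, ← word_append, List.take_append_drop]

/-- Puts one more operator layer on the shift property of a `Frame`, so that frames survive repeated
strings. -/
theorem act_mul_right {d : ℕ} {a n m : Type*} [Fintype a] [DecidableEq a] [Fintype n]
    [DecidableEq n] [Fintype m] [DecidableEq m] {R : ℕ} {C : Fin d → Matrix n n ℂ}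
    {A : Fin d → Matrix m m ℂ} {X : Matrix n m ℂ}
    (h : ∀ u v : List (Fin d), u.length = R → word C u * word C v * X = word C u * X * word A v)
    (T : Fin d → Fin d → Matrix a a ℂ) (u v : List (Fin d)) (hu : u.length = R) :
    word (act T C) u * word (act T C) v * ((1 : Matrix a a ℂ) ⊗ₖ X)
      = word (act T C) u * ((1 : Matrix a a ℂ) ⊗ₖ X) * word (act T A) v := by
  have := glue_linear (P := fun p : Fin d × Fin d => T p.1 p.2) (Q := C)
    (P' := fun p : Fin d × Fin d => T p.1 p.2) (Q' := A) (p := fun i j => (i, j))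
    (q := fun _ j => j) v (f := sandwich (word (act T C) u) ((1 : Matrix a a ℂ) ⊗ₖ X))
    (g := sandwich (word (act T C) u * ((1 : Matrix a a ℂ) ⊗ₖ X)) (1 : Matrix (a × m) (a × m) ℂ))
    fun w w' _ hw' => by
      have := glue_linear (P := fun p : Fin d × Fin d => T p.1 p.2) (Q := C)
        (P' := fun p : Fin d × Fin d => T p.1 p.2) (Q' := C) (p := fun i j => (i, j))
        (q := fun _ j => j) u
        (f := sandwich (1 : Matrix (a × n) (a × n) ℂ)
          (word (fun p : Fin d × Fin d => T p.1 p.2) w ⊗ₖ word C w' * ((1 : Matrix a a ℂ) ⊗ₖ X)))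
        (g := sandwich (1 : Matrix (a × n) (a × n) ℂ) (((1 : Matrix a a ℂ) ⊗ₖ X)
          * (word (fun p : Fin d × Fin d => T p.1 p.2) w ⊗ₖ word A w')))
        fun z z' _ hz' => by
          have e := h z' w' (hz'.trans hu)
          rw [Matrix.mul_assoc, Matrix.mul_assoc] at e
          simp only [sandwich_apply, Matrix.one_mul, ← Matrix.mul_kronecker_mul, Matrix.mul_one, e]
      simpa [Matrix.mul_assoc, act_eq_glue] using this
  simpa [act_eq_glue] using this

namespace WallData

variable {d : ℕ} {I : Type*} {r : ℕ} (P : WallData d I r)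

/-- The action tensor moves through a domain wall. -/
theorem mul_wall (x : I) {u v : List (Fin d)} (i : Fin d) (hu : 2 * r + 1 ≤ u.length)
    (hv : r ≤ v.length) :
    word (act P.T (P.A (P.φ x))) u * act P.T (P.e x) i * word (act P.T (P.A x)) v * P.W x
      = P.B x • (word (act P.T (P.A (P.φ x))) u * P.W (P.φ x) * P.e (P.φ x) i
        * word (P.A (P.φ x)) v) := by
  have h := P.strong (P.φ x)
  -- The bound `2 * r + 1` is a border `u5` of `r` columns, one column `u2` to be reduced, and `r`
  -- columns `u3` next to the wall for the wall phase. Reducing `u2` places `Wh` before the wall;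
  -- afterwards `W` is taken back to the right, up to the wall.
  obtain ⟨u1, u', rfl, hu1, hu'⟩ := exists_split u (a := u.length - (r + 1)) (b := r + 1) (by omega)
  obtain ⟨u2, u3, rfl, hu2, hu3⟩ := exists_split u' (a := 1) (b := r) (by omega)
  obtain ⟨u4, u5, rfl, hu4, hu5⟩ := exists_split u1 (a := u1.length - r) (b := r) (by omega)
  have hne : u2 ≠ [] := by rintro rfl; simp at hu2
  have e1 := congrArg (fun M => word (act P.T (P.A (P.φ x))) u4 * M * (act P.T (P.e x) i
    * word (act P.T (P.A x)) v * P.W x)) (h.expand u5 u2 u3 hu5 hu3 hne)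
  have e2 := congrArg (fun M => word (act P.T (P.A (P.φ x))) u4 * word (act P.T (P.A (P.φ x))) u5
    * P.W (P.φ x) * word (P.A (P.φ (P.φ x))) u2 * M)
    (h.wall_le (P.strong x) (fun u v hu hv => P.phase x u v i hu hv) hu3.ge hv)
  have e3 := congrArg (fun M => P.B x • (word (act P.T (P.A (P.φ x))) u4 * M * (P.e (P.φ x) i
    * word (P.A (P.φ x)) v))) (h.right u5 (u2 ++ u3) hu5)
  simp only [word_append, Matrix.mul_assoc, Matrix.mul_smul] at e1 e2 e3 ⊢
  rw [e1, e2, e3]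

/-- Behind sufficiently many columns, the string of length `k` turns the state `Ψ` into `Φ`. -/
def Shift (x : I) (k : ℕ) (Ψ : List (Fin d) → Fin (P.D x) → ℂ)
    (Φ : List (Fin d) → Fin (P.D (P.φ x)) → ℂ) (β : ℂ) : Prop :=
  ∀ u s : List (Fin d), 2 * r + 1 ≤ u.length → k < s.length →
    word (act P.T (P.A x)) u *ᵥ strOp P.T P.E k Ψ s
      = β • (word (act P.T (P.A x)) u *ᵥ (P.W x *ᵥ Φ s))

/-- No wall lies in the way: the endpoint produces the wall behind the action tensor, which then
moves left through the `k` columns of the string with factor one. -/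
theorem shift_create (x : I) (k : ℕ) (Φ : List (Fin d) → Fin (P.D x) → ℂ) :
    P.Shift x k (pad (P.A x) (k + 1) Φ) (pad (P.A (P.φ x)) k (DomainWall.wall (P.e x) Φ)) 1 := by
  intro u s hu hs
  obtain ⟨v, s', rfl, hv, hs'⟩ := exists_split s (a := k) (b := s.length - k) (by omega)
  obtain ⟨i, t, rfl⟩ : ∃ i t, s' = i :: t := List.exists_cons_of_length_pos (by
    rw [List.length_append] at hs; omega)
  subst hv
  have h1 : strOp P.T P.E 0 (pad (P.A x) 1 Φ) (i :: t) = P.W x *ᵥ (P.e x i *ᵥ Φ t) := by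
    funext c
    rw [← P.create]
    simp [strOp, pad]
  have h2 := (P.strong x).right_le u v (by omega)
  have h3 := strOp_pad (T := P.T) (E := P.E) (P.A x) (pad (P.A x) 1 Φ) 0 v (i :: t)
  rw [Nat.add_zero] at h3
  rw [pad_add, h3, h1, pad_append]
  simp only [Matrix.mulVec_mulVec, one_smul, DomainWall.wall] at h2 ⊢
  rw [← Matrix.mul_assoc, ← Matrix.mul_assoc, h2]
  simp only [Matrix.mul_assoc]

/-- Prepends a wall to the region crossed by the string. The `2 * r + 1` sites behind the wall are
the columns required by the given shift, and they bring the action tensor to the wall, where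
`mul_wall` applies. -/
theorem Shift.cons {x : I} {k : ℕ} {Ψ : List (Fin d) → Fin (P.D x) → ℂ}
    {Φ : List (Fin d) → Fin (P.D (P.φ x)) → ℂ} {β : ℂ} (h : P.Shift x k Ψ Φ β) (m : ℕ) :
    P.Shift (P.φ x) (m + (2 * r + 1 + k + 1))
      (pad (P.A (P.φ x)) m (DomainWall.wall (P.e x) (pad (P.A x) (2 * r + 1) Ψ)))
      (pad (P.A (P.φ (P.φ x))) m (DomainWall.wall (P.e (P.φ x)) (pad (P.A (P.φ x)) (2 * r + 1) Φ)))
      (P.B x * β) := by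
  intro u s hu hs
  obtain ⟨v, s', rfl, hv, hs'⟩ := exists_split s (a := m) (b := s.length - m) (by omega)
  obtain ⟨i, t, rfl⟩ : ∃ i t, s' = i :: t := List.exists_cons_of_length_pos (by
    rw [List.length_append] at hs; omega)
  simp only [List.length_append, List.length_cons] at hs hs'
  obtain ⟨w, t, rfl, hw, ht⟩ := exists_split t (a := 2 * r + 1) (b := t.length - (2 * r + 1))
    (by omega)
  simp only [List.length_append] at hs
  subst hv
  have e1 := h w t hw.ge (by omega)
  have e2 := P.mul_wall x (u := u ++ v) (v := w) i (by simp; omega) (by omega)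
  have e3 := (P.strong (P.φ x)).right_le u v (by omega)
  rw [strOp_pad, strOp_wall, ← hw, strOp_pad, hw, e1, pad_append, DomainWall.wall, ← hw, pad_append]
  simp only [Matrix.mulVec_mulVec, Matrix.mulVec_smul, word_append,
    ← Matrix.mul_assoc] at e2 e3 ⊢
  rw [e2, Matrix.smul_mulVec, smul_smul, e3, mul_comm β]

/-- The ground states visited by the powers of the symmetry. -/
def orbit (x : I) : ℕ → I
  | 0 => x
  | m + 1 => P.φ (orbit x m)

/-- The state with domain walls at the sites `K 0, …, K (m - 1)`, on the sites from `c` on; the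
outer bond at the right end is contracted with `q`. -/
def wallsState (x : I) (q : Fin (P.D x) → ℂ) :
    ∀ m : ℕ, ℕ → (ℕ → ℕ) → List (Fin d) → Fin (P.D (P.orbit x m)) → ℂ
  | 0, _, _ => fun s => word (P.A x) s *ᵥ q
  | m + 1, c, K => pad (P.A (P.orbit x (m + 1))) (K 0 - c)
      (DomainWall.wall (P.e (P.orbit x m)) (wallsState x q m (K 0 + 1) fun i => K (i + 1)))

theorem wallsState_add (x : I) (q : Fin (P.D x) → ℂ) (m : ℕ) {c b : ℕ} {K : ℕ → ℕ}
    (h : 0 < m → c + b ≤ K 0) :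
    P.wallsState x q m c K = pad (P.A (P.orbit x m)) b (P.wallsState x q m (c + b) K) := by
  cases m with
  | zero =>
    exact word_mulVec_eq_pad (P.A x) q b
  | succ m =>
    have := h (Nat.succ_pos m)
    simp only [wallsState]
    rw [← pad_add]
    congr 1
    omega

/-- Induction peels off the leftmost wall. The string to the new endpoint `K m` crosses all `m`
walls, raising each by one power of the symmetry, so walls `m` become walls `m + 1` with one factor
`P.B` per crossing. -/
theorem shift_wallsState (x : I) (q : Fin (P.D x) → ℂ) (m c : ℕ) (K : ℕ → ℕ)
    (hK : ∀ i j, i < j → j ≤ m → K i + (2 * r + 2) ≤ K j) (hc : c ≤ K 0) :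
    P.Shift (P.orbit x m) (K m - c) (P.wallsState x q m c K) (P.wallsState x q (m + 1) c K)
      (∏ j ∈ Finset.range m, P.B (P.orbit x j)) := by
  induction m generalizing c K with
  | zero =>
    rw [P.wallsState_add x q 0 (b := K 0 - c + 1) (by simp)]
    exact P.shift_create x _ _
  | succ m ih =>
    have h0 := hK 0 (m + 1) (Nat.succ_pos m) le_rfl
    have h1 := hK 0 1 one_pos (Nat.succ_le_succ (Nat.zero_le m))
    have := (ih (K 0 + 1 + (2 * r + 1)) (fun i => K (i + 1))
      (fun i j hij hj => hK _ _ (by omega) (by omega)) (by simp only [Nat.zero_add]; omega)).cons P (K 0 - c)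
    have e1 : P.wallsState x q (m + 2) c K = pad (P.A (P.orbit x (m + 2))) (K 0 - c)
        (DomainWall.wall (P.e (P.orbit x (m + 1))) (pad (P.A (P.orbit x (m + 1))) (2 * r + 1)
          (P.wallsState x q (m + 1) (K 0 + 1 + (2 * r + 1)) fun i => K (i + 1)))) := by
      rw [← P.wallsState_add x q (m + 1) (fun _ => by simp only [Nat.zero_add]; omega)]
      rfl
    rw [← P.wallsState_add x q m (fun _ => by simp only [Nat.zero_add]; omega),
      show K 0 - c + (2 * r + 1 + (K (m + 1) - (K 0 + 1 + (2 * r + 1))) + 1) = K (m + 1) - c by omega]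
      at this
    rw [e1]
    rw [Finset.prod_range_succ, mul_comm _ (P.B _)]
    exact this

/-- A state to the left of the domain walls, as it is seen from the right. -/
structure Frame (x : I) where
  /-- the bonds -/
  ν : Type
  [fintype : Fintype ν]
  [decidableEq : DecidableEq ν]
  /-- the tensors of the state -/
  C : Fin d → Matrix ν ν ℂ
  /-- the tensor that closes off the left part of the state -/
  X : Matrix ν (Fin (P.D x)) ℂ
  /-- the vector with which the outer bond is contracted -/
  ρ : ν → ℂ
  /-- the number of sites that belong to the left part -/
  R : ℕ
  shift : ∀ u v : List (Fin d), u.length = R → word C u * word C v * X = word C u * X * word (P.A x) v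

attribute [instance] Frame.fintype Frame.decidableEq

variable {P}

/-- The state composed of a frame and a state with an open bond. -/
def Frame.state {x : I} (F : P.Frame x) (Φ : List (Fin d) → Fin (P.D x) → ℂ) (s : List (Fin d)) : ℂ :=
  F.ρ ⬝ᵥ (word F.C (s.take F.R) *ᵥ (F.X *ᵥ Φ (s.drop F.R)))

/-- The frame after the action of a string whose open bond is contracted with `a`. -/
def Frame.push {x : I} (F : P.Frame x) (a : Fin P.χ → ℂ) : P.Frame (P.φ x) where
  ν := Fin P.χ × F.ν
  C := act P.T F.C
  X := ((1 : Matrix (Fin P.χ) (Fin P.χ) ℂ) ⊗ₖ F.X) * P.W x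
  ρ := fun c => a c.1 * F.ρ c.2
  R := F.R + (2 * r + 1)
  shift u v hu := by
    obtain ⟨u1, u2, rfl, hu1, hu2⟩ := exists_split u hu
    have e1 := act_mul_right F.shift P.T u1 (u2 ++ v) hu1
    have e2 := act_mul_right F.shift P.T u1 u2 hu1
    have e3 := (P.strong x).right_le u2 v (by omega)
    have e1' := congrArg (· * P.W x) e1
    have e2' := congrArg (· * (P.W x * word (P.A (P.φ x)) v)) e2
    have e3' := congrArg (fun M => word (act P.T F.C) u1
      * (((1 : Matrix (Fin P.χ) (Fin P.χ) ℂ) ⊗ₖ F.X) * M)) e3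
    simp only [word_append, Matrix.mul_assoc] at e1' e2' e3' ⊢
    rw [e1', e2', e3']

/-- The `2 * r + 1` sites next to the frame are the columns behind which the shift holds. They are
consumed by the new frame, which also records the open bond of the string. -/
theorem Frame.stringOp_state {x : I} (F : P.Frame x) {N b : ℕ} (k : Fin N) (a : Fin P.χ → ℂ)
    {Ψ : List (Fin d) → Fin (P.D x) → ℂ} {Φ : List (Fin d) → Fin (P.D (P.φ x)) → ℂ} {β : ℂ}
    (h : P.Shift x b Ψ Φ β) (hk : (k : ℕ) = F.R + (2 * r + 1 + b)) :
    stringOp P.T P.E k a *ᵥ (fun s => F.state (pad (P.A x) (2 * r + 1) Ψ) (List.ofFn s))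
      = β • fun s => (F.push a).state Φ (List.ofFn s) := by
  funext s
  have hN : (List.ofFn s).length = F.R + (2 * r + 1 + (N - (F.R + (2 * r + 1)))) := by
    rw [List.length_ofFn]
    have := k.isLt
    omega
  have h0 := stringOp_mulVec_dotProduct (T := P.T) (E := P.E) F.ρ
    (pad F.C F.R fun u => F.X *ᵥ pad (P.A x) (2 * r + 1) Ψ u) k a s
  obtain ⟨u, s', hs, hu, hs'⟩ := exists_split _ hN
  obtain ⟨w, t, rfl, hw, ht⟩ := exists_split s' hs'
  have hbt : b < t.length := by
    have := k.isLt
    omega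
  have hstr : strOp P.T P.E k (pad F.C F.R fun u => F.X *ᵥ pad (P.A x) (2 * r + 1) Ψ u) (u ++ (w ++ t))
      = β • (word (act P.T F.C) (u ++ w) *ᵥ
        ((((1 : Matrix (Fin P.χ) (Fin P.χ) ℂ) ⊗ₖ F.X) * P.W x) *ᵥ Φ t)) := by
    have e1 := act_mul_right F.shift P.T u w hu
    rw [hk, ← hu, strOp_pad, strOp_mulVec, ← hw, strOp_pad, h w t hw.ge hbt]
    have e1' := congrArg (· * P.W x) e1
    simp only [Matrix.mulVec_smul, Matrix.mulVec_mulVec, word_append, Matrix.mul_assoc] at e1' ⊢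
    rw [e1']
  refine h0.trans ?_
  rw [hs, hstr, dotProduct_smul, Pi.smul_apply]
  congr 1
  simp only [Frame.state, Frame.push]
  rw [hs, ← List.append_assoc, List.take_left' (by simp [hu, hw]), List.drop_left' (by simp [hu, hw])]
  rfl

end WallData


/-! ### The cyclic interchange of domain walls -/

theorem prod_reverse_ofFn_mulVec {ι : Type*} [Fintype ι] [DecidableEq ι] {N : ℕ}
    (O : Fin N → Matrix ι ι ℂ) (ψ : ℕ → ι → ℂ) (h : ∀ j : Fin N, O j *ᵥ ψ j = ψ (j + 1)) :
    (List.ofFn O).reverse.prod *ᵥ ψ 0 = ψ N := by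
  induction N generalizing ψ with
  | zero => simp
  | succ N ih =>
    have h0 := h 0
    rw [Fin.val_zero, zero_add] at h0
    rw [List.ofFn_succ, List.reverse_cons, List.prod_append, List.prod_singleton,
      ← Matrix.mulVec_mulVec, h0]
    exact ih (fun j => O j.succ) (fun m => ψ (m + 1)) fun j => h j.succ

theorem orderedProd_mulVec {ι : Type*} [Fintype ι] [DecidableEq ι] {n : ℕ}
    (O : Fin (n + 1) → Matrix ι ι ℂ) (ψ : ℕ → ι → ℂ)
    (h : ∀ j : Fin (n + 1), O j *ᵥ ψ j = ψ (j + 1)) : orderedProd O *ᵥ ψ 0 = ψ (n + 1) :=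
  prod_reverse_ofFn_mulVec O ψ h

namespace WallData

variable {d : ℕ} {I : Type*} {r : ℕ} (P : WallData d I r)

/-- The frame without sites. -/
def Frame.init (x : I) (ρ : Fin (P.D x) → ℂ) : P.Frame x where
  ν := Fin (P.D x)
  C := P.A x
  X := 1
  ρ := ρ
  R := 0
  shift u v _ := by simp

/-- The frame after the action of `m` strings. -/
def frame (x : I) (ρ : Fin (P.D x) → ℂ) (a : ℕ → Fin P.χ → ℂ) : ∀ m, P.Frame (P.orbit x m)
  | 0 => Frame.init P x ρ
  | m + 1 => (frame x ρ a m).push (a m)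

variable {P} {x : I} {ρ q : Fin (P.D x) → ℂ} {a : ℕ → Fin P.χ → ℂ}

theorem frame_R (m : ℕ) : (P.frame x ρ a m).R = m * (2 * r + 1) := by
  induction m with
  | zero => rw [Nat.zero_mul]; rfl
  | succ m ih => simp [frame, Frame.push, ih, Nat.succ_mul]

variable (P x ρ q a) in
/-- The state with `m` domain walls on a segment of `N` sites after the action of `m` strings. -/
def wallsVector (N m : ℕ) (K : ℕ → ℕ) (s : Fin N → Fin d) : ℂ :=
  (P.frame x ρ a m).state (P.wallsState x q m (m * (2 * r + 1)) K) (List.ofFn s)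

theorem wallsVector_zero (N : ℕ) (K : ℕ → ℕ) :
    P.wallsVector x ρ q a N 0 K = fun s => ρ ⬝ᵥ (word (P.A x) (List.ofFn s) *ᵥ q) := by
  have h : ∀ (Φ : List (Fin d) → Fin (P.D x) → ℂ) s, (Frame.init P x ρ).state Φ s = ρ ⬝ᵥ Φ s :=
    fun Φ s => by
      simp only [Frame.init, Frame.state, Matrix.one_mulVec, List.take_zero, List.drop_zero]
      exact congrArg _ (Matrix.one_mulVec _)
  funext s
  exact h _ _

theorem stringOp_wallsVector_of_shift {N m b : ℕ} {K K' : ℕ → ℕ} (k : Fin N) {β : ℂ}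
    (hK : 0 < m → (m + 1) * (2 * r + 1) ≤ K 0) (hk : (k : ℕ) = (m + 1) * (2 * r + 1) + b)
    (h : P.Shift (P.orbit x m) b (P.wallsState x q m ((m + 1) * (2 * r + 1)) K)
      (P.wallsState x q (m + 1) ((m + 1) * (2 * r + 1)) K') β) :
    stringOp P.T P.E k (a m) *ᵥ P.wallsVector x ρ q a N m K = β • P.wallsVector x ρ q a N (m + 1) K' := by
  have := Frame.stringOp_state (P.frame x ρ a m) k (a m) h
    (by rw [frame_R, hk, Nat.succ_mul, Nat.add_assoc])
  have e := P.wallsState_add x q m (c := m * (2 * r + 1)) (b := 2 * r + 1) (K := K) fun h => by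
    rw [← Nat.succ_mul]
    exact hK h
  rw [← Nat.succ_mul m (2 * r + 1)] at e
  rw [← e] at this
  exact this

theorem stringOp_wallsVector {N m : ℕ} {K : ℕ → ℕ} (k : Fin N)
    (hK : ∀ i j, i < j → j ≤ m → K i + (2 * r + 2) ≤ K j) (hK0 : (m + 1) * (2 * r + 1) ≤ K 0)
    (hk : (k : ℕ) = K m) :
    stringOp P.T P.E k (a m) *ᵥ P.wallsVector x ρ q a N m K
      = (∏ j ∈ Finset.range m, P.B (P.orbit x j)) • P.wallsVector x ρ q a N (m + 1) K := by
  refine stringOp_wallsVector_of_shift k (fun _ => hK0) ?_ (P.shift_wallsState x q m _ K hK hK0)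
  have : K 0 ≤ K m := by
    rcases Nat.eq_zero_or_pos m with rfl | h
    · rfl
    · have := hK 0 m h le_rfl
      omega
  omega

/-- The new wall lies to the left of all others, so its string crosses none and there is no factor;
this is the last step of the rotated order. -/
theorem stringOp_wallsVector_zero {N m : ℕ} {K : ℕ → ℕ} (k : Fin N) (hK1 : 0 < m → K 0 + 1 ≤ K 1)
    (hK0 : (m + 1) * (2 * r + 1) ≤ K 0) (hk : (k : ℕ) = K 0) :
    stringOp P.T P.E k (a m) *ᵥ P.wallsVector x ρ q a N m (fun i => K (i + 1))
      = P.wallsVector x ρ q a N (m + 1) K := by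
  rw [← one_smul ℂ (P.wallsVector x ρ q a N (m + 1) K)]
  refine stringOp_wallsVector_of_shift k (b := K 0 - (m + 1) * (2 * r + 1))
    (fun h => hK0.trans ((Nat.le_succ _).trans (hK1 h))) (by omega) ?_
  rw [P.wallsState_add x q m (b := K 0 - (m + 1) * (2 * r + 1) + 1) (fun h => by
    have := hK1 h
    simp only [Nat.zero_add]
    omega), show (m + 1) * (2 * r + 1) + (K 0 - (m + 1) * (2 * r + 1) + 1) = K 0 + 1 by omega]
  exact P.shift_create _ _ _

/-- Domain walls that are created one after the other at sites further and further to the right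
may be interchanged cyclically. -/
theorem exchange {n N : ℕ} (k : Fin (n + 1) → Fin N) (a : Fin (n + 1) → Fin P.χ → ℂ) (x : I)
    (p q : Fin (P.D x)) (hk : ∀ j : Fin n, (k j.castSucc : ℕ) + (n + 1) * (2 * r + 2) ≤ k j.succ)
    (hk0 : (n + 1) * (2 * r + 2) ≤ (k 0 : ℕ)) :
    orderedProd (fun j => stringOp P.T P.E (k j) (a j)) *ᵥ
        (fun s => word (P.A x) (List.ofFn s) p q)
      = (∏ i ∈ Finset.range n, P.B (P.orbit x i)) •
        (orderedProd (fun j => stringOp P.T P.E (k (finRotate _ j)) (a j)) *ᵥ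
          fun s => word (P.A x) (List.ofFn s) p q) := by
  have hℓ1 : (n + 1) * (2 * r + 1) ≤ (n + 1) * (2 * r + 2) := Nat.mul_le_mul_left _ (by omega)
  have hℓ2 : 2 * r + 2 ≤ (n + 1) * (2 * r + 2) := Nat.le_mul_of_pos_left _ (Nat.succ_pos n)
  -- Indices are read modulo `n + 1`, so that `K (n + 1) = K 0` and the rotated order is the shift
  -- of `K` by one.
  let K : ℕ → ℕ := fun i => k (Fin.ofNat (n + 1) i)
  let a' : ℕ → Fin P.χ → ℂ := fun i => a (Fin.ofNat (n + 1) i)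
  have ha' : ∀ j : Fin (n + 1), a j = a' j := fun j => by simp [a']
  have hkK : ∀ j : Fin (n + 1), (k j : ℕ) = K j := fun j => by simp [K]
  have hK1 : ∀ i, i < n → K i + (2 * r + 2) ≤ K (i + 1) := by
    intro i hi
    have := hk ⟨i, hi⟩
    rw [hkK, hkK] at this
    simp only [Fin.val_castSucc, Fin.val_succ] at this
    omega
  have hK : ∀ i j, i < j → j ≤ n → K i + (2 * r + 2) ≤ K j := by
    intro i j hij hj
    induction j, hij using Nat.le_induction with
    | base => exact hK1 i hj
    | succ j hij ih =>
      have := ih (by omega)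
      have := hK1 j (by omega)
      omega
  have hK0 : (n + 1) * (2 * r + 2) ≤ K 0 := by
    rw [hkK] at hk0
    exact hk0
  have hm : ∀ m, m ≤ n → (m + 1) * (2 * r + 1) ≤ K 0 := fun m h =>
    (Nat.mul_le_mul_right _ (by omega)).trans (hℓ1.trans hK0)
  let ρ : Fin (P.D x) → ℂ := Pi.single p 1
  let η : Fin (P.D x) → ℂ := Pi.single q 1
  -- The factor accumulated when `m` walls have been created from left to right; the creation number
  -- `i + 1` crosses `i` walls.
  let γ : ℕ → ℂ := fun m => ∏ i ∈ Finset.range m, ∏ j ∈ Finset.range i, P.B (P.orbit x j)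
  have hγ : ∀ m, γ (m + 1) = γ m * ∏ j ∈ Finset.range m, P.B (P.orbit x j) := fun m =>
    Finset.prod_range_succ _ _
  have h0 : ∀ K, (fun s => word (P.A x) (List.ofFn s) p q) = γ 0 • P.wallsVector x ρ η a' N 0 K := by
    intro K
    rw [wallsVector_zero]
    funext s
    simp [γ, ρ, η]
  have e1 := orderedProd_mulVec (fun j => stringOp P.T P.E (k j) (a j))
    (fun m => γ m • P.wallsVector x ρ η a' N m K) fun j => by
      rw [Matrix.mulVec_smul, ha', stringOp_wallsVector (K := K) (k j)
        (fun i l hil hl => hK i l hil (by have := j.isLt; omega))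
        (hm j (by have := j.isLt; omega)) (hkK j), hγ, smul_smul]
  have e2 := orderedProd_mulVec (fun j => stringOp P.T P.E (k (finRotate _ j)) (a j))
    -- The first `n` creations, at the shifted sites, accumulate `γ n` as in the original order; the
    -- last one, at `K 0`, adds no factor.
    (fun m => if m ≤ n then γ m • P.wallsVector x ρ η a' N m (fun i => K (i + 1)) else
      γ n • P.wallsVector x ρ η a' N m K) fun j => by
      have hj := j.isLt
      have hrot : ((k (finRotate _ j) : Fin N) : ℕ) = K (j + 1) := by
        simp only [K]
        congr 2
        rw [finRotate_apply]
        refine Fin.ext ?_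
        simp [Fin.val_add]
      rw [if_pos (by omega), Matrix.mulVec_smul, ha']
      rcases Nat.lt_or_ge j n with h | h
      · rw [if_pos (by omega), stringOp_wallsVector (K := fun i => K (i + 1)) _
          (fun i l hil hl => hK _ _ (by omega) (by omega)) ?_ hrot, hγ, smul_smul]
        have := hm j (by omega)
        have := hK1 0 (by omega)
        simp only [Nat.zero_add] at this ⊢
        omega
      · have hjn : (j : ℕ) = n := by omega
        have hKn : K (n + 1) = K 0 := by simp [K]
        rw [if_neg (by omega), hjn]
        rw [hjn] at hrot
        rw [stringOp_wallsVector_zero (K := K) _ ?_ (hm n le_rfl) (hrot.trans hKn)]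
        intro h
        have := hK1 0 h
        simp only [Nat.zero_add] at this
        omega
  simp only [Nat.zero_le, if_true] at e2
  rw [if_neg (by omega)] at e2
  conv_rhs => rw [h0 fun i => K (i + 1), e2]
  rw [h0 K, e1, hγ, smul_smul, mul_comm]

end WallData


/-! ### Right and left wall operators as instances of the general interchange -/

section Exchange

variable {G : Type*} [Group G] {d : ℕ} {U : MPURep G d} {I : Type*} [MulAction G I]
  {S : GroundStates U I} {r : ℕ}

/-- Contracting the physical index with a letter of block `x` selects the coefficient of that block
and of that pair of bond indices. The blocks must be separated because the endpoints sum over all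
ground states. -/
theorem IsBlockLeftInverse.sum_smul [Fintype I]
    {Ahat : ∀ x, Fin d → Matrix (Fin (S.D x)) (Fin (S.D x)) ℂ} (h : IsBlockLeftInverse S Ahat)
    {M : Type*} [AddCommMonoid M] [Module ℂ M]
    (f : ∀ x, Fin (S.D x) → Fin (S.D x) → M) (x : I) (α β : Fin (S.D x)) :
    ∑ j, S.A x j α β • ∑ y, ∑ α', ∑ β', Ahat y j α' β' • f y α' β' = f x α β := by
  classical
  have h1 : ∀ y α' β', ∑ j, (S.A x j α β * Ahat y j α' β') • f y α' β'
      = if h : x = y then (if h ▸ α = α' ∧ h ▸ β = β' then f y α' β' else 0) else 0 := by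
    intro y α' β'
    rw [← Finset.sum_smul]
    split_ifs with hxy hαβ
    · subst hxy
      simp only [mul_comm, h.1 x α' β' α β]
      simp [hαβ.1.symm, hαβ.2.symm]
    · subst hxy
      simp only [mul_comm, h.1 x α' β' α β]
      rw [if_neg, zero_smul]
      exact fun hh => hαβ ⟨hh.1.symm, hh.2.symm⟩
    · simp only [mul_comm, h.2 y x (Ne.symm hxy), zero_smul]
  simp only [Finset.smul_sum, smul_smul]
  rw [Finset.sum_comm, Finset.sum_eq_single x]
  · rw [Finset.sum_comm]
    simp only [Finset.sum_comm (s := Finset.univ (α := Fin d)), h1]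
    simp [ite_and]
  · intro y _ hy
    rw [Finset.sum_comm]
    simp only [Finset.sum_comm (s := Finset.univ (α := Fin d)), h1]
    simp [hy.symm]
  · simp

theorem orderedProd_submatrix {ι κ : Type*} [Fintype ι] [DecidableEq ι] [Fintype κ] [DecidableEq κ]
    (f : κ ≃ ι) {n : ℕ} (O : Fin (n + 1) → Matrix ι ι ℂ) :
    orderedProd (fun j => (O j).submatrix f f) = (orderedProd O).submatrix f f := by
  have := map_list_prod (Matrix.reindexAlgEquiv ℂ ℂ f.symm) (List.ofFn O).reverse
  simp only [Matrix.coe_reindexAlgEquiv, Matrix.reindex_apply, Equiv.symm_symm,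
    List.map_reverse, List.map_ofFn] at this
  exact this.symm

theorem sum_rightEnd [Fintype I] (W : ActionTensors S r) (e : WallTensors S)
    {Ahat : ∀ x, Fin d → Matrix (Fin (S.D x)) (Fin (S.D x)) ℂ} (hAhat : IsBlockLeftInverse S Ahat)
    (g : G) (x : I) (i : Fin d) (v : Fin (S.D x) → ℂ) (c : Fin (U.χ g) × Fin (S.D x)) :
    ∑ j, rightEnd W e Ahat g i j c.1 * (S.A x j *ᵥ v) c.2 = (W.W g x *ᵥ (e (g • x) x i *ᵥ v)) c := by
  have h : ∀ γ, ∑ j, S.A x j c.2 γ * rightEnd W e Ahat g i j c.1 = (W.W g x * e (g • x) x i) c γ := by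
    intro γ
    refine Eq.trans (Finset.sum_congr rfl fun j _ => ?_) (hAhat.sum_smul
      (fun y α β => ∑ δ, W.W g y (c.1, α) δ * e (g • y) y i δ β) x c.2 γ)
    simp only [rightEnd, smul_eq_mul, Finset.mul_sum, mul_assoc]
  rw [Matrix.mulVec_mulVec]
  simp only [Matrix.mulVec, dotProduct, ← h, Finset.mul_sum, Finset.sum_mul]
  rw [Finset.sum_comm]
  exact Finset.sum_congr rfl fun γ _ => Finset.sum_congr rfl fun j _ => by ring

theorem sum_leftEnd [Fintype I] (W : ActionTensors S r) (e : WallTensors S)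
    {Ahat : ∀ x, Fin d → Matrix (Fin (S.D x)) (Fin (S.D x)) ℂ} (hAhat : IsBlockLeftInverse S Ahat)
    (g : G) (x : I) (i : Fin d) (v : Fin (S.D x) → ℂ) (c : Fin (U.χ g) × Fin (S.D x)) :
    ∑ j, leftEnd W e Ahat g i j c.1 * ((S.A x j)ᵀ *ᵥ v) c.2
      = ((W.Wh g x)ᵀ *ᵥ ((e x (g • x) i)ᵀ *ᵥ v)) c := by
  have h : ∀ γ, ∑ j, S.A x j γ c.2 * leftEnd W e Ahat g i j c.1 = (e x (g • x) i * W.Wh g x) γ c := by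
    intro γ
    refine Eq.trans (Finset.sum_congr rfl fun j _ => ?_) (hAhat.sum_smul
      (fun y α β => ∑ δ, e y (g • y) i α δ * W.Wh g y δ (c.1, β)) x γ c.2)
    simp only [leftEnd, smul_eq_mul, Finset.mul_sum, mul_assoc]
  rw [Matrix.mulVec_mulVec, ← Matrix.transpose_mul]
  simp only [Matrix.mulVec, dotProduct, Matrix.transpose_apply, ← h, Finset.mul_sum, Finset.sum_mul]
  rw [Finset.sum_comm]
  exact Finset.sum_congr rfl fun γ _ => Finset.sum_congr rfl fun j _ => by ring

/-- The data for the strings with right endpoints. -/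
def rightWallData [Fintype I] {W : ActionTensors S r} {e : WallTensors S}
    {B : G → I → I → ℂˣ} (hB : IsWallPhase W e B)
    {Ahat : ∀ x, Fin d → Matrix (Fin (S.D x)) (Fin (S.D x)) ℂ} (hAhat : IsBlockLeftInverse S Ahat)
    (g : G) : WallData d I r where
  φ x := g • x
  χ := U.χ g
  D := S.D
  T := U.T g
  A := S.A
  W := W.W g
  Wh := W.Wh g
  strong := W.strong g
  e x := e (g • x) x
  B x := B g (g • x) x
  phase x u v i hu hv := hB g (g • x) x u v i hu hv
  E := rightEnd W e Ahat g
  create := sum_rightEnd W e hAhat g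

theorem IsInjective.transpose {σ n : Type*} [Fintype σ] [DecidableEq n] {A : σ → Matrix n n ℂ}
    (h : IsInjective A) : IsInjective fun i => (A i)ᵀ := by
  obtain ⟨Ahat, h⟩ := h
  refine ⟨fun i => (Ahat i)ᵀ, fun a b a' b' => ?_⟩
  simpa [and_comm] using h b a b' a'

theorem act_transpose {m n n' : Type*} (T : Fin d → Fin d → Matrix m m ℂ)
    (A : Fin d → Matrix n n' ℂ) :
    act (fun i j => (T i j)ᵀ) (fun j => (A j)ᵀ) = fun i => (act T A i)ᵀ := by
  funext i
  simp only [act, Matrix.transpose_sum]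
  rfl

/-- The data for the strings with left endpoints, read from right to left. -/
def leftWallData [Fintype I] {W : ActionTensors S r} {e : WallTensors S}
    {B : G → I → I → ℂˣ} (hB : IsWallPhase W e B)
    {Ahat : ∀ x, Fin d → Matrix (Fin (S.D x)) (Fin (S.D x)) ℂ} (hAhat : IsBlockLeftInverse S Ahat)
    (g : G) : WallData d I r where
  φ x := g • x
  χ := U.χ g
  D := S.D
  T i j := (U.T g i j)ᵀ
  A x i := (S.A x i)ᵀ
  W x := (W.Wh g x)ᵀ
  Wh x := (W.W g x)ᵀ
  strong x := by
    have h := (W.isReduction g x).transpose.strong (S.injective _).transpose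
    rw [← act_transpose] at h
    exact h
  e x i := (e x (g • x) i)ᵀ
  -- Transposition exchanges the two sides of a wall, hence the lower indices of the phase.
  B x := B g x (g • x)
  phase x u v i hu hv := by
    have h := congrArg Matrix.transpose (hB g x (g • x) v.reverse u.reverse i (by simpa) (by simpa))
    simp only [act_transpose, word_transpose]
    simp only [Matrix.transpose_smul, Matrix.transpose_mul, Matrix.mul_assoc] at h ⊢
    exact h
  E := leftEnd W e Ahat g
  create := sum_leftEnd W e hAhat g

theorem ofFn_comp_rev {α : Type*} {N : ℕ} (f : Fin N → α) :
    (List.ofFn fun l => f l.rev) = (List.ofFn f).reverse := by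
  refine List.ext_getElem (by simp) fun i h1 h2 => ?_
  simp only [List.getElem_ofFn, List.getElem_reverse, List.length_ofFn]
  congr 1
  refine Fin.ext ?_
  simp only [List.length_ofFn] at h1
  simp only [Fin.val_rev]
  omega

/-- The reflection of a configuration on a segment. -/
def reflect (d N : ℕ) : (Fin N → Fin d) ≃ (Fin N → Fin d) := Equiv.arrowCongr Fin.revPerm (Equiv.refl _)

/-- Reflecting the chain reverses the product along the string, and transposing the tensors restores
its order. -/
theorem leftWallOp_eq_stringOp [Fintype I] (W : ActionTensors S r) (e : WallTensors S)
    (Ahat : ∀ x, Fin d → Matrix (Fin (S.D x)) (Fin (S.D x)) ℂ) (g : G) {N : ℕ}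
    (k : Fin N) (a : Fin (U.χ g) → ℂ) :
    leftWallOp W e Ahat g k a = (stringOp (fun i j => (U.T g i j)ᵀ) (leftEnd W e Ahat g) k.rev
      a).submatrix (reflect d N) (reflect d N) := by
  ext s t
  have hr : ∀ (s : Fin N → Fin d) l, reflect d N s l = s l.rev := fun s l => rfl
  have h1 : (∀ l, k.rev < l → s l.rev = t l.rev) ↔ ∀ l, l < k → s l = t l := by
    refine ⟨fun h l hl => by simpa using h l.rev (by simpa using hl), fun h l hl => ?_⟩
    exact h _ (by rwa [← Fin.rev_lt_rev, Fin.rev_rev])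
  have h2 : (List.ofFn fun l : Fin N => if l < k.rev then (U.T g (s l.rev) (t l.rev))ᵀ else 1).prod
      = ((List.ofFn fun l => if k < l then U.T g (s l) (t l) else 1).prod)ᵀ := by
    rw [Matrix.transpose_list_prod, List.map_ofFn, ← ofFn_comp_rev]
    congr 2
    funext l
    have : l < k.rev ↔ k < l.rev := by rw [← Fin.rev_lt_rev, Fin.rev_rev]
    simp only [this, Function.comp]
    split_ifs <;> simp
  simp only [leftWallOp, stringOp, Matrix.submatrix_apply, hr, h1, h2, Fin.rev_rev,
    Matrix.mulVec_transpose]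
  simp only [dotProduct_comm a]

theorem rightWallOp_exchange [Fintype I] {W : ActionTensors S r} {e : WallTensors S}
    {B : G → I → I → ℂˣ} (hB : IsWallPhase W e B)
    {Ahat : ∀ x, Fin d → Matrix (Fin (S.D x)) (Fin (S.D x)) ℂ} (hAhat : IsBlockLeftInverse S Ahat)
    (g : G) {n N : ℕ} (k : Fin (n + 1) → Fin N) (a : Fin (n + 1) → Fin (U.χ g) → ℂ) (x : I)
    (p q : Fin (S.D x))
    (hk : ∀ j : Fin n, (k j.castSucc : ℕ) + (n + 1) * (2 * r + 2) ≤ k j.succ)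
    (hk0 : (n + 1) * (2 * r + 2) ≤ (k 0 : ℕ)) :
    orderedProd (fun j => rightWallOp W e Ahat g (k j) (a j)) *ᵥ segmentState S x N p q
      = ((∏ i ∈ Finset.range n, B g (g ^ (i + 1) • x) (g ^ i • x) : ℂˣ) : ℂ) •
        (orderedProd (fun j => rightWallOp W e Ahat g (k (finRotate _ j)) (a j)) *ᵥ
          segmentState S x N p q) := by
  have ho : ∀ i, (rightWallData hB hAhat g).orbit x i = g ^ i • x := by
    intro i
    induction i with
    | zero => simp [WallData.orbit]
    | succ i ih => rw [pow_succ', mul_smul, ← ih]; rfl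
  have h := (rightWallData hB hAhat g).exchange k a x p q hk hk0
  have hb : ∀ i, (rightWallData hB hAhat g).B ((rightWallData hB hAhat g).orbit x i)
      = B g (g ^ (i + 1) • x) (g ^ i • x) := by
    intro i
    rw [ho, pow_succ', mul_smul]
    rfl
  simp only [hb] at h
  rw [Units.coe_prod]
  exact h

/-- The mirror image of `rightWallOp_exchange`. -/
theorem leftWallOp_exchange [Fintype I] {W : ActionTensors S r} {e : WallTensors S}
    {B : G → I → I → ℂˣ} (hB : IsWallPhase W e B)
    {Ahat : ∀ x, Fin d → Matrix (Fin (S.D x)) (Fin (S.D x)) ℂ} (hAhat : IsBlockLeftInverse S Ahat)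
    (g : G) {n N : ℕ} (k : Fin (n + 1) → Fin N) (a : Fin (n + 1) → Fin (U.χ g) → ℂ) (x : I)
    (p q : Fin (S.D x))
    (hk : ∀ j : Fin n, (k j.succ : ℕ) + (n + 1) * (2 * r + 2) ≤ k j.castSucc)
    (hk0 : (k 0 : ℕ) + (n + 1) * (2 * r + 2) < N) :
    orderedProd (fun j => leftWallOp W e Ahat g (k j) (a j)) *ᵥ segmentState S x N p q
      = ((∏ i ∈ Finset.range n, B g (g ^ i • x) (g ^ (i + 1) • x) : ℂˣ) : ℂ) •
        (orderedProd (fun j => leftWallOp W e Ahat g (k (finRotate _ j)) (a j)) *ᵥ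
          segmentState S x N p q) := by
  have ho : ∀ i, (leftWallData hB hAhat g).orbit x i = g ^ i • x := by
    intro i
    induction i with
    | zero => simp [WallData.orbit]
    | succ i ih => rw [pow_succ', mul_smul, ← ih]; rfl
  -- The reflection also exchanges the outer bond indices `p` and `q`, and the distance to the right
  -- end becomes a distance to the left end.
  have h := (leftWallData hB hAhat g).exchange (fun j => (k j).rev) a x q p
    (fun j => by
      have := hk j
      have := (k j.castSucc).isLt
      simp only [Fin.val_rev]
      omega) (by
      simp only [Fin.val_rev]
      omega)
  have hb : ∀ i, (leftWallData hB hAhat g).B ((leftWallData hB hAhat g).orbit x i)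
      = B g (g ^ i • x) (g ^ (i + 1) • x) := by
    intro i
    rw [ho, pow_succ', mul_smul]
    rfl
  have hs : segmentState S x N p q ∘ (reflect d N).symm
      = fun s => word (fun i => (S.A x i)ᵀ) (List.ofFn s) q p := by
    funext s
    rw [word_transpose, ← ofFn_comp_rev]
    rfl
  simp only [hb] at h
  simp only [leftWallOp_eq_stringOp, orderedProd_submatrix, Matrix.submatrix_mulVec_equiv, hs]
  rw [Units.coe_prod]
  exact congrArg (· ∘ reflect d N) h

end Exchange


/-! ### Independence of the choices and the main theorem -/

section Main

variable {G : Type*} [Group G] {d : ℕ} {U : MPURep G d} {I : Type*} [MulAction G I]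
  {S : GroundStates U I} {r r' : ℕ}

/-- A bond dimension of zero would force the wall tensor from a ground state to itself to vanish. -/
theorem WallTensors.D_pos {e : WallTensors S} (he0 : ∀ x y, e x y ≠ 0) (x : I) : 0 < S.D x := by
  by_contra h
  have : IsEmpty (Fin (S.D x)) := by
    rw [Nat.eq_zero_of_not_pos h]; infer_instance
  exact he0 x x (funext fun i => Matrix.ext fun a => this.elim a)

theorem WallTensors.d_pos [Nonempty I] {e : WallTensors S} (he0 : ∀ x y, e x y ≠ 0) : 0 < d := by
  obtain ⟨x⟩ := ‹Nonempty I›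
  by_contra h
  have : IsEmpty (Fin d) := by
    rw [Nat.eq_zero_of_not_pos h]; infer_instance
  exact he0 x x (funext fun i => this.elim i)

/-- Both sets of tensors are regarded as having length `max r r'`, where an L-symbol relates them.
The left side involves only the action tensors and the right side only the fusion tensors, so
neither depends on any choice, nor on `x`. -/
theorem IsAssociator.prod_eq_wallPhase {F : FusionTensors U r} {W : ActionTensors S r'}
    {ω : G → G → G → ℂˣ} (hω : IsAssociator F ω) {e : WallTensors S} {B : G → I → I → ℂˣ}
    (hB : IsWallPhase W e B) (he0 : ∀ x y, e x y ≠ 0) (g : G) (x : I) :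
    ∏ i ∈ Finset.Icc 1 (orderOf g), B g (g ^ i • x) (g ^ (i - 1) • x)
        = ∏ i ∈ Finset.Icc 1 (orderOf g), (ω g (g ^ i) g)⁻¹ ∧
      ∏ i ∈ Finset.Icc 1 (orderOf g), B g (g ^ (i - 1) • x) (g ^ i • x)
        = (∏ i ∈ Finset.Icc 1 (orderOf g), (ω g (g ^ i) g)⁻¹)⁻¹ := by
  have hD := WallTensors.D_pos he0
  have hB' := hB.mono (le_max_right r r')
  obtain ⟨L, hL, -⟩ := existsUnique_isLSymbol (F.mono (le_max_left r r')) _ hD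
  rw [(hω.mono (le_max_left r r')).prod_orderOf hL hD g x, hB'.prod_orderOf hL he0 hD,
    hB'.prod_orderOf_swap hL he0 hD]
  exact ⟨rfl, rfl⟩

theorem IsAssociator.isCocycle_of_wallTensors [Finite G] [Finite I] [Nonempty I]
    {F : FusionTensors U r} {ω : G → G → G → ℂˣ} (hω : IsAssociator F ω) {e : WallTensors S}
    (he0 : ∀ x y, e x y ≠ 0) : IsCocycle ω := by
  have hD := WallTensors.D_pos he0
  obtain ⟨r', ⟨W⟩⟩ := exists_actionTensors S hD
  obtain ⟨L, hL, -⟩ := existsUnique_isLSymbol (F.mono (le_max_left r r'))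
    (W.mono (le_max_right r r')) hD
  exact (hω.mono _).isCocycle hL hD

end Main

end DomainWall

end

theorem mainTheorem4 {G I : Type*} [Group G] [Finite G] [Fintype I] [Nonempty I] [MulAction G I]
    [MulAction.IsPretransitive G I] {d : ℕ}
    (U : DomainWall.MPURep G d) (S : DomainWall.GroundStates U I)
    (e : DomainWall.WallTensors S) (he0 : ∀ x y, e x y ≠ 0) (he : DomainWall.PermutesWalls e)
    (g : G) (hg : g ∉ DomainWall.unbroken G I) :
    -- fusion and action tensors exist
    (∃ r, Nonempty (DomainWall.FusionTensors U r) ∧ Nonempty (DomainWall.ActionTensors S r)) ∧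
    -- one phase factor for all ground states and all choices of fusion and action tensors
    ∃ Θ : ℂˣ, ‖(Θ : ℂ)‖ = 1 ∧
      -- it is the product of the local domain wall phases
      (∀ r (W : DomainWall.ActionTensors S r),
        (∃! B, DomainWall.IsWallPhase W e B) ∧
        ∀ B, DomainWall.IsWallPhase W e B → ∀ x : I,
          ∏ i ∈ Finset.Icc 1 (orderOf g), B g (g ^ i • x) (g ^ (i - 1) • x) = Θ ∧
          ∏ i ∈ Finset.Icc 1 (orderOf g), B g (g ^ (i - 1) • x) (g ^ i • x) = Θ⁻¹) ∧
      -- it is determined by the 3-cocycle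
      (∀ r (F : DomainWall.FusionTensors U r),
        (∃! ω, DomainWall.IsAssociator F ω) ∧
        ∀ ω, DomainWall.IsAssociator F ω →
          DomainWall.IsCocycle ω ∧
          Θ = ∏ i ∈ Finset.Icc 1 (orderOf g), (ω g (g ^ i) g)⁻¹ ∧
          (DomainWall.IsCoboundary ω → Θ = 1)) ∧
      -- it is determined by the L-symbols
      (∀ r (F : DomainWall.FusionTensors U r) (W : DomainWall.ActionTensors S r),
        (∃! L, DomainWall.IsLSymbol F W L) ∧
        ∀ L, DomainWall.IsLSymbol F W L → ∀ x : I,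
          Θ = ∏ i ∈ Finset.Icc 1 (orderOf g), L (g • x) g (g ^ i) / L x g (g ^ i) ∧
          ∀ B, DomainWall.IsWallPhase W e B → B 1 (g • x) x = 1 →
            Θ = ∏ i ∈ Finset.Icc 1 (orderOf g - 1), L (g • x) g (g ^ i) / L x g (g ^ i)) ∧
      -- it is trivial for on-site symmetries
      (U.IsOnSite → Θ = 1) ∧
      -- it is the phase of the cyclic interchange of `orderOf g + 1` domain walls
      (∀ r, ∃ ℓ : ℕ, ∀ (W : DomainWall.ActionTensors S r)
          (Ahat : ∀ x, Fin d → Matrix (Fin (S.D x)) (Fin (S.D x)) ℂ),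
        DomainWall.IsBlockLeftInverse S Ahat →
        ∀ (N : ℕ) (k : Fin (orderOf g + 1) → Fin N)
          (a : Fin (orderOf g + 1) → Fin (U.χ g) → ℂ) (x : I) (p q : Fin (S.D x)),
          ((∀ j : Fin (orderOf g), (k j.castSucc : ℕ) + ℓ ≤ k j.succ) → ℓ ≤ (k 0 : ℕ) →
            DomainWall.orderedProd
                (fun j => DomainWall.rightWallOp W e Ahat g (k j) (a j)) *ᵥ
                DomainWall.segmentState S x N p q
              = (Θ : ℂ) • (DomainWall.orderedProd
                (fun j => DomainWall.rightWallOp W e Ahat g (k (finRotate _ j)) (a j)) *ᵥ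
                DomainWall.segmentState S x N p q)) ∧
          ((∀ j : Fin (orderOf g), (k j.succ : ℕ) + ℓ ≤ k j.castSucc) → (k 0 : ℕ) + ℓ < N →
            DomainWall.orderedProd
                (fun j => DomainWall.leftWallOp W e Ahat g (k j) (a j)) *ᵥ
                DomainWall.segmentState S x N p q
              = ((Θ⁻¹ : ℂˣ) : ℂ) • (DomainWall.orderedProd
                (fun j => DomainWall.leftWallOp W e Ahat g (k (finRotate _ j)) (a j)) *ᵥ
                DomainWall.segmentState S x N p q))) := by
  have hd := DomainWall.WallTensors.d_pos he0
  have hD := DomainWall.WallTensors.D_pos he0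
  obtain ⟨r₁, ⟨F₀⟩⟩ := DomainWall.exists_fusionTensors U hd
  obtain ⟨r₂, ⟨W₀⟩⟩ := DomainWall.exists_actionTensors S hD
  obtain ⟨ω₀, hω₀, -⟩ := DomainWall.existsUnique_isAssociator F₀ hd
  obtain ⟨B₀, hB₀, -⟩ := DomainWall.existsUnique_isWallPhase W₀ he0 he
  obtain ⟨x₀⟩ := ‹Nonempty I›
  have : Nonempty I := ⟨x₀⟩
  -- Any two associators are compared through the wall phases of the fixed action tensors `W₀`.
  have hω : ∀ r (F : DomainWall.FusionTensors U r) (ω : G → G → G → ℂˣ),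
      DomainWall.IsAssociator F ω →
        ∏ i ∈ Finset.Icc 1 (orderOf g), (ω₀ g (g ^ i) g)⁻¹
          = ∏ i ∈ Finset.Icc 1 (orderOf g), (ω g (g ^ i) g)⁻¹ := fun r F ω h =>
    (hω₀.prod_eq_wallPhase hB₀ he0 g x₀).1.symm.trans (h.prod_eq_wallPhase hB₀ he0 g x₀).1
  -- The distance `(orderOf g + 1) * (2 * r + 2)` leaves `2 * r + 1` sites between neighbouring
  -- walls and room at the end for the frames of all `orderOf g + 1` strings, each of which takes `2
  -- * r + 1` sites.
  refine ⟨⟨max r₁ r₂, ⟨F₀.mono (le_max_left _ _)⟩, ⟨W₀.mono (le_max_right _ _)⟩⟩,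
    ∏ i ∈ Finset.Icc 1 (orderOf g), (ω₀ g (g ^ i) g)⁻¹,
    (hω₀.isCocycle_of_wallTensors he0).norm_prod g, fun r W => ?_, fun r F => ?_, fun r F W => ?_,
    fun hU => (hU.isCoboundary hd hω₀).prod_eq_one g, fun r => ⟨(orderOf g + 1) * (2 * r + 2), fun W Ahat hA N k a x p q =>
      ⟨fun hk hk0 => ?_, fun hk hk0 => ?_⟩⟩⟩
  · exact ⟨DomainWall.existsUnique_isWallPhase W he0 he, fun B hB x =>
      hω₀.prod_eq_wallPhase hB he0 g x⟩
  · exact ⟨DomainWall.existsUnique_isAssociator F hd, fun ω h =>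
      ⟨h.isCocycle_of_wallTensors he0, hω r F ω h, fun hc =>
        (hω r F ω h).trans (hc.prod_eq_one g)⟩⟩
  · refine ⟨DomainWall.existsUnique_isLSymbol F W hD, fun L hL x => ?_⟩
    obtain ⟨ω, h, -⟩ := DomainWall.existsUnique_isAssociator F hd
    have key := (hω r F ω h).trans (h.prod_orderOf hL hD g x)
    refine ⟨key, fun B hB hB1 => key.trans ?_⟩
    -- The last factor of the product involves $g^{o(g)}=1$, where the two L-symbols agree in the
    -- chosen gauge.
    obtain ⟨n, hn⟩ : ∃ n, orderOf g = n + 1 := ⟨orderOf g - 1, by have := orderOf_pos g; omega⟩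
    have h1 : g ^ (n + 1) = 1 := by rw [← hn, pow_orderOf_eq_one]
    rw [hn, Finset.prod_Icc_succ_top (by omega), h1, hB.lSymbol_one hL he0 hD g hB1, div_self',
      mul_one, Nat.add_sub_cancel]
  · obtain ⟨B, hB, -⟩ := DomainWall.existsUnique_isWallPhase W he0 he
    rw [← (hω₀.prod_eq_wallPhase hB he0 g x).1, DomainWall.prod_Icc_one]
    exact DomainWall.rightWallOp_exchange hB hA g k a x p q hk hk0
  · obtain ⟨B, hB, -⟩ := DomainWall.existsUnique_isWallPhase W he0 he
    rw [← (hω₀.prod_eq_wallPhase hB he0 g x).2, DomainWall.prod_Icc_one]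
    exact DomainWall.leftWallOp_exchange hB hA g k a x p q hk hk0
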